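/- **Setting.** Let $T>0$, $r_0>0$, $H\in(\tfrac12,1)$, and let $W=(W^1,\dots,W^m)$ be independent (continuous) fractional Brownian motions on $[0,T]$ with Hurst parameter $H$ on a probability space $(\Omega,\mathcal F,P)$. For $a<b$ and $f:[a,b]\to\mathbb R^d$ put $$\|f\|_{\alpha,\infty(a,b)}=\sup_{t\in[a,b]}\Big(|f(t)|+\int_a^t\frac{|f(t)-f(s)|}{(t-s)^{\alpha+1}}\,ds\Big),$$ let $W_0^{\alpha,\infty}(a,b;\mathbb R^d)$ be the space of measurable $f$ for which this is finite, let $C^{\lambda}(a,b;\mathbb R^d)$ be the space of $\lambda$-Hölder continuous functions, and write $\|\cdot\|_{\alpha,\infty}=\|\cdot\|_{\alpha,\infty(0,T)}$. **Hypotheses.** (H1) $\sigma:[0,T]\times\mathbb R^d\to\mathbb R^{d\times m}$ is measurable, $\sigma(t,x)$ is differentiable in $x$, and there are $\beta,\delta\in(0,1]$ and, for every $N\ge0$, a constant $M_N>0$ such that for all $s,t\in[0,T]$ and $i=1,\dots,d$: $|\sigma(t,x)-\sigma(t,y)|\le M_0|x-y|$ for all $x,y\in\mathbb R^d$; $|\partial_{x_i}\sigma(t,x)-\partial_{x_i}\sigma(t,y)|\le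 M_N|x-y|^\delta$ for all $|x|,|y|\le N$; and $|\sigma(t,x)-\sigma(s,x)|+|\partial_{x_i}\sigma(t,x)-\partial_{x_i}\sigma(s,x)|\le M_0|t-s|^\beta$ for all $x\in\mathbb R^d$. (H2') $b:[0,T]\times\mathbb R^d\to\mathbb R^d$ is measurable, and there are $\rho\ge2$, $b_0\in L^\rho(0,T)$ and, for every $N\ge0$, a constant $L_N>0$ such that for all $t\in[0,T]$: $|b(t,x)-b(t,y)|\le L_N|x-y|$ for all $|x|,|y|\le N$, and $|b(t,x)|\le L_0|x|+b_0(t)$ for all $x\in\mathbb R^d$. (H3) There are $\gamma\in[0,1]$ and $K_0>0$ such that $|\sigma(t,x)|\le K_0(1+|x|^\gamma)$ for all $t\in[0,T]$, $x\in\mathbb R^d$. **Theorem.** Assume (H1) and (H2') with $\beta>1-H$ and $\delta>\frac1H-1$, and set $\alpha_0=\min\{\tfrac12,\beta,\tfrac{\delta}{1+\delta}\}$. Let $\alpha>1-H$ with $\rho\le\frac1\alpha$, and let $\eta\in W_0^{\alpha,\infty}(-r_0,0;\mathbb R^d)\cap C^{1-\alpha}(-r_0,0;\mathbb R^d)$.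 For $r\in(0,r_0]$ let $X^r$ be a process with paths almost surely in $W_0^{\alpha,\infty}(-r,T;\mathbb R^d)$ solving $$X^r(t)=\eta(0)+\int_0^t b(s,X^r(s))\,ds+\int_0^t\sigma(s,X^r(s-r))\,dW_s,\quad t\in(0,T],\qquad X^r(t)=\eta(t),\quad t\in[-r,0],$$ and let $X$ be a process with paths almost surely in $W_0^{\alpha,\infty}(0,T;\mathbb R^d)$ solving $$X(t)=\eta(0)+\int_0^t b(s,X(s))\,ds+\int_0^t\sigma(s,X(s))\,dW_s,\quad t\in[0,T],$$ where the integrals with respect to $W$ are pathwise Riemann–Stieltjes integrals. 1. If $\alpha\in(1-H,\alpha_0)$ and, for almost every $\omega$, the path $X^r(\omega,\cdot)$ solves its equation for all $r\in(0,r_0]$ simultaneously, then for $P$-almost all $\omega$ $$\lim_{r\downarrow0}\|X(\omega,\cdot)-X^r(\omega,\cdot)\|_{\alpha,\infty}=0.$$ 2. If (H3) holds and $\alpha\in\big(1-H,\ \alpha_0\vee\tfrac{2-\gamma}{4}\big)$, where $\vee$ denotes the maximum, then $$\lim_{r\downarrow0}E\big(\|X-X^r\|_{\alpha,\infty}^p\big)=0\qquad\text{for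 every }p\ge1.$$ -/

import Mathlib

open MeasureTheory ProbabilityTheory Filter Topology Set
open scoped ENNReal

namespace DelayFBM

noncomputable section

/-- The norm `‖f‖_{α,∞}` on `[a, b]`, with value `∞` when it is not finite:
`sup_{t ∈ [a,b]} ( |f t| + ∫_a^t |f t - f s| / (t - s)^(α+1) ds )`. -/
def wNorm {E : Type*} [NormedAddCommGroup E] (α a b : ℝ) (f : ℝ → E) : ℝ≥0∞ :=
  ⨆ t ∈ Icc a b,
    (‖f t‖ₑ + ∫⁻ s in Ioo a t, ‖f t - f s‖ₑ / ENNReal.ofReal ((t - s) ^ (α + 1)))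

/-- The space `W_0^{α,∞}(a, b; E)`. Only the values of `f` on `[a, b]` matter. -/
def MemW {E : Type*} [NormedAddCommGroup E] [MeasurableSpace E] (α a b : ℝ) (f : ℝ → E) : Prop :=
  Measurable (fun t : Icc a b => f t) ∧ wNorm α a b f < ∞

/-- The `lam`-Hölder norm on `[a, b]`, with value `∞` when it is not finite. -/
def holderNorm {E : Type*} [NormedAddCommGroup E] (lam a b : ℝ) (f : ℝ → E) : ℝ≥0∞ :=
  (⨆ t ∈ Icc a b, ‖f t‖ₑ) +
    ⨆ t ∈ Icc a b, ⨆ s ∈ Ico a t, ‖f t - f s‖ₑ / ENNReal.ofReal ((t - s) ^ lam)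

/-- The space `C^lam(a, b; E)` of Hölder continuous functions. -/
def MemHolder {E : Type*} [NormedAddCommGroup E] (lam a b : ℝ) (f : ℝ → E) : Prop :=
  holderNorm lam a b f < ∞

/-- The Riemann-Stieltjes integral of `f` with respect to `g` over `[a, b]` exists and equals `I`:
the sums `∑ (g (t_{i+1}) - g (t_i)) f (ξ_i)` tend to `I` as the mesh of the partition
`a = t_0 ≤ t_1 ≤ … ≤ t_n = b` tends to zero, whatever the tags `ξ_i ∈ [t_i, t_{i+1}]`. -/
def HasRSIntegral {E : Type*} [NormedAddCommGroup E] [NormedSpace ℝ E]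
    (f : ℝ → E) (g : ℝ → ℝ) (a b : ℝ) (I : E) : Prop :=
  ∀ ε > 0, ∃ κ > 0, ∀ (n : ℕ) (t ξ : ℕ → ℝ), t 0 = a → t n = b →
    (∀ i < n, t i ≤ t (i + 1)) → (∀ i < n, t (i + 1) - t i < κ) →
    (∀ i < n, ξ i ∈ Icc (t i) (t (i + 1))) →
    ‖(∑ i ∈ Finset.range n, (g (t (i + 1)) - g (t i)) • f (ξ i)) - I‖ < ε

/-- Hypothesis (H1) with exponents `β`, `δ`. The `d × m` matrix `σ t x` is given by its columns
`σ t x j`, `j : Fin m`; the constant `M N` is the `M_N` of the hypothesis. -/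
structure HypH1 {d m : ℕ} (T β δ : ℝ)
    (σ : ℝ → EuclideanSpace ℝ (Fin d) → Fin m → EuclideanSpace ℝ (Fin d)) : Prop where
  measurable : Measurable (fun p : Icc (0 : ℝ) T × EuclideanSpace ℝ (Fin d) => σ p.1 p.2)
  differentiable : ∀ t ∈ Icc 0 T, Differentiable ℝ (σ t)
  β_mem : β ∈ Ioc (0 : ℝ) 1
  δ_mem : δ ∈ Ioc (0 : ℝ) 1
  bounds : ∃ M : ℝ → ℝ, (∀ N ≥ 0, 0 < M N) ∧
    (∀ t ∈ Icc 0 T, ∀ x y, ‖σ t x - σ t y‖ ≤ M 0 * ‖x - y‖) ∧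
    (∀ N ≥ 0, ∀ t ∈ Icc 0 T, ∀ x y, ‖x‖ ≤ N → ‖y‖ ≤ N → ∀ i : Fin d,
      ‖fderiv ℝ (σ t) x (EuclideanSpace.single i 1) -
        fderiv ℝ (σ t) y (EuclideanSpace.single i 1)‖ ≤ M N * ‖x - y‖ ^ δ) ∧
    (∀ t ∈ Icc 0 T, ∀ s ∈ Icc 0 T, ∀ x, ∀ i : Fin d,
      ‖σ t x - σ s x‖ +
        ‖fderiv ℝ (σ t) x (EuclideanSpace.single i 1) -
          fderiv ℝ (σ s) x (EuclideanSpace.single i 1)‖ ≤ M 0 * |t - s| ^ β)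

/-- Hypothesis (H2') with integrability exponent `ρ`; `L N` is the constant `L_N`. -/
structure HypH2' {d : ℕ} (T ρ : ℝ)
    (b : ℝ → EuclideanSpace ℝ (Fin d) → EuclideanSpace ℝ (Fin d)) : Prop where
  measurable : Measurable (fun p : Icc (0 : ℝ) T × EuclideanSpace ℝ (Fin d) => b p.1 p.2)
  ρ_ge : 2 ≤ ρ
  bounds : ∃ (b₀ : ℝ → ℝ) (L : ℝ → ℝ),
    MemLp b₀ (ENNReal.ofReal ρ) (volume.restrict (Icc 0 T)) ∧ (∀ N ≥ 0, 0 < L N) ∧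
    (∀ N ≥ 0, ∀ t ∈ Icc 0 T, ∀ x y, ‖x‖ ≤ N → ‖y‖ ≤ N → ‖b t x - b t y‖ ≤ L N * ‖x - y‖) ∧
    (∀ t ∈ Icc 0 T, ∀ x, ‖b t x‖ ≤ L 0 * ‖x‖ + b₀ t)

/-- Hypothesis (H3) with growth exponent `γ`. -/
def HypH3 {d m : ℕ} (T γ : ℝ)
    (σ : ℝ → EuclideanSpace ℝ (Fin d) → Fin m → EuclideanSpace ℝ (Fin d)) : Prop :=
  γ ∈ Icc (0 : ℝ) 1 ∧ ∃ K₀ > 0, ∀ t ∈ Icc 0 T, ∀ x, ‖σ t x‖ ≤ K₀ * (1 + ‖x‖ ^ γ)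

/-- `W` is a (continuous) fractional Brownian motion on `[0, T]` with Hurst parameter `H`. -/
structure IsFractionalBrownianMotion {Ω : Type*} [MeasurableSpace Ω] (P : Measure Ω) (H T : ℝ)
    (W : ℝ → Ω → ℝ) : Prop where
  gaussian : IsGaussianProcess (fun (t : Icc (0 : ℝ) T) ω => W t ω) P
  mean_zero : ∀ t ∈ Icc 0 T, ∫ ω, W t ω ∂P = 0
  covariance : ∀ s ∈ Icc 0 T, ∀ t ∈ Icc 0 T,
    ∫ ω, W s ω * W t ω ∂P = (s ^ (2 * H) + t ^ (2 * H) - |t - s| ^ (2 * H)) / 2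
  continuous : ∀ᵐ ω ∂P, ContinuousOn (fun t => W t ω) (Icc 0 T)

/-- The path `x`, driven by `g = (g 1, …, g m)`, is a solution in `W_0^{α,∞}(-r, T)` of
`x t = η 0 + ∫_0^t b (s, x s) ds + ∫_0^t σ (s, x (s - r)) dg_s`, `t ∈ (0, T]`,
`x t = η t`, `t ∈ [-r, 0]`. -/
structure IsDelaySolution {d m : ℕ} (α T r : ℝ)
    (b : ℝ → EuclideanSpace ℝ (Fin d) → EuclideanSpace ℝ (Fin d))
    (σ : ℝ → EuclideanSpace ℝ (Fin d) → Fin m → EuclideanSpace ℝ (Fin d))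
    (η : ℝ → EuclideanSpace ℝ (Fin d)) (g : Fin m → ℝ → ℝ)
    (x : ℝ → EuclideanSpace ℝ (Fin d)) : Prop where
  memW : MemW α (-r) T x
  initial : ∀ t ∈ Icc (-r) 0, x t = η t
  equation : ∀ t ∈ Ioc 0 T, IntervalIntegrable (fun s => b s (x s)) volume 0 t ∧
    ∃ I : Fin m → EuclideanSpace ℝ (Fin d),
      (∀ j, HasRSIntegral (fun s => σ s (x (s - r)) j) (g j) 0 t (I j)) ∧
      x t = η 0 + (∫ s in (0 : ℝ)..t, b s (x s)) + ∑ j, I j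

/-- The path `x`, driven by `g = (g 1, …, g m)`, is a solution in `W_0^{α,∞}(0, T)` of
`x t = x₀ + ∫_0^t b (s, x s) ds + ∫_0^t σ (s, x s) dg_s`, `t ∈ [0, T]`. -/
structure IsSolution {d m : ℕ} (α T : ℝ)
    (b : ℝ → EuclideanSpace ℝ (Fin d) → EuclideanSpace ℝ (Fin d))
    (σ : ℝ → EuclideanSpace ℝ (Fin d) → Fin m → EuclideanSpace ℝ (Fin d))
    (x₀ : EuclideanSpace ℝ (Fin d)) (g : Fin m → ℝ → ℝ)
    (x : ℝ → EuclideanSpace ℝ (Fin d)) : Prop where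
  memW : MemW α 0 T x
  equation : ∀ t ∈ Icc 0 T, IntervalIntegrable (fun s => b s (x s)) volume 0 t ∧
    ∃ I : Fin m → EuclideanSpace ℝ (Fin d),
      (∀ j, HasRSIntegral (fun s => σ s (x s) j) (g j) 0 t (I j)) ∧
      x t = x₀ + (∫ s in (0 : ℝ)..t, b s (x s)) + ∑ j, I j

end

end DelayFBM

open DelayFBM

/-! The argument is pathwise: probability enters only through the Hölder constant of the driving
path. Fix `ν` in `(1/2, H)` and let `G` be a `ν`-Hölder constant of `W` on `[0, T]`. If `θ + ν > 1`,
a Riemann-Stieltjes integral of a `θ`-Hölder integrand obeys Young's estimate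
(`HasRSIntegral.young_estimate`), obtained by comparing dyadic sums. A path in `W_0^{α,∞}` is
`α`-Hölder away from its left end (`MemW.exists_holder`), so with `θ = min α β > 1 - H` Young's
estimate applies to every solution.

A priori bounds (`exists_apriori_bound`). On time steps of length `Δ` of order `(1 + G)^(-1/ν)`,
Young's estimate bounds the Hölder constant of a solution by a contraction of itself plus data.
Hence the supremum at most doubles, up to a constant, on each step. With about `(1 + G)^(1/ν)` steps
this gives the bound `C exp (C (1 + G)^(1/ν))`, uniformly in the delay. Since `ρ ≥ 2`, the drift
term is `1/2`-Hölder, and so are the solutions on `[0, T]`; this suffices because both ranges of `α`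
lie below `1/2`.

Stability (`norm_sub_le_of_short_interval`). Write `σ(x) - σ(y(· - r))` as `σ(x) - σ(y)` plus the
effect of the delay on `y`. The latter is of order `r^(θ-κ)` in `κ`-Hölder norm, for some `κ < θ`
with `κ + ν > 1`. The former is a second difference of `σ`; its `κ`-Hölder bound requires `κ ≤ ν δ`,
which is compatible with `κ > 1 - ν` because `δ > 1/H - 1`. The exponent `ν δ` is available only if
the paths are `ν`-Hölder, while `∫ b₀` is merely `1/2`-Hölder in time; therefore increments are
measured in the clock `t + ∫_0^t b₀`, and Young's estimate is stated for such clocks. The result is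
`sup |x - y| ≤ C r^(θ-κ)`, and interpolation with the `1/2`-Hölder bounds gives convergence in
`‖·‖_{α,∞}`.

Moments. Gaussian chaining over dyadic increments makes `exp (ε G²)` integrable for some `ε > 0`
(`exists_holder_const_fractionalBrownianMotion`). As `1/ν < 2`, every power of the a priori bound is
dominated by a multiple of `exp (ε G²)`, and dominated convergence yields the `L^p` statement. -/

namespace DelayFBM

/-! ### Closing estimates by contraction. -/

section SelfImprovement

/-- A family of bounds that can be improved by a fixed contraction holds with its fixed point. -/
theorem le_of_self_improving {ι : Type*} {f w : ι → ℝ} {B₀ K q : ℝ} (hK : 0 ≤ K) (hB₀ : 0 ≤ B₀)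
    (hq : 0 ≤ q) (hq1 : q < 1) (hw : ∀ i, 0 ≤ w i) (h₀ : ∀ i, f i ≤ B₀ * w i)
    (himp : ∀ B, 0 ≤ B → (∀ i, f i ≤ B * w i) → ∀ i, f i ≤ (K + q * B) * w i) (i : ι) :
    f i ≤ K / (1 - q) * w i := by
  set S := K / (1 - q) with hS
  have h1q : 0 < 1 - q := by linarith
  have hfix : K + q * S = S := by rw [hS]; field_simp; ring
  have hS0 : 0 ≤ S := by positivity
  -- `S` is the fixed point of `B ↦ K + q B`. The size of `B₀` is irrelevant: only its finiteness is
  -- needed, as its contribution decays like `q ^ n`.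
  have key : ∀ n : ℕ, ∀ i, f i ≤ (S + q ^ n * B₀) * w i := by
    intro n
    induction n with
    | zero =>
      intro i
      refine (h₀ i).trans (mul_le_mul_of_nonneg_right ?_ (hw i))
      simpa using hS0
    | succ n ih =>
      intro i
      have := himp (S + q ^ n * B₀) (by positivity) ih i
      have e : K + q * (S + q ^ n * B₀) = S + q ^ (n + 1) * B₀ := by
        rw [mul_add, ← add_assoc, hfix]; ring
      rwa [e] at this
  have hlim : Tendsto (fun n : ℕ => (S + q ^ n * B₀) * w i) atTop (𝓝 ((S + 0 * B₀) * w i)) :=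
    ((tendsto_const_nhds.add ((tendsto_pow_atTop_nhds_zero_of_lt_one hq hq1).mul_const B₀))).mul_const _
  have := ge_of_tendsto' hlim (fun n => key n i)
  simpa using this

end SelfImprovement

/-! ### Riemann-Stieltjes integrals and Young's estimate. -/

section RiemannStieltjes

theorem sum_range_two_mul {M : Type*} [AddCommMonoid M] (h : ℕ → M) (N : ℕ) :
    ∑ i ∈ Finset.range (2 * N), h i = ∑ k ∈ Finset.range N, (h (2 * k) + h (2 * k + 1)) := by
  induction N with
  | zero => simp
  | succ N ih =>
    rw [mul_add, mul_one, Finset.sum_range_succ, Finset.sum_range_succ, ih,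
      Finset.sum_range_succ _ N]
    simp only [add_assoc]

variable {E : Type*} [NormedAddCommGroup E] [NormedSpace ℝ E]

/-- The empty partition `n = 0` is admissible on a degenerate interval and has sum zero. -/
theorem HasRSIntegral.eq_zero_of_eq {f : ℝ → E} {g : ℝ → ℝ} {a : ℝ} {I : E}
    (h : HasRSIntegral f g a a I) : I = 0 := by
  by_contra hI
  obtain ⟨κ, -, hκ⟩ := h ‖I‖ (norm_pos_iff.2 hI)
  have := hκ 0 (fun _ => a) (fun _ => a) rfl rfl (by simp) (by simp) (by simp)
  simp at this

theorem HasRSIntegral.sub {f₁ f₂ : ℝ → E} {g : ℝ → ℝ} {a b : ℝ} {I₁ I₂ : E}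
    (h₁ : HasRSIntegral f₁ g a b I₁) (h₂ : HasRSIntegral f₂ g a b I₂) :
    HasRSIntegral (fun s => f₁ s - f₂ s) g a b (I₁ - I₂) := by
  intro ε hε
  obtain ⟨κ₁, hκ₁, H₁⟩ := h₁ (ε / 2) (half_pos hε)
  obtain ⟨κ₂, hκ₂, H₂⟩ := h₂ (ε / 2) (half_pos hε)
  refine ⟨min κ₁ κ₂, lt_min hκ₁ hκ₂, fun n t ξ h0 hn hmono hmesh hξ => ?_⟩
  have A₁ := H₁ n t ξ h0 hn hmono (fun i hi => (hmesh i hi).trans_le (min_le_left _ _)) hξ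
  have A₂ := H₂ n t ξ h0 hn hmono (fun i hi => (hmesh i hi).trans_le (min_le_right _ _)) hξ
  simp only [smul_sub, Finset.sum_sub_distrib]
  rw [sub_sub_sub_comm]
  calc _ ≤ _ := norm_sub_le _ _
    _ < ε / 2 + ε / 2 := add_lt_add A₁ A₂
    _ = ε := by ring

theorem exists_uniform_partition {a b κ : ℝ} (hab : a ≤ b) (hκ : 0 < κ) :
    ∃ (N : ℕ) (t : ℕ → ℝ), t 0 = a ∧ t N = b ∧ (∀ i, t i ≤ t (i + 1)) ∧
      ∀ i, t (i + 1) - t i < κ := by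
  obtain ⟨N, hN⟩ := exists_nat_gt ((b - a) / κ)
  have hN0 : 0 < (N : ℝ) := lt_of_le_of_lt (by apply div_nonneg <;> linarith) hN
  have hstep : ∀ i : ℕ, (a + ((i + 1 : ℕ) : ℝ) * ((b - a) / N)) - (a + (i : ℝ) * ((b - a) / N))
      = (b - a) / N := by
    intro i; push_cast; ring
  refine ⟨N, fun i => a + i * ((b - a) / N), by simp, by field_simp; ring, fun i => ?_, fun i => ?_⟩
  · have := hstep i
    have h2 : 0 ≤ (b - a) / N := by apply div_nonneg <;> linarith
    linarith
  · rw [hstep, div_lt_iff₀ hN0]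
    rwa [div_lt_iff₀ hκ, mul_comm] at hN

/-- Prepend one fixed fine partition of `[a, b]` to any fine partition of `[b, c]`: the full sum is
close to `I` and its first part to `J`, so the remainder is close to `I - J`. -/
theorem HasRSIntegral.tail {f : ℝ → E} {g : ℝ → ℝ} {a b c : ℝ} {I J : E} (hab : a ≤ b)
    (hI : HasRSIntegral f g a c I) (hJ : HasRSIntegral f g a b J) :
    HasRSIntegral f g b c (I - J) := by
  intro ε hε
  obtain ⟨κ₁, hκ₁, H₁⟩ := hI (ε / 2) (half_pos hε)
  obtain ⟨κ₂, hκ₂, H₂⟩ := hJ (ε / 2) (half_pos hε)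
  obtain ⟨N, p, p0, pN, pmono, pmesh⟩ := exists_uniform_partition hab (lt_min hκ₁ hκ₂)
  refine ⟨κ₁, hκ₁, fun n t ξ h0 hn hmono hmesh hξ => ?_⟩
  have A₂ := H₂ N p p p0 pN (fun i _ => pmono i)
    (fun i _ => (pmesh i).trans_le (min_le_right _ _)) (fun i _ => ⟨le_rfl, pmono i⟩)
  -- The two lists share the node `b = p N = t 0`. Nodes therefore switch after index `N`, whereas
  -- tags, one per interval, switch at `N`.
  let t' : ℕ → ℝ := fun i => if i ≤ N then p i else t (i - N)
  let ξ' : ℕ → ℝ := fun i => if i < N then p i else ξ (i - N)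
  have t'lo : ∀ i, i ≤ N → t' i = p i := fun i hi => if_pos hi
  have t'hi : ∀ i, t' (N + i) = t i := by
    intro i
    rcases Nat.eq_zero_or_pos i with rfl | hi
    · simp [t', pN, h0]
    · simp only [t']; rw [if_neg (by omega)]; congr 1; omega
  have ξ'lo : ∀ i, i < N → ξ' i = p i := fun i hi => if_pos hi
  have ξ'hi : ∀ i, ξ' (N + i) = ξ i := by
    intro i; simp [ξ']
  have cases' : ∀ i, i < N + n → i < N ∨ ∃ k < n, i = N + k := by
    intro i hi
    rcases lt_or_ge i N with h | h
    · exact Or.inl h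
    · exact Or.inr ⟨i - N, by omega, by omega⟩
  have A₁ := H₁ (N + n) t' ξ' (by rw [t'lo 0 (Nat.zero_le _), p0]) (by rw [t'hi, hn])
    (by
      intro i hi
      rcases cases' i hi with h | ⟨k, hk, rfl⟩
      · rw [t'lo _ h.le, t'lo _ h]; exact pmono i
      · rw [add_assoc, t'hi, t'hi]; exact hmono k hk)
    (by
      intro i hi
      rcases cases' i hi with h | ⟨k, hk, rfl⟩
      · rw [t'lo _ h.le, t'lo _ h]; exact (pmesh i).trans_le (min_le_left _ _)
      · rw [add_assoc, t'hi, t'hi]; exact hmesh k hk)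
    (by
      intro i hi
      rcases cases' i hi with h | ⟨k, hk, rfl⟩
      · rw [t'lo _ h.le, t'lo _ h, ξ'lo _ h]; exact ⟨le_rfl, pmono i⟩
      · rw [add_assoc, t'hi, t'hi, ξ'hi]; exact hξ k hk)
  rw [Finset.sum_range_add] at A₁
  have e1 : ∑ i ∈ Finset.range N, (g (t' (i + 1)) - g (t' i)) • f (ξ' i)
      = ∑ i ∈ Finset.range N, (g (p (i + 1)) - g (p i)) • f (p i) := by
    refine Finset.sum_congr rfl fun i hi => ?_
    have h := Finset.mem_range.1 hi
    rw [t'lo _ h.le, t'lo _ h, ξ'lo _ h]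
  have e2 : ∑ i ∈ Finset.range n, (g (t' (N + i + 1)) - g (t' (N + i))) • f (ξ' (N + i))
      = ∑ i ∈ Finset.range n, (g (t (i + 1)) - g (t i)) • f (ξ i) := by
    refine Finset.sum_congr rfl fun i hi => ?_
    rw [add_assoc, t'hi, t'hi, ξ'hi]
  rw [e1, e2] at A₁
  set S₁ := ∑ i ∈ Finset.range N, (g (p (i + 1)) - g (p i)) • f (p i)
  set S₂ := ∑ i ∈ Finset.range n, (g (t (i + 1)) - g (t i)) • f (ξ i)
  have : S₂ - (I - J) = (S₁ + S₂ - I) - (S₁ - J) := by abel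
  rw [this]
  calc _ ≤ _ := norm_sub_le _ _
    _ < ε / 2 + ε / 2 := add_lt_add A₁ A₂
    _ = ε := by ring

/-- The constant in the Young estimate with total exponent `s > 1`. -/
noncomputable def youngConst (s : ℝ) : ℝ := (2 : ℝ) ^ (-s) / (1 - 2 * (2 : ℝ) ^ (-s))

theorem two_mul_two_rpow_neg_lt_one {s : ℝ} (hs : 1 < s) : 2 * (2 : ℝ) ^ (-s) < 1 := by
  have : (2 : ℝ) ^ (-s) < 2 ^ (-1 : ℝ) := Real.rpow_lt_rpow_of_exponent_lt (by norm_num) (by linarith)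
  rw [Real.rpow_neg_one] at this
  linarith

theorem youngConst_nonneg {s : ℝ} (hs : 1 < s) : 0 ≤ youngConst s := by
  have := two_mul_two_rpow_neg_lt_one hs
  unfold youngConst
  apply div_nonneg (by positivity)
  linarith

/-- The Young estimate for a Riemann-Stieltjes integral, with Hölder bounds measured in a
clock `φ`. The integrand need not be controlled at the left end point. -/
theorem HasRSIntegral.young_estimate {f : ℝ → E} {g φ : ℝ → ℝ} {a b θ ν B G : ℝ} {I : E}
    (hab : a ≤ b) (hφc : ContinuousOn φ (Icc a b))
    (hφ : ∀ u ∈ Icc a b, ∀ v ∈ Icc a b, u ≤ v → v - u ≤ φ v - φ u)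
    (hν : 0 < ν) (hθν : 1 < θ + ν) (hB : 0 ≤ B) (hG : 0 ≤ G)
    (hf : ∀ u ∈ Ioc a b, ∀ v ∈ Icc a b, u ≤ v → ‖f v - f u‖ ≤ B * (φ v - φ u) ^ θ)
    (hg : ∀ u ∈ Icc a b, ∀ v ∈ Icc a b, u ≤ v → |g v - g u| ≤ G * (φ v - φ u) ^ ν)
    (hI : HasRSIntegral f g a b I) :
    ‖I - (g b - g a) • f b‖ ≤ youngConst (θ + ν) * (B * G * (φ b - φ a) ^ (θ + ν)) := by
  set L := φ b - φ a with hL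
  have haI : a ∈ Icc a b := ⟨le_rfl, hab⟩
  have hbI : b ∈ Icc a b := ⟨hab, le_rfl⟩
  have hL0 : b - a ≤ L := hφ a haI b hbI hab
  have hLnn : 0 ≤ L := by linarith
  have hφlt : ∀ u ∈ Icc a b, ∀ v ∈ Icc a b, u < v → φ u < φ v := by
    intro u hu v hv huv
    have := hφ u hu v hv huv.le
    linarith
  have hφle : ∀ u ∈ Icc a b, ∀ v ∈ Icc a b, φ u ≤ φ v → u ≤ v := by
    intro u hu v hv huv
    by_contra hc
    push Not at hc
    exact absurd (hφlt v hv u hu hc) (not_lt.2 huv)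
  -- The dyadic partitions are equally spaced in the clock: `ψ` inverts the strictly increasing
  -- continuous `φ`, and pulls the points `p n k` back to `[a, b]`. Since `φ` grows at least as fast
  -- as time, the ordinary mesh is at most `L / 2 ^ n`.
  have hsurj : ∀ y ∈ Icc (φ a) (φ b), ∃ x ∈ Icc a b, φ x = y := fun y hy =>
    intermediate_value_Icc hab hφc hy
  choose! ψ hψmem hψ using hsurj
  have hψle : ∀ y ∈ Icc (φ a) (φ b), ∀ z ∈ Icc (φ a) (φ b), y ≤ z → ψ y ≤ ψ z := by
    intro y hy z hz hyz
    exact hφle _ (hψmem y hy) _ (hψmem z hz) (by rwa [hψ y hy, hψ z hz])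
  let p : ℕ → ℕ → ℝ := fun n k => φ a + k * (L / 2 ^ n)
  have hpmem : ∀ n k : ℕ, k ≤ 2 ^ n → p n k ∈ Icc (φ a) (φ b) := by
    intro n k hk
    have h2 : (0 : ℝ) < 2 ^ n := by positivity
    have hk' : (k : ℝ) ≤ 2 ^ n := by exact_mod_cast hk
    constructor
    · have : 0 ≤ (k : ℝ) * (L / 2 ^ n) := by positivity
      simp only [p]; linarith
    · have : (k : ℝ) * (L / 2 ^ n) ≤ 2 ^ n * (L / 2 ^ n) :=
        mul_le_mul_of_nonneg_right hk' (by positivity)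
      rw [mul_div_cancel₀ _ h2.ne'] at this
      simp only [p]; linarith
  have hpstep : ∀ n k : ℕ, p n (k + 1) - p n k = L / 2 ^ n := by
    intro n k; simp only [p]; push_cast; ring
  have hpdouble : ∀ n k : ℕ, p (n + 1) (2 * k) = p n k := by
    intro n k; simp only [p]; push_cast; rw [pow_succ]; field_simp
  let t : ℕ → ℕ → ℝ := fun n k => ψ (p n k)
  have htmem : ∀ n k : ℕ, k ≤ 2 ^ n → t n k ∈ Icc a b := fun n k hk => hψmem _ (hpmem n k hk)
  have hφt : ∀ n k : ℕ, k ≤ 2 ^ n → φ (t n k) = p n k := fun n k hk => hψ _ (hpmem n k hk)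
  have htdouble : ∀ n k : ℕ, t (n + 1) (2 * k) = t n k := by
    intro n k; simp only [t, hpdouble]
  have ht0 : ∀ n, t n 0 = a := by
    intro n
    have h := hφt n 0 (Nat.zero_le _)
    have hm := htmem n 0 (Nat.zero_le _)
    have hp0 : p n 0 = φ a := by simp [p]
    rw [hp0] at h
    exact le_antisymm (hφle _ hm _ haI h.le) (hφle _ haI _ hm h.ge)
  have htend : ∀ n, t n (2 ^ n) = b := by
    intro n
    have h := hφt n (2 ^ n) le_rfl
    have hm := htmem n (2 ^ n) le_rfl
    have hp0 : p n (2 ^ n) = φ b := by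
      simp only [p, hL]; push_cast; field_simp; ring
    rw [hp0] at h
    exact le_antisymm (hφle _ hm _ hbI h.le) (hφle _ hbI _ hm h.ge)
  have htmono : ∀ n k : ℕ, k < 2 ^ n → t n k ≤ t n (k + 1) := by
    intro n k hk
    refine hψle _ (hpmem n k hk.le) _ (hpmem n _ hk) ?_
    have := hpstep n k
    have : 0 ≤ L / 2 ^ n := by positivity
    linarith
  have hφstep : ∀ n k : ℕ, k < 2 ^ n → φ (t n (k + 1)) - φ (t n k) = L / 2 ^ n := by
    intro n k hk
    rw [hφt n k hk.le, hφt n (k + 1) hk, hpstep]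
  have htmesh : ∀ n k : ℕ, k < 2 ^ n → t n (k + 1) - t n k ≤ L / 2 ^ n := by
    intro n k hk
    rw [← hφstep n k hk]
    exact hφ _ (htmem n k hk.le) _ (htmem n _ hk) (htmono n k hk)
  -- Tags at right end points avoid evaluating `f` at `a`, where no control is assumed, and give `S
  -- 0 = (g b - g a) f b`.
  let S : ℕ → E := fun n => ∑ k ∈ Finset.range (2 ^ n), (g (t n (k + 1)) - g (t n k)) • f (t n (k + 1))
  have hS0 : S 0 = (g b - g a) • f b := by
    have h1 := htend 0
    simp only [pow_zero] at h1
    simp [S, ht0, h1]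
  set c : ℝ := (2 : ℝ) ^ (-(θ + ν)) with hc
  have hc0 : 0 < c := by positivity
  have h2c : 2 * c < 1 := two_mul_two_rpow_neg_lt_one hθν
  set Q : ℝ := B * G * L ^ (θ + ν) with hQ
  have hQ0 : 0 ≤ Q := by positivity
  have hscale : ∀ n : ℕ, (L / 2 ^ n) ^ (θ + ν) = L ^ (θ + ν) * c ^ n := by
    intro n
    rw [Real.div_rpow hLnn (by positivity), hc, ← Real.rpow_natCast (2 ^ (-(θ + ν))) n,
      ← Real.rpow_mul (by norm_num), ← Real.rpow_natCast 2 n, ← Real.rpow_mul (by norm_num),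
      div_eq_mul_inv, ← Real.rpow_neg (by norm_num)]
    congr 2; ring
  -- Halving an interval changes its term by the product of the increment of `g` over the first half
  -- and that of `f` over the second half. The `2 ^ n` products are each at most `Q c ^ (n + 1)`,
  -- and `2 c < 1` because `θ + ν > 1`.
  have hdiff : ∀ n, ‖S (n + 1) - S n‖ ≤ Q * c * (2 * c) ^ n := by
    intro n
    have e : S (n + 1) - S n = ∑ k ∈ Finset.range (2 ^ n),
        -((g (t (n + 1) (2 * k + 1)) - g (t (n + 1) (2 * k))) •
          (f (t (n + 1) (2 * (k + 1))) - f (t (n + 1) (2 * k + 1)))) := by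
      simp only [S]
      rw [pow_succ, mul_comm (2 ^ n) 2, sum_range_two_mul, ← Finset.sum_sub_distrib]
      refine Finset.sum_congr rfl fun k _ => ?_
      rw [← htdouble n k, ← htdouble n (k + 1)]
      have : 2 * k + 1 + 1 = 2 * (k + 1) := by ring
      rw [this, smul_sub]
      simp only [sub_smul]
      abel
    rw [e]
    refine (norm_sum_le_of_le (f := _) (n := fun _ => Q * c * c ^ n) _ fun k hk => ?_).trans ?_
    · have hk' := Finset.mem_range.1 hk
      have hp : 2 ^ (n + 1) = 2 * 2 ^ n := by ring
      have hk1 : 2 * k < 2 ^ (n + 1) := by omega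
      have hk2 : 2 * k + 1 < 2 ^ (n + 1) := by omega
      rw [norm_neg, norm_smul, Real.norm_eq_abs]
      -- If `L = 0` the midpoint may be `a`, where `f` is uncontrolled, but then the increment of
      -- `g` vanishes. If `L > 0` the midpoint is strictly right of `a`.
      rcases hLnn.eq_or_lt with hL0' | hLpos
      · have hg0 := hg _ (htmem (n + 1) (2 * k) hk1.le) _ (htmem (n + 1) (2 * k + 1) hk1)
          (htmono _ _ hk1)
        rw [hφstep _ _ hk1, ← hL0', zero_div, Real.zero_rpow hν.ne', mul_zero] at hg0
        have : |g (t (n + 1) (2 * k + 1)) - g (t (n + 1) (2 * k))| = 0 :=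
          le_antisymm hg0 (abs_nonneg _)
        rw [this, zero_mul]
        positivity
      · have hg0 := hg _ (htmem (n + 1) (2 * k) hk1.le) _ (htmem (n + 1) (2 * k + 1) hk1)
          (htmono _ _ hk1)
        rw [hφstep _ _ hk1] at hg0
        have hmid : t (n + 1) (2 * k + 1) ∈ Ioc a b := by
          refine ⟨?_, (htmem (n + 1) (2 * k + 1) hk1).2⟩
          have hne : t (n + 1) (2 * k + 1) ≠ a := by
            intro h
            have h1 := hφt (n + 1) (2 * k + 1) hk1
            rw [h] at h1
            simp only [p] at h1
            have : (0 : ℝ) < ((2 * k + 1 : ℕ) : ℝ) * (L / 2 ^ (n + 1)) := by positivity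
            linarith
          exact lt_of_le_of_ne (htmem (n + 1) (2 * k + 1) hk1).1 (Ne.symm hne)
        have hf0 := hf _ hmid _ (htmem (n + 1) (2 * k + 1 + 1) hk2) (htmono _ _ hk2)
        rw [hφstep _ _ hk2] at hf0
        calc _ ≤ (G * (L / 2 ^ (n + 1)) ^ ν) * (B * (L / 2 ^ (n + 1)) ^ θ) :=
              mul_le_mul hg0 hf0 (norm_nonneg _) (by positivity)
          _ = B * G * ((L / 2 ^ (n + 1)) ^ (θ + ν)) := by
              rw [Real.rpow_add (by positivity)]; ring
          _ = Q * c * c ^ n := by rw [hscale, hQ, pow_succ]; ring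
    · rw [Finset.sum_const, Finset.card_range, nsmul_eq_mul, mul_pow]
      push_cast
      exact le_of_eq (by ring)
  have hSn : ∀ n, ‖S n - S 0‖ ≤ Q * c / (1 - 2 * c) * (1 - (2 * c) ^ n) := by
    intro n
    induction n with
    | zero => simp
    | succ n ih =>
      have h1 : S (n + 1) - S 0 = (S (n + 1) - S n) + (S n - S 0) := by abel
      rw [h1]
      refine (norm_add_le _ _).trans ((add_le_add (hdiff n) ih).trans (le_of_eq ?_))
      have hD : Q * c = Q * c / (1 - 2 * c) * (1 - 2 * c) := by
        rw [div_mul_cancel₀]; linarith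
      generalize Q * c / (1 - 2 * c) = R at hD ⊢
      rw [hD]; ring
  have hSn' : ∀ n, ‖S n - S 0‖ ≤ Q * c / (1 - 2 * c) := by
    intro n
    refine (hSn n).trans ?_
    have h1 : 0 ≤ Q * c / (1 - 2 * c) := div_nonneg (by positivity) (by linarith)
    have h2 : 0 ≤ (2 * c) ^ n := by positivity
    nlinarith
  have hlim : Tendsto S atTop (𝓝 I) := by
    rw [Metric.tendsto_atTop]
    intro ε hε
    obtain ⟨κ, hκ, H⟩ := hI ε hε
    have hmesh0 : Tendsto (fun n : ℕ => L / 2 ^ n) atTop (𝓝 0) :=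
      tendsto_const_nhds.div_atTop (tendsto_pow_atTop_atTop_of_one_lt (by norm_num))
    obtain ⟨n₀, hn₀⟩ := eventually_atTop.1 (hmesh0.eventually (gt_mem_nhds hκ))
    refine ⟨n₀, fun n hn => ?_⟩
    rw [dist_eq_norm]
    exact H (2 ^ n) (t n) (fun k => t n (k + 1)) (ht0 n) (htend n) (htmono n)
      (fun k hk => (htmesh n k hk).trans_lt (hn₀ n hn)) (fun k hk => ⟨htmono n k hk, le_rfl⟩)
  have hfin := le_of_tendsto' ((hlim.sub_const (S 0)).norm) hSn'
  rw [hS0] at hfin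
  refine hfin.trans (le_of_eq ?_)
  rw [youngConst, ← hc]; ring

/-- The Young estimate summed over the components of a vector-valued driving path. -/
theorem norm_sum_le_of_hasRSIntegral {m : ℕ} {f : ℝ → Fin m → E} {g : Fin m → ℝ → ℝ}
    {φ : ℝ → ℝ} {a b θ ν B G S : ℝ} {J : Fin m → E}
    (hab : a ≤ b) (hφc : ContinuousOn φ (Icc a b))
    (hφ : ∀ u ∈ Icc a b, ∀ v ∈ Icc a b, u ≤ v → v - u ≤ φ v - φ u)
    (hθ : 0 < θ) (hν : 0 < ν) (hθν : 1 < θ + ν) (hB : 0 ≤ B) (hG : 0 ≤ G)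
    (hf : ∀ u ∈ Ioc a b, ∀ v ∈ Icc a b, u ≤ v → ‖f v - f u‖ ≤ B * (φ v - φ u) ^ θ)
    (hfb : ‖f b‖ ≤ S)
    (hg : ∀ j, ∀ u ∈ Icc a b, ∀ v ∈ Icc a b, u ≤ v → |g j v - g j u| ≤ G * (v - u) ^ ν)
    (hJ : ∀ j, HasRSIntegral (fun u => f u j) (g j) a b (J j)) :
    ‖∑ j, J j‖ ≤ m * (G * (S + youngConst (θ + ν) * B * (φ b - φ a) ^ θ) * (φ b - φ a) ^ ν) := by
  have haI : a ∈ Icc a b := ⟨le_rfl, hab⟩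
  have hbI : b ∈ Icc a b := ⟨hab, le_rfl⟩
  have hL : 0 ≤ φ b - φ a := (sub_nonneg.2 hab).trans (hφ a haI b hbI hab)
  have hg' : ∀ j, ∀ u ∈ Icc a b, ∀ v ∈ Icc a b, u ≤ v → |g j v - g j u| ≤ G * (φ v - φ u) ^ ν := by
    intro j u hu v hv huv
    refine (hg j u hu v hv huv).trans (mul_le_mul_of_nonneg_left ?_ hG)
    exact Real.rpow_le_rpow (sub_nonneg.2 huv) (hφ u hu v hv huv) hν.le
  refine (norm_sum_le_of_le (f := J)
    (n := fun _ => G * (S + youngConst (θ + ν) * B * (φ b - φ a) ^ θ) * (φ b - φ a) ^ ν)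
    Finset.univ fun j _ => ?_).trans (le_of_eq ?_)
  · have h1 := (hJ j).young_estimate hab hφc hφ hν hθν hB hG
      (fun u hu v hv huv => ((norm_le_pi_norm (f v - f u) j)).trans (hf u hu v hv huv)) (hg' j)
    have h2 : ‖(g j b - g j a) • f b j‖ ≤ G * (φ b - φ a) ^ ν * S := by
      rw [norm_smul, Real.norm_eq_abs]
      exact mul_le_mul (hg' j a haI b hbI hab) ((norm_le_pi_norm (f b) j).trans hfb)
        (norm_nonneg _) (by positivity)
    have h3 : J j = (J j - (g j b - g j a) • f b j) + (g j b - g j a) • f b j := by abel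
    rw [h3]
    refine (norm_add_le _ _).trans ((add_le_add h1 h2).trans (le_of_eq ?_))
    rw [Real.rpow_add_of_nonneg hL hθ.le hν.le]
    ring
  · simp

end RiemannStieltjes

/-! ### Hölder regularity of functions in `W_0^{α,∞}`. -/

section SlobodeckijRegularity

theorem rpow_le_mul_rpow_of_le {h L a θ : ℝ} (h0 : 0 ≤ h) (hL : h ≤ L) (hθ : 0 < θ) (hθa : θ ≤ a) :
    h ^ a ≤ L ^ (a - θ) * h ^ θ := by
  rcases h0.eq_or_lt with rfl | hpos
  · rw [Real.zero_rpow (by linarith), Real.zero_rpow hθ.ne', mul_zero]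
  · calc h ^ a = h ^ (a - θ) * h ^ θ := by rw [← Real.rpow_add hpos]; congr 1; ring
      _ ≤ L ^ (a - θ) * h ^ θ := by
        gcongr

/-- On the window `(s - h, s)` one has `t - u ≤ t - s + h`, so the weight can be removed at the
price of `(t - s + h) ^ (α + 1)`. -/
theorem lintegral_enorm_sub_le {E : Type*} [NormedAddCommGroup E] {α a t s h A : ℝ} {f : ℝ → E} (hα : 0 ≤ α + 1)
    (hA : ∫⁻ s in Ioo a t, ‖f t - f s‖ₑ / ENNReal.ofReal ((t - s) ^ (α + 1)) ≤ ENNReal.ofReal A)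
    (has : a ≤ s - h) (hst : s ≤ t) (hh : 0 < h) :
    ∫⁻ u in Ioo (s - h) s, ‖f t - f u‖ₑ ≤ ENNReal.ofReal ((t - s + h) ^ (α + 1) * A) := by
  have hpos : 0 < t - s + h := by linarith
  calc ∫⁻ u in Ioo (s - h) s, ‖f t - f u‖ₑ
      ≤ ∫⁻ u in Ioo (s - h) s, ENNReal.ofReal ((t - s + h) ^ (α + 1)) *
          (‖f t - f u‖ₑ / ENNReal.ofReal ((t - u) ^ (α + 1))) := by
        refine setLIntegral_mono' measurableSet_Ioo fun u hu => ?_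
        have h1 : 0 < (t - u) ^ (α + 1) := Real.rpow_pos_of_pos (by linarith [hu.2]) _
        have h2 : (t - u) ^ (α + 1) ≤ (t - s + h) ^ (α + 1) :=
          Real.rpow_le_rpow (by linarith [hu.2]) (by linarith [hu.1]) hα
        rw [← mul_div_assoc, ENNReal.le_div_iff_mul_le (Or.inl (by simpa using h1))
          (Or.inl ENNReal.ofReal_ne_top), mul_comm]
        gcongr
    _ = ENNReal.ofReal ((t - s + h) ^ (α + 1)) * ∫⁻ u in Ioo (s - h) s,
          (‖f t - f u‖ₑ / ENNReal.ofReal ((t - u) ^ (α + 1))) :=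
        lintegral_const_mul' _ _ ENNReal.ofReal_ne_top
    _ ≤ ENNReal.ofReal ((t - s + h) ^ (α + 1)) * ENNReal.ofReal A := by
        gcongr
        refine le_trans (lintegral_mono_set ?_) hA
        exact Ioo_subset_Ioo has hst
    _ = _ := by rw [← ENNReal.ofReal_mul (by positivity)]

variable {E : Type*} [NormedAddCommGroup E] [MeasurableSpace E]

theorem MemW.exists_bound {α a b : ℝ} {f : ℝ → E} (hf : MemW α a b f) :
    ∃ A : ℝ, 0 ≤ A ∧ (∀ t ∈ Icc a b, ‖f t‖ ≤ A) ∧ ∀ t ∈ Icc a b,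
      ∫⁻ s in Ioo a t, ‖f t - f s‖ₑ / ENNReal.ofReal ((t - s) ^ (α + 1)) ≤ ENNReal.ofReal A := by
  refine ⟨(wNorm α a b f).toReal, ENNReal.toReal_nonneg, fun t ht => ?_, fun t ht => ?_⟩
  · have h1 : ‖f t‖ₑ ≤ wNorm α a b f := by
      refine le_trans ?_ (le_iSup₂ (f := fun t (_ : t ∈ Icc a b) =>
        (‖f t‖ₑ + ∫⁻ s in Ioo a t, ‖f t - f s‖ₑ / ENNReal.ofReal ((t - s) ^ (α + 1)))) t ht)
      exact le_self_add
    have := ENNReal.toReal_mono hf.2.ne h1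
    simpa using this
  · rw [ENNReal.ofReal_toReal hf.2.ne]
    refine le_trans ?_ (le_iSup₂ (f := fun t (_ : t ∈ Icc a b) =>
        (‖f t‖ₑ + ∫⁻ s in Ioo a t, ‖f t - f s‖ₑ / ENNReal.ofReal ((t - s) ^ (α + 1)))) t ht)
    exact le_add_self

variable [BorelSpace E] [SecondCountableTopology E]

/-- A function with finite Slobodeckij-type integrals is Hölder continuous away from the left
end point. -/
theorem MemW.norm_sub_le {α a b : ℝ} {f : ℝ → E} (hα : 0 < α) (hf : MemW α a b f) :
    ∃ K : ℝ, 0 ≤ K ∧ (∀ t ∈ Icc a b, ‖f t‖ ≤ K) ∧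
      ∀ s t, s < t → t ≤ b → a ≤ s - (t - s) → ‖f t - f s‖ ≤ K * (t - s) ^ α := by
  obtain ⟨A, hA0, hA, hint⟩ := hf.exists_bound
  have h2 : (1 : ℝ) ≤ 2 ^ (α + 2) := Real.one_le_rpow (by norm_num) (by linarith)
  refine ⟨2 ^ (α + 2) * A, by positivity, fun t ht => (hA t ht).trans (by nlinarith), ?_⟩
  intro s t hst htb has
  set h := t - s with hh
  have hpos : 0 < h := by linarith
  have hs : s ∈ Icc a b := ⟨by linarith, by linarith⟩
  have ht : t ∈ Icc a b := ⟨by linarith, htb⟩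
  have i1 := lintegral_enorm_sub_le (by linarith) (hint t ht) has hst.le hpos
  have i2 := lintegral_enorm_sub_le (by linarith) (hint s hs) has le_rfl hpos
  have hmeas : AEMeasurable f (volume.restrict (Ioo (s - h) s)) := by
    have : AEMeasurable f (volume.restrict (Icc a b)) :=
      aemeasurable_restrict_of_measurable_subtype measurableSet_Icc hf.1
    refine this.mono_measure (Measure.restrict_mono ?_ le_rfl)
    intro u hu
    exact ⟨by linarith [hu.1], by linarith [hu.2]⟩
  -- Average the triangle inequality through `f u` over a window of length `h = t - s` to the left
  -- of `s`. Both right-hand integrals are of order `h ^ (α + 1)`, the left one is `h ‖f t - f s‖`,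
  -- and dividing by `h` leaves `h ^ α`.
  have i3 : ∫⁻ _ in Ioo (s - h) s, ‖f t - f s‖ₑ ≤
      ENNReal.ofReal ((t - s + h) ^ (α + 1) * A) + ENNReal.ofReal ((s - s + h) ^ (α + 1) * A) := by
    calc ∫⁻ _ in Ioo (s - h) s, ‖f t - f s‖ₑ
        ≤ ∫⁻ u in Ioo (s - h) s, (‖f t - f u‖ₑ + ‖f s - f u‖ₑ) := by
          refine lintegral_mono fun u => ?_
          have : f t - f s = (f t - f u) - (f s - f u) := by abel
          rw [this]
          exact enorm_sub_le
      _ = (∫⁻ u in Ioo (s - h) s, ‖f t - f u‖ₑ) + ∫⁻ u in Ioo (s - h) s, ‖f s - f u‖ₑ :=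
          lintegral_add_left' ((aemeasurable_const.sub hmeas).enorm) _
      _ ≤ _ := add_le_add i1 i2
  have n1 : 0 ≤ (t - s + h) ^ (α + 1) * A := mul_nonneg (Real.rpow_nonneg (by linarith) _) hA0
  have n2 : 0 ≤ (s - s + h) ^ (α + 1) * A := mul_nonneg (Real.rpow_nonneg (by linarith) _) hA0
  rw [setLIntegral_const, Real.volume_Ioo, ← ENNReal.ofReal_add n1 n2,
    ← ofReal_norm, ← ENNReal.ofReal_mul (norm_nonneg _)] at i3
  have i4 := (ENNReal.ofReal_le_ofReal_iff (add_nonneg n1 n2)).1 i3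
  have e1 : (t - s + h) ^ (α + 1) = 2 ^ (α + 1) * (h ^ α * h) := by
    rw [← hh, ← two_mul, Real.mul_rpow (by norm_num) hpos.le, Real.rpow_add_one hpos.ne']
  have e2 : (s - s + h) ^ (α + 1) = h ^ α * h := by
    rw [sub_self, zero_add, Real.rpow_add_one hpos.ne']
  have e3 : (2 : ℝ) ^ (α + 2) = 2 ^ (α + 1) * 2 := by
    rw [← Real.rpow_add_one (by norm_num)]; congr 1; ring
  have e4 : (1 : ℝ) ≤ 2 ^ (α + 1) := Real.one_le_rpow (by norm_num) (by linarith)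
  rw [e1, e2, show s - (s - h) = h by ring] at i4
  have hp : 0 ≤ h ^ α := by positivity
  have i5 : ‖f t - f s‖ * h ≤ (2 ^ (α + 2) * A * h ^ α) * h := by
    rw [e3]
    have : h ^ α * h * A ≤ 2 ^ (α + 1) * (h ^ α * h * A) := le_mul_of_one_le_left (by positivity) e4
    nlinarith
  exact le_of_mul_le_mul_right i5 hpos

/-- Increments shorter than `ε` leave room for the averaging window left of `s`; longer ones are
covered by the sup bound. The constant may blow up as `ε` tends to zero, but it is finite, which is
what a self-improvement argument needs to start. -/
theorem MemW.exists_holder_of_left {α a b ε : ℝ} {f : ℝ → E} (hα : 0 < α) (hε : 0 < ε)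
    (hf : MemW α a b f) :
    ∃ K : ℝ, 0 ≤ K ∧ ∀ s t, a + ε ≤ s → s ≤ t → t ≤ b → ‖f t - f s‖ ≤ K * (t - s) ^ α := by
  obtain ⟨K, hK, hb, hh⟩ := hf.norm_sub_le hα
  refine ⟨K + 2 * K / ε ^ α, by positivity, fun s t hs hst ht => ?_⟩
  rcases hst.eq_or_lt with rfl | hst
  · simp [Real.zero_rpow hα.ne']
  have hp : 0 ≤ (t - s) ^ α := Real.rpow_nonneg (by linarith) _
  rcases le_or_gt (t - s) ε with h | h
  · refine (hh s t hst ht (by linarith)).trans (mul_le_mul_of_nonneg_right ?_ hp)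
    have : 0 ≤ 2 * K / ε ^ α := by positivity
    linarith
  · have h1 : ‖f t - f s‖ ≤ K + K := (_root_.norm_sub_le _ _).trans
      (add_le_add (hb t ⟨by linarith, ht⟩) (hb s ⟨by linarith, by linarith⟩))
    have h2 : ε ^ α ≤ (t - s) ^ α := Real.rpow_le_rpow hε.le h.le hα.le
    have h3 : 2 * K ≤ 2 * K / ε ^ α * (t - s) ^ α := by
      rw [div_mul_eq_mul_div, le_div_iff₀ (by positivity)]
      gcongr
    have : 0 ≤ K * (t - s) ^ α := by positivity
    linarith [add_mul K (2 * K / ε ^ α) ((t - s) ^ α)]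

/-- A function in `W_0^{α,∞}(a, b)` is `α`-Hölder continuous on `(a, b]`. -/
theorem MemW.exists_holder {α a b : ℝ} {f : ℝ → E} (hα : 0 < α) (hf : MemW α a b f) :
    ∃ K : ℝ, 0 ≤ K ∧ ∀ s t, a < s → s ≤ t → t ≤ b → ‖f t - f s‖ ≤ K * (t - s) ^ α := by
  obtain ⟨K, hK, -, hh⟩ := hf.norm_sub_le hα
  set q : ℝ := (1 / 2) ^ α with hq
  have hq0 : 0 ≤ q := by positivity
  have hq1 : q < 1 := Real.rpow_lt_one (by norm_num) (by norm_num) hα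
  refine ⟨K / (1 - q), div_nonneg hK (by linarith), fun s₀ t₀ hs₀ hst₀ ht₀ => ?_⟩
  obtain ⟨B₀, hB₀, hB₀h⟩ := hf.exists_holder_of_left hα (sub_pos.2 hs₀)
  let ι := {p : ℝ × ℝ // s₀ ≤ p.1 ∧ p.1 ≤ p.2 ∧ p.2 ≤ b}
  refine le_of_self_improving (ι := ι) (f := fun p => ‖f p.1.2 - f p.1.1‖)
    (w := fun p => (p.1.2 - p.1.1) ^ α) hK hB₀ hq0 hq1
    (fun p => Real.rpow_nonneg (sub_nonneg.2 p.2.2.1) _)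
    (fun p => hB₀h _ _ (by linarith [p.2.1]) p.2.2.1 p.2.2.2) ?_ ⟨(s₀, t₀), le_rfl, hst₀, ht₀⟩
  rintro B hB hBh ⟨⟨s, t⟩, hs, hst, ht⟩
  simp only at hs hst ht ⊢
  rcases hst.eq_or_lt with rfl | hst
  · simp [Real.zero_rpow hα.ne']
  have hp : 0 ≤ (t - s) ^ α := Real.rpow_nonneg (by linarith) _
  rcases le_or_gt (t - s) (s - a) with h | h
  · refine (hh s t hst ht (by linarith)).trans (mul_le_mul_of_nonneg_right ?_ hp)
    have : 0 ≤ q * B := by positivity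
    linarith
  -- When `s` is too close to `a`, jump to the point `c` whose window ends exactly at `a`. The step
  -- from `c` to `t` is direct, and the remaining one from `s` to `c` is at most half as long,
  -- whence the contraction factor `(1/2) ^ α`, independent of `s₀`.
  · set c := (a + t) / 2 with hc
    have hsc : s ≤ c := by rw [hc]; linarith
    have hct : c < t := by rw [hc]; linarith
    have h1 := hh c t hct ht (by rw [hc]; linarith)
    have h2 := hBh ⟨(s, c), hs, hsc, by linarith⟩
    simp only at h2
    have h3 : (t - c) ^ α ≤ (t - s) ^ α := Real.rpow_le_rpow (by linarith) (by linarith) hα.le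
    have h4 : (c - s) ^ α ≤ q * (t - s) ^ α := by
      rw [hq, ← Real.mul_rpow (by norm_num) (by linarith)]
      exact Real.rpow_le_rpow (by linarith) (by rw [hc]; linarith) hα.le
    have : f t - f s = (f t - f c) + (f c - f s) := by abel
    rw [this]
    calc _ ≤ _ := norm_add_le _ _
      _ ≤ K * (t - s) ^ α + B * (q * (t - s) ^ α) :=
        add_le_add (h1.trans (mul_le_mul_of_nonneg_left h3 hK))
          (h2.trans (mul_le_mul_of_nonneg_left h4 hB))
      _ = _ := by ring

end SlobodeckijRegularity

/-! ### Increments of solutions and their local Hölder constants. -/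

section APriori

variable {E : Type*} [NormedAddCommGroup E] {m : ℕ}

/-- The regularity and growth of the coefficients used in the pathwise estimates. -/
structure CoeffBounds (T θ M : ℝ) (b : ℝ → E → E) (σ : ℝ → E → Fin m → E) (b₀ : ℝ → ℝ) :
    Prop where
  one_le : 1 ≤ M
  lip : ∀ t ∈ Icc 0 T, ∀ x y, ‖σ t x - σ t y‖ ≤ M * ‖x - y‖
  time : ∀ s ∈ Icc 0 T, ∀ t ∈ Icc 0 T, ∀ x, ‖σ t x - σ s x‖ ≤ M * |t - s| ^ θ
  zero : ∀ t ∈ Icc 0 T, ‖σ t 0‖ ≤ M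
  integrable : IntervalIntegrable b₀ volume 0 T
  nonneg : ∀ t ∈ Icc 0 T, 0 ≤ b₀ t
  half : ∀ s t, 0 ≤ s → s ≤ t → t ≤ T → ∫ u in s..t, b₀ u ≤ M * (t - s) ^ (1 / 2 : ℝ)
  growth : ∀ t ∈ Icc 0 T, ∀ x, ‖b t x‖ ≤ M * ‖x‖ + b₀ t

variable {T θ M : ℝ} {b : ℝ → E → E} {σ : ℝ → E → Fin m → E} {b₀ : ℝ → ℝ}

theorem CoeffBounds.intervalIntegrable (h : CoeffBounds T θ M b σ b₀) {s t : ℝ} (hs : 0 ≤ s)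
    (hst : s ≤ t) (ht : t ≤ T) : IntervalIntegrable b₀ volume s t := by
  refine h.integrable.mono_set ?_
  rw [uIcc_of_le hst, uIcc_of_le (by linarith)]
  exact Icc_subset_Icc hs ht

theorem CoeffBounds.norm_sigma_le (h : CoeffBounds T θ M b σ b₀) {A t : ℝ} {y : E}
    (ht : t ∈ Icc 0 T) (hy : ‖y‖ ≤ A) : ‖σ t y‖ ≤ M * (1 + A) := by
  have hM : 0 ≤ M := by linarith [h.one_le]
  have h1 : σ t y = (σ t y - σ t 0) + σ t 0 := by abel
  have h2 := h.lip t ht y 0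
  rw [sub_zero] at h2
  rw [h1]
  refine (norm_add_le _ _).trans ((add_le_add h2 (h.zero t ht)).trans ?_)
  nlinarith [mul_le_mul_of_nonneg_left hy hM]

theorem CoeffBounds.norm_sigma_sub_le (h : CoeffBounds T θ M b σ b₀) {u v : ℝ} {y z : E}
    (hu : u ∈ Icc 0 T) (hv : v ∈ Icc 0 T) (huv : u ≤ v) :
    ‖σ v z - σ u y‖ ≤ M * (v - u) ^ θ + M * ‖z - y‖ := by
  have h1 : σ v z - σ u y = (σ v z - σ u z) + (σ u z - σ u y) := by abel
  rw [h1]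
  refine (norm_add_le _ _).trans (add_le_add ?_ (h.lip u hu z y))
  have := h.time u hu v hv z
  rwa [abs_of_nonneg (sub_nonneg.2 huv)] at this

variable [NormedSpace ℝ E]

/-- The integral equation with delay `r`, written for increments. -/
structure IncrementEq (T r : ℝ) (b : ℝ → E → E) (σ : ℝ → E → Fin m → E) (g : Fin m → ℝ → ℝ)
    (x : ℝ → E) : Prop where
  integrable : IntervalIntegrable (fun s => b s (x s)) volume 0 T
  incr : ∀ s t, 0 ≤ s → s < t → t ≤ T → ∃ J : Fin m → E,
    (∀ j, HasRSIntegral (fun u => σ u (x (u - r)) j) (g j) s t (J j)) ∧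
    x t - x s = (∫ u in s..t, b u (x u)) + ∑ j, J j

/-- The integrals over `[0, t]` and `[0, s]` are subtracted by `HasRSIntegral.tail`, so that Young's
estimate can be used on any subinterval. -/
theorem IncrementEq.of_equation {r : ℝ} {g : Fin m → ℝ → ℝ} {x : ℝ → E} (hT : 0 < T)
    (h : ∀ t ∈ Ioc 0 T, IntervalIntegrable (fun s => b s (x s)) volume 0 t ∧
      ∃ I : Fin m → E, (∀ j, HasRSIntegral (fun s => σ s (x (s - r)) j) (g j) 0 t (I j)) ∧
        x t = x 0 + (∫ s in (0 : ℝ)..t, b s (x s)) + ∑ j, I j) :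
    IncrementEq T r b σ g x := by
  refine ⟨(h T ⟨hT, le_rfl⟩).1, fun s t hs hst ht => ?_⟩
  obtain ⟨ht1, I, hI, hxt⟩ := h t ⟨by linarith, ht⟩
  rcases hs.eq_or_lt with rfl | hs
  · exact ⟨I, hI, by rw [hxt]; abel⟩
  · obtain ⟨hs1, J, hJ, hxs⟩ := h s ⟨hs, by linarith⟩
    refine ⟨fun j => I j - J j, fun j => (hI j).tail hs.le (hJ j), ?_⟩
    rw [hxt, hxs, Finset.sum_sub_distrib, ← intervalIntegral.integral_interval_sub_left ht1 hs1]
    abel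

theorem CoeffBounds.norm_integral_le (h : CoeffBounds T θ M b σ b₀) {x : ℝ → E} {A s t : ℝ}
    (hs : 0 ≤ s) (hst : s ≤ t) (ht : t ≤ T) (hA : ∀ u ∈ Icc s t, ‖x u‖ ≤ A) :
    ‖∫ u in s..t, b u (x u)‖ ≤ M * A * (t - s) + ∫ u in s..t, b₀ u := by
  have hM : 0 ≤ M := by linarith [h.one_le]
  calc ‖∫ u in s..t, b u (x u)‖ ≤ ∫ u in s..t, (M * A + b₀ u) := by
        refine intervalIntegral.norm_integral_le_of_norm_le hst (ae_of_all _ fun u hu => ?_)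
          (intervalIntegrable_const.add (h.intervalIntegrable hs hst ht))
        have hu' : u ∈ Icc s t := Ioc_subset_Icc_self hu
        refine (h.growth u ⟨by linarith [hu.1], by linarith [hu.2]⟩ _).trans ?_
        gcongr
        exact hA u hu'
    _ = M * A * (t - s) + ∫ u in s..t, b₀ u := by
        rw [intervalIntegral.integral_add intervalIntegrable_const (h.intervalIntegrable hs hst ht)]
        rw [intervalIntegral.integral_const, smul_eq_mul]; ring

/-- The increment of the stochastic integral, estimated through sup and Hölder bounds. -/
theorem CoeffBounds.norm_sum_le (h : CoeffBounds T θ M b σ b₀) {g : Fin m → ℝ → ℝ} {x : ℝ → E}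
    {r ν G A B s t : ℝ} {J : Fin m → E} (hθ : 0 < θ) (hν : 0 < ν) (hθν : 1 < θ + ν) (hG : 0 ≤ G)
    (hB : 0 ≤ B)
    (hg : ∀ j, ∀ u ∈ Icc 0 T, ∀ v ∈ Icc 0 T, u ≤ v → |g j v - g j u| ≤ G * (v - u) ^ ν)
    (hs : 0 ≤ s) (hst : s < t) (ht : t ≤ T) (hA : ‖x (t - r)‖ ≤ A)
    (hx : ∀ u ∈ Ioc s t, ∀ v ∈ Icc s t, u ≤ v → ‖x (v - r) - x (u - r)‖ ≤ B * (v - u) ^ θ)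
    (hJ : ∀ j, HasRSIntegral (fun u => σ u (x (u - r)) j) (g j) s t (J j)) :
    ‖∑ j, J j‖ ≤ m * (G * (M * (1 + A) + youngConst (θ + ν) * (M * (1 + B)) * (t - s) ^ θ) *
      (t - s) ^ ν) := by
  have hM : 0 ≤ M := by linarith [h.one_le]
  have hmem : ∀ u ∈ Icc s t, u ∈ Icc 0 T := fun u hu => ⟨hs.trans hu.1, hu.2.trans ht⟩
  refine norm_sum_le_of_hasRSIntegral (f := fun u => σ u (x (u - r))) (φ := fun u => u) hst.le
    continuousOn_id (fun u _ v _ _ => le_rfl) hθ hν hθν (by positivity) hG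
    (fun u hu v hv huv => ?_)
    (h.norm_sigma_le (hmem t ⟨hst.le, le_rfl⟩) hA)
    (fun j u hu v hv huv => hg j u (hmem u hu) v (hmem v hv) huv) hJ
  refine (h.norm_sigma_sub_le (hmem u (Ioc_subset_Icc_self hu)) (hmem v hv) huv).trans ?_
  have := mul_le_mul_of_nonneg_left (hx u hu v hv huv) hM
  linarith [mul_add M ((v - u) ^ θ) (B * (v - u) ^ θ)]

/-- The increments of a solution, estimated through sup and Hölder bounds. -/
theorem IncrementEq.norm_sub_le {g : Fin m → ℝ → ℝ} {x : ℝ → E} {r ν G A B s t : ℝ}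
    (he : IncrementEq T r b σ g x) (h : CoeffBounds T θ M b σ b₀)
    (hθ : 0 < θ) (hν : 0 < ν) (hθν : 1 < θ + ν) (hG : 0 ≤ G) (hB : 0 ≤ B)
    (hg : ∀ j, ∀ u ∈ Icc 0 T, ∀ v ∈ Icc 0 T, u ≤ v → |g j v - g j u| ≤ G * (v - u) ^ ν)
    (hs : 0 ≤ s) (hst : s < t) (ht : t ≤ T)
    (hA : ∀ u ∈ Icc s t, ‖x u‖ ≤ A) (hAr : ‖x (t - r)‖ ≤ A)
    (hx : ∀ u ∈ Ioc s t, ∀ v ∈ Icc s t, u ≤ v → ‖x (v - r) - x (u - r)‖ ≤ B * (v - u) ^ θ) :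
    ‖x t - x s‖ ≤ M * A * (t - s) + (∫ u in s..t, b₀ u) +
      m * (G * (M * (1 + A) + youngConst (θ + ν) * (M * (1 + B)) * (t - s) ^ θ) * (t - s) ^ ν) := by
  obtain ⟨J, hJ, e⟩ := he.incr s t hs hst ht
  rw [e]
  exact (norm_add_le _ _).trans (add_le_add (h.norm_integral_le hs hst.le ht hA)
    (h.norm_sum_le hθ hν hθν hG hB hg hs hst ht hAr hx hJ))

/-- A Hölder continuous solution of the equation with delay `r ≥ 0` and controlled initial path. -/
structure DelayPath (T r θ M : ℝ) (b : ℝ → E → E) (σ : ℝ → E → Fin m → E) (g : Fin m → ℝ → ℝ)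
    (x : ℝ → E) : Prop where
  eq : IncrementEq T r b σ g x
  init_le : ∀ t ∈ Icc (-r) 0, ‖x t‖ ≤ M
  init_holder : ∀ s t, -r ≤ s → s ≤ t → t ≤ 0 → ‖x t - x s‖ ≤ M * (t - s) ^ θ
  holder : ∃ C, 0 ≤ C ∧ ∀ s t, -r ≤ s → s ≤ t → t ≤ T → ‖x t - x s‖ ≤ C * (t - s) ^ θ

variable {g : Fin m → ℝ → ℝ} {x : ℝ → E} {r ν G : ℝ}

/-- The Hölder constant of a solution at the scale `Δ`. -/
theorem DelayPath.local_holder (hx : DelayPath T r θ M b σ g x) (h : CoeffBounds T θ M b σ b₀)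
    (hr : 0 ≤ r) (hθ : 0 < θ) (hθ2 : θ ≤ 1 / 2) (hν : 1 / 2 < ν) (hθν : 1 < θ + ν)
    (hG : 0 ≤ G)
    (hg : ∀ j, ∀ u ∈ Icc 0 T, ∀ v ∈ Icc 0 T, u ≤ v → |g j v - g j u| ≤ G * (v - u) ^ ν)
    {Δ : ℝ} (hΔ : 0 < Δ) (hΔ1 : Δ ≤ 1) (hΔM : M * Δ ≤ 1 / 16) (hΔG : m * G * M * Δ ^ ν ≤ 1 / 16)
    (hΔY : m * G * (youngConst (θ + ν) * M) * Δ ^ ν ≤ 1 / 4)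
    {τ A : ℝ} (hτ : 0 ≤ τ) (hτT : τ ≤ T) (hA : ∀ u ∈ Icc (-r) τ, ‖x u‖ ≤ A) {s t : ℝ}
    (hs : -r ≤ s) (hst : s ≤ t) (ht : t ≤ τ) (htΔ : t - s ≤ Δ) :
    ‖x t - x s‖ ≤ (A / 4 + 6 * M) * Δ ^ (-θ) * (t - s) ^ θ := by
  have hM1 := h.one_le
  have hA0 : 0 ≤ A := (norm_nonneg _).trans (hA 0 ⟨by linarith, hτ⟩)
  set D := Δ ^ (-θ) with hD
  have hD1 : 1 ≤ D := by
    rw [hD, Real.rpow_neg hΔ.le]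
    exact (one_le_inv₀ (by positivity)).2 (Real.rpow_le_one hΔ.le hΔ1 hθ.le)
  -- Every term of the increment is converted to the power `θ`: an exponent `a ≥ θ` gains a factor
  -- `Δ ^ a`, small enough for the smallness conditions on `Δ`, against the common loss `D = Δ ^
  -- (-θ)`.
  have hDpow : ∀ {a y : ℝ}, θ ≤ a → 0 ≤ y → y ≤ Δ → y ^ a ≤ D * Δ ^ a * y ^ θ := by
    intro a y ha hy hyΔ
    refine (rpow_le_mul_rpow_of_le hy hyΔ hθ ha).trans (le_of_eq ?_)
    rw [hD, ← Real.rpow_add hΔ]; congr 2; ring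
  obtain ⟨C, hC0, hC⟩ := hx.holder
  have hY := youngConst_nonneg hθν
  set K := (A / 8 + 3 * M + 1 / 2) * D with hK
  have hK0 : 0 ≤ K := by positivity
  let ι := {p : ℝ × ℝ // -r ≤ p.1 ∧ p.1 ≤ p.2 ∧ p.2 ≤ τ ∧ p.2 - p.1 ≤ Δ}
  -- The family consists of pairs at distance at most `Δ`, including times before `0`, so that `B`
  -- also controls the delayed increments. Young's term feeds `B` back with factor at most `1/4`;
  -- the qualitative constant `C` only starts the iteration.
  have key := le_of_self_improving (ι := ι) (f := fun p => ‖x p.1.2 - x p.1.1‖)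
    (w := fun p => (p.1.2 - p.1.1) ^ θ) (q := 1 / 4) hK0 hC0 (by norm_num) (by norm_num)
    (fun p => Real.rpow_nonneg (sub_nonneg.2 p.2.2.1) _)
    (fun p => hC _ _ p.2.1 p.2.2.1 (p.2.2.2.1.trans hτT)) ?_ ⟨(s, t), hs, hst, ht, htΔ⟩
  · refine key.trans (mul_le_mul_of_nonneg_right ?_ (Real.rpow_nonneg (sub_nonneg.2 hst) _))
    rw [hK]
    have : 0 ≤ A * D := by positivity
    have : D ≤ M * D := le_mul_of_one_le_left (by linarith) hM1
    norm_num
    nlinarith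
  · rintro B hB hBh ⟨⟨s, t⟩, hs, hst, ht, htΔ⟩
    simp only at hs hst ht htΔ ⊢
    have hBh' : ∀ u v, -r ≤ u → u ≤ v → v ≤ τ → v - u ≤ Δ → ‖x v - x u‖ ≤ B * (v - u) ^ θ :=
      fun u v h1 h2 h3 h4 => hBh ⟨(u, v), h1, h2, h3, h4⟩
    -- increments at nonnegative times
    have pos : ∀ u v, 0 ≤ u → u ≤ v → v ≤ τ → v - u ≤ Δ →
        ‖x v - x u‖ ≤ ((A / 8 + 2 * M + 1 / 2) * D + 1 / 4 * B) * (v - u) ^ θ := by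
      intro u v hu huv hv hvΔ
      have hp : 0 ≤ (v - u) ^ θ := Real.rpow_nonneg (by linarith) _
      rcases huv.eq_or_lt with rfl | huv
      · simp [Real.zero_rpow hθ.ne']
      have h1 := hx.eq.norm_sub_le h hθ (by linarith) hθν hG hB hg hu huv (hv.trans hτT)
        (fun w hw => hA w ⟨by linarith [hw.1], by linarith [hw.2]⟩)
        (hA _ ⟨by linarith, by linarith⟩)
        (fun w hw z hz hwz => by
          have := hBh' (w - r) (z - r) (by linarith [hw.1]) (by linarith) (by linarith [hz.2])
            (by linarith [hw.1, hz.2])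
          rwa [show z - r - (w - r) = z - w by ring] at this)
      have h2 := h.half u v hu huv.le (hv.trans hτT)
      have d0 : 0 ≤ v - u := by linarith
      have p1 : M * A * (v - u) ≤ (A / 16) * D * (v - u) ^ θ := by
        have := hDpow (a := 1) (by linarith) d0 hvΔ
        rw [Real.rpow_one, Real.rpow_one] at this
        calc M * A * (v - u) ≤ M * A * (D * Δ * (v - u) ^ θ) := by gcongr
          _ = (M * Δ) * (A * D * (v - u) ^ θ) := by ring
          _ ≤ 1 / 16 * (A * D * (v - u) ^ θ) := by gcongr
          _ = _ := by ring
      have p2 : M * (v - u) ^ (1 / 2 : ℝ) ≤ M * D * (v - u) ^ θ := by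
        have := hDpow (a := 1 / 2) hθ2 d0 hvΔ
        have h3 : Δ ^ (1 / 2 : ℝ) ≤ 1 := Real.rpow_le_one hΔ.le hΔ1 (by norm_num)
        calc M * (v - u) ^ (1 / 2 : ℝ) ≤ M * (D * Δ ^ (1 / 2 : ℝ) * (v - u) ^ θ) := by gcongr
          _ ≤ M * (D * 1 * (v - u) ^ θ) := by gcongr
          _ = _ := by ring
      have hpν : (v - u) ^ ν ≤ D * Δ ^ ν * (v - u) ^ θ := hDpow (by linarith) d0 hvΔ
      have p3 : m * G * M * (1 + A) * (v - u) ^ ν ≤ 1 / 16 * (1 + A) * D * (v - u) ^ θ := by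
        calc m * G * M * (1 + A) * (v - u) ^ ν
            ≤ m * G * M * (1 + A) * (D * Δ ^ ν * (v - u) ^ θ) := by gcongr
          _ = (m * G * M * Δ ^ ν) * ((1 + A) * D * (v - u) ^ θ) := by ring
          _ ≤ 1 / 16 * ((1 + A) * D * (v - u) ^ θ) := by gcongr
          _ = _ := by ring
      have p4 : m * G * (youngConst (θ + ν) * M) * (1 + B) * (v - u) ^ ν * (v - u) ^ θ
          ≤ (1 / 4 * D + 1 / 4 * B) * (v - u) ^ θ := by
        calc m * G * (youngConst (θ + ν) * M) * (1 + B) * (v - u) ^ ν * (v - u) ^ θ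
            ≤ m * G * (youngConst (θ + ν) * M) * (1 + B) * Δ ^ ν * (v - u) ^ θ := by gcongr
          _ = m * G * (youngConst (θ + ν) * M) * Δ ^ ν * ((1 + B) * (v - u) ^ θ) := by ring
          _ ≤ 1 / 4 * ((1 + B) * (v - u) ^ θ) := by gcongr
          _ ≤ 1 / 4 * ((D + B) * (v - u) ^ θ) := by gcongr
          _ = _ := by ring
      have e : m * (G * (M * (1 + A) + youngConst (θ + ν) * (M * (1 + B)) * (v - u) ^ θ) *
          (v - u) ^ ν) = m * G * M * (1 + A) * (v - u) ^ ν +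
            m * G * (youngConst (θ + ν) * M) * (1 + B) * (v - u) ^ ν * (v - u) ^ θ := by ring
      rw [e] at h1
      have f1 : D * (v - u) ^ θ ≤ M * (D * (v - u) ^ θ) :=
        le_mul_of_one_le_left (by positivity) hM1
      have f2 : 0 ≤ D * (v - u) ^ θ := by positivity
      nlinarith
    have D0 : 0 ≤ D := by linarith
    have AD0 : 0 ≤ (A / 8 + 2 * M + 1 / 2) * D + 1 / 4 * B := by positivity
    have hMD : M ≤ M * D := le_mul_of_one_le_right (by linarith) hD1
    -- The last summand `M D` is reserved for the initial path: an increment straddling `0` is cut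
    -- there and the two pieces are added.
    have split : K + 1 / 4 * B = ((A / 8 + 2 * M + 1 / 2) * D + 1 / 4 * B) + M * D := by
      rw [hK]; ring
    rw [split]
    rcases le_total 0 s with h0s | hs0
    · refine (pos s t h0s hst ht htΔ).trans (mul_le_mul_of_nonneg_right ?_
        (Real.rpow_nonneg (by linarith) _))
      have : 0 ≤ M * D := by positivity
      linarith
    rcases le_total t 0 with ht0 | h0t
    · refine (hx.init_holder s t hs hst ht0).trans (mul_le_mul_of_nonneg_right ?_
        (Real.rpow_nonneg (by linarith) _))
      linarith
    · have e : x t - x s = (x t - x 0) + (x 0 - x s) := by abel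
      rw [e, add_mul]
      refine (norm_add_le _ _).trans (add_le_add ?_ ?_)
      · refine (pos 0 t le_rfl h0t ht (by linarith)).trans (mul_le_mul_of_nonneg_left ?_ AD0)
        exact Real.rpow_le_rpow (by linarith) (by linarith) hθ.le
      · refine (hx.init_holder s 0 hs hs0 le_rfl).trans ?_
        refine mul_le_mul hMD ?_ (Real.rpow_nonneg (by linarith) _) (by positivity)
        exact Real.rpow_le_rpow (by linarith) (by linarith) hθ.le

end APriori

/-! ### Global bounds with explicit dependence on the driving path. -/

section Growth

variable {E : Type*} [NormedAddCommGroup E] [NormedSpace ℝ E] {m : ℕ}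
variable {T θ M : ℝ} {b : ℝ → E → E} {σ : ℝ → E → Fin m → E} {b₀ : ℝ → ℝ}
variable {g : Fin m → ℝ → ℝ} {x : ℝ → E} {r ν G : ℝ}

/-- Over one time step the supremum of a solution at most doubles, up to a constant. -/
theorem DelayPath.bound_step (hx : DelayPath T r θ M b σ g x) (h : CoeffBounds T θ M b σ b₀)
    (hr : 0 ≤ r) (hθ : 0 < θ) (hθ2 : θ ≤ 1 / 2) (hν : 1 / 2 < ν) (hθν : 1 < θ + ν)
    (hG : 0 ≤ G)
    (hg : ∀ j, ∀ u ∈ Icc 0 T, ∀ v ∈ Icc 0 T, u ≤ v → |g j v - g j u| ≤ G * (v - u) ^ ν)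
    {Δ : ℝ} (hΔ : 0 < Δ) (hΔ1 : Δ ≤ 1) (hΔM : M * Δ ≤ 1 / 16) (hΔG : m * G * M * Δ ^ ν ≤ 1 / 16)
    (hΔY : m * G * (youngConst (θ + ν) * M) * Δ ^ ν ≤ 1 / 4)
    {τ A : ℝ} (hτ : 0 ≤ τ) (hτT : τ ≤ T) (hA : ∀ u ∈ Icc (-r) τ, ‖x u‖ ≤ A) :
    ∀ u ∈ Icc (-r) (min (τ + Δ) T), ‖x u‖ ≤ 2 * A + 12 * M := by
  intro u hu
  have hM1 := h.one_le
  set τ' := min (τ + Δ) T with hτ'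
  have hτ'T : τ' ≤ T := min_le_right _ _
  have hτ'Δ : τ' ≤ τ + Δ := min_le_left _ _
  have hττ' : τ ≤ τ' := le_min (by linarith) hτT
  have hA0 : 0 ≤ A := (norm_nonneg _).trans (hA 0 ⟨by linarith, hτ⟩)
  obtain ⟨C, hC0, hC⟩ := hx.holder
  have hbd : ∀ v ∈ Icc (-r) τ', ‖x v‖ ≤ A + C * (T + r) ^ θ := by
    intro v hv
    have h1 := hC (-r) v le_rfl hv.1 (hv.2.trans hτ'T)
    have h2 : (v - -r) ^ θ ≤ (T + r) ^ θ :=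
      Real.rpow_le_rpow (by linarith [hv.1]) (by linarith [hv.2]) hθ.le
    have h3 : x v = (x v - x (-r)) + x (-r) := by abel
    rw [h3]
    refine (norm_add_le _ _).trans ?_
    linarith [hA (-r) ⟨le_rfl, by linarith⟩, mul_le_mul_of_nonneg_left h2 hC0]
  -- If `B` bounds the path up to `τ'`, the local Hölder estimate from `τ` improves it to `A + 6 M +
  -- B / 4`; the fixed point `4/3 (A + 6 M)` is below `2 A + 12 M`.
  have key := le_of_self_improving (ι := Icc (-r) τ') (f := fun v => ‖x v‖)
    (w := fun _ => 1) (q := 1 / 4) (K := A + 6 * M) (by positivity)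
    (B₀ := A + C * (T + r) ^ θ)
    (add_nonneg hA0 (mul_nonneg hC0 (Real.rpow_nonneg (by linarith) _)))
    (by norm_num) (by norm_num) (fun _ => zero_le_one)
    (fun v => by simpa using hbd v v.2) ?_ ⟨u, hu⟩
  · refine key.trans ?_
    norm_num
    linarith
  · rintro B hB hBh ⟨v, hv⟩
    simp only [mul_one] at hBh ⊢
    rcases le_total v τ with hvτ | hτv
    · refine (hA v ⟨hv.1, hvτ⟩).trans ?_
      linarith
    · have h1 := hx.local_holder h hr hθ hθ2 hν hθν hG hg hΔ hΔ1 hΔM hΔG hΔY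
        (hτ.trans hττ') hτ'T (fun w hw => hBh ⟨w, hw⟩) (s := τ) (t := v) (by linarith) hτv hv.2
        (by linarith [hv.2])
      have h2 : (v - τ) ^ θ ≤ Δ ^ θ :=
        Real.rpow_le_rpow (by linarith) (by linarith [hv.2]) hθ.le
      have h3 : Δ ^ (-θ) * (v - τ) ^ θ ≤ 1 := by
        rw [Real.rpow_neg hΔ.le, inv_mul_le_one₀ (by positivity)]
        exact h2
      have h4 : (B / 4 + 6 * M) * Δ ^ (-θ) * (v - τ) ^ θ ≤ B / 4 + 6 * M := by
        rw [mul_assoc]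
        exact mul_le_of_le_one_right (by positivity) h3
      have h5 : x v = (x v - x τ) + x τ := by abel
      rw [h5]
      refine (norm_add_le _ _).trans ?_
      linarith [hA τ ⟨by linarith, le_rfl⟩]

/-- The sequence `13 M 2 ^ n - 12 M` solves the recursion `a ↦ 2 a + 12 M` started at the bound `M`
of the initial path. -/
theorem DelayPath.bound_iterate (hx : DelayPath T r θ M b σ g x) (h : CoeffBounds T θ M b σ b₀)
    (hT : 0 ≤ T)
    (hr : 0 ≤ r) (hθ : 0 < θ) (hθ2 : θ ≤ 1 / 2) (hν : 1 / 2 < ν) (hθν : 1 < θ + ν)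
    (hG : 0 ≤ G)
    (hg : ∀ j, ∀ u ∈ Icc 0 T, ∀ v ∈ Icc 0 T, u ≤ v → |g j v - g j u| ≤ G * (v - u) ^ ν)
    {Δ : ℝ} (hΔ : 0 < Δ) (hΔ1 : Δ ≤ 1) (hΔM : M * Δ ≤ 1 / 16) (hΔG : m * G * M * Δ ^ ν ≤ 1 / 16)
    (hΔY : m * G * (youngConst (θ + ν) * M) * Δ ^ ν ≤ 1 / 4) (n : ℕ) :
    ∀ u ∈ Icc (-r) (min (n * Δ) T), ‖x u‖ ≤ 13 * M * 2 ^ n - 12 * M := by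
  induction n with
  | zero =>
    intro u hu
    rw [Nat.cast_zero, zero_mul, min_eq_left hT] at hu
    refine (hx.init_le u hu).trans (le_of_eq ?_)
    ring
  | succ n ih =>
    intro u hu
    have h1 := hx.bound_step h hr hθ hθ2 hν hθν hG hg hΔ hΔ1 hΔM hΔG hΔY
      (le_min (by positivity) hT) (min_le_right _ _) ih u ?_
    · refine h1.trans (le_of_eq ?_)
      rw [pow_succ]; ring
    · refine ⟨hu.1, hu.2.trans ?_⟩
      rcases le_total (n * Δ) T with hle | hle
      · rw [min_eq_left hle]
        push_cast
        rw [add_mul, one_mul]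
      · rw [min_eq_right hle]
        exact (min_le_right _ _).trans (le_min (by linarith) le_rfl)

set_option maxHeartbeats 1000000 in
/-- Bounds for solutions, uniform in the delay, growing with the Hölder constant `G` of the
driving path at most like `exp (C (1 + G)^(1/ν))`. -/
theorem exists_apriori_bound (m : ℕ) {T θ M ν : ℝ} (hT : 0 ≤ T) (hθ : 0 < θ) (hθ2 : θ ≤ 1 / 2)
    (hν : 1 / 2 < ν) (hν1 : ν ≤ 1) (hθν : 1 < θ + ν) (hM : 1 ≤ M) :
    ∃ C : ℝ, 1 ≤ C ∧ ∀ (b : ℝ → E → E) (σ : ℝ → E → Fin m → E) (b₀ : ℝ → ℝ)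
      (g : Fin m → ℝ → ℝ) (x : ℝ → E) (r G : ℝ), CoeffBounds T θ M b σ b₀ → 0 ≤ r → 0 ≤ G →
      (∀ j, ∀ u ∈ Icc 0 T, ∀ v ∈ Icc 0 T, u ≤ v → |g j v - g j u| ≤ G * (v - u) ^ ν) →
      DelayPath T r θ M b σ g x →
      (∀ t ∈ Icc (-r) T, ‖x t‖ ≤ C * Real.exp (C * (1 + G) ^ (1 / ν))) ∧
      (∀ s t, -r ≤ s → s ≤ t → t ≤ T →
        ‖x t - x s‖ ≤ C * Real.exp (C * (1 + G) ^ (1 / ν)) * (t - s) ^ θ) := by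
  have hY := youngConst_nonneg hθν
  set Y := youngConst (θ + ν) with hYdef
  -- One constant below all three smallness thresholds once `G Δ ^ ν ≤ c` and `Δ ≤ c`.
  set c : ℝ := 1 / (16 * M * (m + 1) * (Y + 1)) with hc
  have hν0 : 0 < ν := by linarith
  have hden : 0 < 16 * M * (m + 1) * (Y + 1) := by positivity
  have hc0 : 0 < c := by positivity
  have hc16 : c * (16 * M * (m + 1) * (Y + 1)) = 1 := by rw [hc]; field_simp
  have hm0 : (0 : ℝ) ≤ m := Nat.cast_nonneg m
  have hcM : M * c ≤ 1 / 16 := by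
    have : 0 ≤ c * M * (m * (Y + 1) + Y) := by positivity
    nlinarith
  have hcm : m * M * c ≤ 1 / 16 := by
    have : 0 ≤ c * M * (m * Y + Y + 1) := by positivity
    nlinarith
  have hcY : m * (Y * M) * c ≤ 1 / 4 := by
    have : 0 ≤ c * M * (m + Y + 1) := by positivity
    nlinarith
  have hc1 : c ≤ 1 := by nlinarith
  set c₀ : ℝ := (1 / c) ^ (1 / ν) with hc₀
  have hc₀0 : 0 ≤ c₀ := by positivity
  have he1 : 1 ≤ Real.exp 1 := Real.one_le_exp (by norm_num)
  refine ⟨(26 * Real.exp 1 + 6) * M + (T + 1) * c₀, ?_, ?_⟩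
  · have : 0 ≤ (T + 1) * c₀ := by positivity
    nlinarith
  intro b σ b₀ g x r G h hr hG hg hx
  set z : ℝ := (1 + G) ^ (1 / ν) with hz
  have hz0 : 0 ≤ z := by positivity
  -- This choice gives `Δ ^ ν = c / (1 + G)`. The number of steps is of order `1 / Δ = c₀ (1 + G) ^
  -- (1 / ν)`, and doubling at each of them produces the exponential.
  set Δ : ℝ := (c / (1 + G)) ^ (1 / ν) with hΔdef
  have hcG0 : 0 < c / (1 + G) := by positivity
  have hcGc : c / (1 + G) ≤ c := div_le_self hc0.le (by linarith)
  have hΔ : 0 < Δ := by positivity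
  have h1ν : 1 ≤ 1 / ν := by rw [le_div_iff₀ hν0]; linarith
  have hΔc : Δ ≤ c := by
    refine le_trans ?_ hcGc
    rw [hΔdef]
    exact Real.rpow_le_self_of_le_one hcG0.le (hcGc.trans hc1) h1ν
  have hΔν : Δ ^ ν = c / (1 + G) := by
    rw [hΔdef, ← Real.rpow_mul hcG0.le, one_div_mul_cancel hν0.ne', Real.rpow_one]
  have hGΔ : G * Δ ^ ν ≤ c := by
    rw [hΔν, mul_div_assoc', div_le_iff₀ (by positivity)]
    nlinarith
  have hΔ1 : Δ ≤ 1 := hΔc.trans hc1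
  have hΔM : M * Δ ≤ 1 / 16 := (mul_le_mul_of_nonneg_left hΔc (by linarith)).trans hcM
  have hΔG : m * G * M * Δ ^ ν ≤ 1 / 16 := by
    calc m * G * M * Δ ^ ν = m * M * (G * Δ ^ ν) := by ring
      _ ≤ m * M * c := by gcongr
      _ ≤ _ := hcm
  have hΔY : m * G * (Y * M) * Δ ^ ν ≤ 1 / 4 := by
    calc m * G * (Y * M) * Δ ^ ν = m * (Y * M) * (G * Δ ^ ν) := by ring
      _ ≤ m * (Y * M) * c := by gcongr
      _ ≤ _ := hcY
  have hinv : 1 / Δ = c₀ * z := by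
    rw [hc₀, hz, ← Real.mul_rpow (by positivity) (by positivity), hΔdef, one_div,
      ← Real.inv_rpow hcG0.le]
    congr 1
    field_simp
  set n := ⌈T / Δ⌉₊ with hn
  have hnT : T ≤ n * Δ := by
    have := Nat.le_ceil (T / Δ)
    rwa [div_le_iff₀ hΔ] at this
  have hn2 : (n : ℝ) ≤ T * c₀ * z + 1 := by
    have := Nat.ceil_lt_add_one (a := T / Δ) (by positivity)
    have e : T / Δ = T * c₀ * z := by rw [mul_assoc, ← hinv]; ring
    rw [e] at this
    rw [hn, e]
    exact this.le
  set A : ℝ := 13 * M * (Real.exp 1 * Real.exp (T * c₀ * z)) with hA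
  have h2n : (2 : ℝ) ^ n ≤ Real.exp 1 * Real.exp (T * c₀ * z) := by
    calc (2 : ℝ) ^ n ≤ (Real.exp 1) ^ n := by
          gcongr
          have := Real.add_one_le_exp (1 : ℝ)
          linarith
      _ = Real.exp n := by rw [← Real.exp_nat_mul, mul_one]
      _ ≤ Real.exp (1 + T * c₀ * z) := Real.exp_le_exp.2 (by linarith)
      _ = _ := Real.exp_add _ _
  have hsup : ∀ t ∈ Icc (-r) T, ‖x t‖ ≤ A := by
    intro t ht
    refine (hx.bound_iterate h hT hr hθ hθ2 hν hθν hG hg hΔ hΔ1 hΔM hΔG hΔY n t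
      ⟨ht.1, le_min (ht.2.trans hnT) ht.2⟩).trans ?_
    have : 13 * M * 2 ^ n ≤ A := by rw [hA]; gcongr
    linarith
  have hA0 : 0 ≤ A := by positivity
  have hDexp : Δ ^ (-θ) ≤ Real.exp (c₀ * z) := by
    calc Δ ^ (-θ) = (1 / Δ) ^ θ := by rw [one_div, Real.inv_rpow hΔ.le, Real.rpow_neg hΔ.le]
      _ ≤ (1 / Δ) ^ (1 : ℝ) := Real.rpow_le_rpow_of_exponent_le
          ((one_le_div hΔ).2 hΔ1) (by linarith)
      _ = c₀ * z := by rw [Real.rpow_one, hinv]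
      _ ≤ Real.exp (c₀ * z) := by linarith [Real.add_one_le_exp (c₀ * z)]
  have hD0 : 0 ≤ Δ ^ (-θ) := by positivity
  have hhol : ∀ s t, -r ≤ s → s ≤ t → t ≤ T →
      ‖x t - x s‖ ≤ (2 * A + 6 * M) * Δ ^ (-θ) * (t - s) ^ θ := by
    intro s t hs hst ht
    have hp : 0 ≤ (t - s) ^ θ := Real.rpow_nonneg (by linarith) _
    rcases le_or_gt (t - s) Δ with hle | hgt
    · refine (hx.local_holder h hr hθ hθ2 hν hθν hG hg hΔ hΔ1 hΔM hΔG hΔY hT le_rfl hsup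
        hs hst ht hle).trans ?_
      gcongr
      linarith
    · have h1 : ‖x t - x s‖ ≤ 2 * A := by
        refine (norm_sub_le _ _).trans ?_
        linarith [hsup t ⟨by linarith, ht⟩, hsup s ⟨hs, by linarith⟩]
      have h2 : 1 ≤ Δ ^ (-θ) * (t - s) ^ θ := by
        rw [Real.rpow_neg hΔ.le, le_inv_mul_iff₀ (by positivity), mul_one]
        exact Real.rpow_le_rpow hΔ.le hgt.le hθ.le
      rw [mul_assoc]
      refine h1.trans ((le_mul_of_one_le_right (by positivity) h2).trans ?_)
      gcongr
      linarith
  set C := (26 * Real.exp 1 + 6) * M + (T + 1) * c₀ with hC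
  have hCc : (T + 1) * c₀ ≤ C := by
    have : 0 ≤ (26 * Real.exp 1 + 6) * M := by positivity
    linarith
  have hCM : (26 * Real.exp 1 + 6) * M ≤ C := by
    have : 0 ≤ (T + 1) * c₀ := by positivity
    linarith
  have hcomb : (2 * A + 6 * M) * Real.exp (c₀ * z) ≤ C * Real.exp (C * z) := by
    have hone : 1 ≤ Real.exp (T * c₀ * z) := Real.one_le_exp (by positivity)
    calc (2 * A + 6 * M) * Real.exp (c₀ * z)
        ≤ ((26 * Real.exp 1 + 6) * M * Real.exp (T * c₀ * z)) * Real.exp (c₀ * z) := by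
          gcongr
          rw [hA]
          nlinarith
      _ = (26 * Real.exp 1 + 6) * M * Real.exp ((T + 1) * c₀ * z) := by
          rw [mul_assoc _ (Real.exp _), ← Real.exp_add]; congr 2; ring
      _ ≤ C * Real.exp (C * z) := by gcongr
  refine ⟨fun t ht => (hsup t ht).trans (le_trans ?_ hcomb), fun s t hs hst ht => ?_⟩
  · have : 1 ≤ Real.exp (c₀ * z) := Real.one_le_exp (by positivity)
    nlinarith
  · refine (hhol s t hs hst ht).trans (mul_le_mul_of_nonneg_right (le_trans ?_ hcomb)
      (Real.rpow_nonneg (by linarith) _))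
    gcongr

/-- Once sup and Hölder bounds are known, the stochastic integral has increments of order `(t - s) ^
ν`. Only `∫ b₀` may be rougher than that, which motivates including it in the clock. -/
theorem DelayPath.norm_sub_le_clock (hx : DelayPath T r θ M b σ g x)
    (h : CoeffBounds T θ M b σ b₀) (hr : 0 ≤ r) (hθ : 0 < θ) (hν : 0 < ν) (hθν : 1 < θ + ν)
    (hG : 0 ≤ G)
    (hg : ∀ j, ∀ u ∈ Icc 0 T, ∀ v ∈ Icc 0 T, u ≤ v → |g j v - g j u| ≤ G * (v - u) ^ ν)
    {R : ℝ} (hR : ∀ t ∈ Icc (-r) T, ‖x t‖ ≤ R)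
    (hRh : ∀ s t, -r ≤ s → s ≤ t → t ≤ T → ‖x t - x s‖ ≤ R * (t - s) ^ θ) {s t : ℝ}
    (hs : 0 ≤ s) (hst : s ≤ t) (ht : t ≤ T) :
    ‖x t - x s‖ ≤ M * R * (t - s) + (∫ u in s..t, b₀ u) +
      m * (G * (M * (1 + R) * (1 + youngConst (θ + ν) * T ^ θ)) * (t - s) ^ ν) := by
  have hM := h.one_le
  have hR0 : 0 ≤ R := (norm_nonneg _).trans (hR 0 ⟨by linarith, by linarith⟩)
  have hY := youngConst_nonneg hθν
  rcases hst.eq_or_lt with rfl | hst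
  · simp [Real.zero_rpow hν.ne']
  have h1 := hx.eq.norm_sub_le h hθ hν hθν hG hR0 hg hs hst ht
    (fun u hu => hR u ⟨by linarith [hu.1], by linarith [hu.2]⟩)
    (hR _ ⟨by linarith, by linarith⟩)
    (fun u hu v hv huv => by
      have := hRh (u - r) (v - r) (by linarith [hu.1]) (by linarith) (by linarith [hv.2])
      rwa [show v - r - (u - r) = v - u by ring] at this)
  refine h1.trans ?_
  have h2 : (t - s) ^ θ ≤ T ^ θ := Real.rpow_le_rpow (by linarith) (by linarith) hθ.le
  have h3 : M * (1 + R) + youngConst (θ + ν) * (M * (1 + R)) * (t - s) ^ θ ≤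
      M * (1 + R) * (1 + youngConst (θ + ν) * T ^ θ) := by
    have := mul_le_mul_of_nonneg_left h2
      (show 0 ≤ youngConst (θ + ν) * (M * (1 + R)) by positivity)
    linarith
  have h4 : 0 ≤ (t - s) ^ ν := Real.rpow_nonneg (by linarith) _
  gcongr

/-- Solutions are `1/2`-Hölder on `[0, T]`, with a constant of the same growth. -/
theorem exists_apriori_bound_half (m : ℕ) {T θ M ν : ℝ} (hT : 0 ≤ T) (hθ : 0 < θ)
    (hθ2 : θ ≤ 1 / 2) (hν : 1 / 2 < ν) (hν1 : ν ≤ 1) (hθν : 1 < θ + ν) (hM : 1 ≤ M) :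
    ∃ C : ℝ, 1 ≤ C ∧ ∀ (b : ℝ → E → E) (σ : ℝ → E → Fin m → E) (b₀ : ℝ → ℝ)
      (g : Fin m → ℝ → ℝ) (x : ℝ → E) (r G : ℝ), CoeffBounds T θ M b σ b₀ → 0 ≤ r → 0 ≤ G →
      (∀ j, ∀ u ∈ Icc 0 T, ∀ v ∈ Icc 0 T, u ≤ v → |g j v - g j u| ≤ G * (v - u) ^ ν) →
      DelayPath T r θ M b σ g x →
      (∀ t ∈ Icc (-r) T, ‖x t‖ ≤ C * Real.exp (C * (1 + G) ^ (1 / ν))) ∧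
      (∀ s t, -r ≤ s → s ≤ t → t ≤ T →
        ‖x t - x s‖ ≤ C * Real.exp (C * (1 + G) ^ (1 / ν)) * (t - s) ^ θ) ∧
      (∀ s t, 0 ≤ s → s ≤ t → t ≤ T →
        ‖x t - x s‖ ≤ C * Real.exp (C * (1 + G) ^ (1 / ν)) * (t - s) ^ (1 / 2 : ℝ)) := by
  obtain ⟨C, hC1, hC⟩ := exists_apriori_bound (E := E) m hT hθ hθ2 hν hν1 hθν hM
  have hY := youngConst_nonneg hθν
  set Y := youngConst (θ + ν) with hYdef
  set K := M * T ^ (1 / 2 : ℝ) + M + 2 * m * M * (1 + Y * T ^ θ) * T ^ (ν - 1 / 2) with hK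
  have hK0 : 0 ≤ K := by positivity
  have hν0 : 0 < ν := by linarith
  -- Young's estimate contributes an extra factor `G`, absorbed by `G ≤ z ≤ exp z`. This raises the
  -- exponent to `(C + 1) z`, while `K` collects the remaining constants.
  refine ⟨(C + 1) * (K + 1), by nlinarith, ?_⟩
  intro b σ b₀ g x r G h hr hG hg hx
  obtain ⟨hR, hRh⟩ := hC b σ b₀ g x r G h hr hG hg hx
  set z : ℝ := (1 + G) ^ (1 / ν) with hz
  have h1ν : 1 ≤ 1 / ν := by rw [le_div_iff₀ hν0]; linarith
  have hz1 : 1 + G ≤ z := Real.self_le_rpow_of_one_le (by linarith) h1ν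
  set R := C * Real.exp (C * z) with hRdef
  set C' := (C + 1) * (K + 1) with hC'
  have hCC' : C + 1 ≤ C' := by nlinarith
  have hCK : C * K ≤ C' := by nlinarith
  have hR1 : 1 ≤ R := by
    have : 1 ≤ Real.exp (C * z) := Real.one_le_exp (by positivity)
    nlinarith
  have hRR' : R ≤ C' * Real.exp (C' * z) := by
    rw [hRdef]
    gcongr <;> linarith
  refine ⟨fun t ht => (hR t ht).trans hRR', fun s t hs hst ht => (hRh s t hs hst ht).trans
    (mul_le_mul_of_nonneg_right hRR' (Real.rpow_nonneg (by linarith) _)), fun s t hs hst ht => ?_⟩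
  have h1 := hx.norm_sub_le_clock h hr hθ hν0 hθν hG hg hR hRh hs hst ht
  have h2 := h.half s t hs hst ht
  have d0 : 0 ≤ t - s := by linarith
  have dT : t - s ≤ T := by linarith
  have p1 := rpow_le_mul_rpow_of_le (a := 1) (θ := 1 / 2) d0 dT (by norm_num) (by norm_num)
  have p2 := rpow_le_mul_rpow_of_le (a := ν) (θ := 1 / 2) d0 dT (by norm_num) hν.le
  rw [Real.rpow_one, show (1 : ℝ) - 1 / 2 = 1 / 2 by norm_num] at p1
  set w := (t - s) ^ (1 / 2 : ℝ) with hw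
  have hw0 : 0 ≤ w := Real.rpow_nonneg d0 _
  have hGe : G ≤ Real.exp z := by linarith [Real.add_one_le_exp z]
  have he : 1 ≤ Real.exp z := Real.one_le_exp (by positivity)
  have hmain : M * R * (t - s) + M * w + m * (G * (M * (1 + R) * (1 + Y * T ^ θ)) * (t - s) ^ ν)
      ≤ (R * Real.exp z * K) * w := by
    have q1 : M * R * (t - s) ≤ R * Real.exp z * (M * T ^ (1 / 2 : ℝ)) * w := by
      calc M * R * (t - s) ≤ M * R * (T ^ (1 / 2 : ℝ) * w) := by gcongr
        _ = 1 * (R * (M * T ^ (1 / 2 : ℝ)) * w) := by ring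
        _ ≤ Real.exp z * (R * (M * T ^ (1 / 2 : ℝ)) * w) := by gcongr
        _ = _ := by ring
    have q2 : M * w ≤ R * Real.exp z * M * w := by
      calc M * w = 1 * 1 * M * w := by ring
        _ ≤ R * Real.exp z * M * w := by gcongr
    have q3 : m * (G * (M * (1 + R) * (1 + Y * T ^ θ)) * (t - s) ^ ν) ≤
        R * Real.exp z * (2 * m * M * (1 + Y * T ^ θ) * T ^ (ν - 1 / 2)) * w := by
      calc m * (G * (M * (1 + R) * (1 + Y * T ^ θ)) * (t - s) ^ ν)
          ≤ m * (Real.exp z * (M * (R + R) * (1 + Y * T ^ θ)) * (T ^ (ν - 1 / 2) * w)) := by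
            gcongr
        _ = _ := by ring
    rw [hK]
    linarith [mul_add (R * Real.exp z) (M * T ^ (1 / 2 : ℝ) + M)
      (2 * m * M * (1 + Y * T ^ θ) * T ^ (ν - 1 / 2))]
  calc ‖x t - x s‖ ≤ (R * Real.exp z * K) * w := by linarith
    _ = (C * K) * Real.exp ((C + 1) * z) * w := by
        rw [hRdef, mul_assoc C, ← Real.exp_add]; ring_nf
    _ ≤ C' * Real.exp (C' * z) * w := by gcongr

end Growth

/-! ### Comparison of a solution with a delayed solution. -/

section Stability

variable {E : Type*} [NormedAddCommGroup E] {m : ℕ}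
variable {T θ δ N M M' : ℝ} {b : ℝ → E → E} {σ : ℝ → E → Fin m → E} {b₀ : ℝ → ℝ}

/-- The clock in which solutions are Hölder continuous with the exponent of the driving path. -/
noncomputable def clock (b₀ : ℝ → ℝ) (t : ℝ) : ℝ := t + ∫ u in (0 : ℝ)..t, b₀ u

theorem CoeffBounds.clock_sub (h : CoeffBounds T θ M b σ b₀) {s t : ℝ} (hs : 0 ≤ s) (hst : s ≤ t)
    (ht : t ≤ T) : clock b₀ t - clock b₀ s = (t - s) + ∫ u in s..t, b₀ u := by
  have := intervalIntegral.integral_interval_sub_left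
    (h.intervalIntegrable le_rfl (hs.trans hst) ht) (h.intervalIntegrable le_rfl hs (hst.trans ht))
  rw [clock, clock, ← this]; ring

theorem CoeffBounds.integral_nonneg (h : CoeffBounds T θ M b σ b₀) {s t : ℝ} (hs : 0 ≤ s)
    (hst : s ≤ t) (ht : t ≤ T) : 0 ≤ ∫ u in s..t, b₀ u :=
  intervalIntegral.integral_nonneg hst fun u hu => h.nonneg u ⟨hs.trans hu.1, hu.2.trans ht⟩

theorem CoeffBounds.sub_le_clock_sub (h : CoeffBounds T θ M b σ b₀) {s t : ℝ} (hs : 0 ≤ s)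
    (hst : s ≤ t) (ht : t ≤ T) : t - s ≤ clock b₀ t - clock b₀ s := by
  rw [h.clock_sub hs hst ht]
  linarith [h.integral_nonneg hs hst ht]

theorem CoeffBounds.continuousOn_clock (h : CoeffBounds T θ M b σ b₀) (hT : 0 ≤ T) :
    ContinuousOn (clock b₀) (Icc 0 T) := by
  refine continuousOn_id.add ?_
  have := intervalIntegral.continuousOn_primitive_interval' h.integrable left_mem_uIcc
  rwa [uIcc_of_le hT] at this

variable [NormedSpace ℝ E]

/-- The local regularity of the coefficients used to compare two solutions bounded by `N`. -/
structure LocalBounds (T θ δ N M : ℝ) (b : ℝ → E → E) (σ : ℝ → E → Fin m → E) : Prop where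
  nonneg : 0 ≤ M
  differentiable : ∀ t ∈ Icc 0 T, Differentiable ℝ (σ t)
  deriv_time : ∀ s ∈ Icc 0 T, ∀ t ∈ Icc 0 T, ∀ x,
    ‖fderiv ℝ (σ t) x - fderiv ℝ (σ s) x‖ ≤ M * |t - s| ^ θ
  deriv_space : ∀ t ∈ Icc 0 T, ∀ x y, ‖x‖ ≤ N → ‖y‖ ≤ N →
    ‖fderiv ℝ (σ t) x - fderiv ℝ (σ t) y‖ ≤ M * ‖x - y‖ ^ δ
  drift : ∀ t ∈ Icc 0 T, ∀ x y, ‖x‖ ≤ N → ‖y‖ ≤ N → ‖b t x - b t y‖ ≤ M * ‖x - y‖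

theorem norm_segment_le {p q : E} {N z : ℝ} (hp : ‖p‖ ≤ N) (hq : ‖q‖ ≤ N) (hz : z ∈ Icc (0 : ℝ) 1) :
    ‖q + z • (p - q)‖ ≤ N := by
  have e : q + z • (p - q) = (1 - z) • q + z • p := by rw [smul_sub, sub_smul, one_smul]; abel
  rw [e]
  refine (norm_add_le _ _).trans ?_
  rw [norm_smul, norm_smul, Real.norm_of_nonneg hz.1, Real.norm_of_nonneg (sub_nonneg.2 hz.2)]
  nlinarith [mul_le_mul_of_nonneg_left hp hz.1,
    mul_le_mul_of_nonneg_left hq (sub_nonneg.2 hz.2)]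

/-- The second difference of `σ` along two paths. -/
theorem LocalBounds.norm_second_difference_le (hl : LocalBounds T θ δ N M' b σ)
    (h : CoeffBounds T θ M b σ b₀) (hδ : 0 ≤ δ) {u v ρ : ℝ} (hu : u ∈ Icc 0 T) (hv : v ∈ Icc 0 T)
    {x₁ y₁ x₀ y₀ : E} (hx₁ : ‖x₁‖ ≤ N) (hy₁ : ‖y₁‖ ≤ N) (hx₀ : ‖x₀‖ ≤ N) (hy₀ : ‖y₀‖ ≤ N)
    (hx : ‖x₁ - x₀‖ ≤ ρ) (hy : ‖y₁ - y₀‖ ≤ ρ) :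
    ‖(σ v x₁ - σ v y₁) - (σ u x₀ - σ u y₀)‖ ≤
      M * ‖(x₁ - y₁) - (x₀ - y₀)‖ + M' * (|v - u| ^ θ + ρ ^ δ) * ‖x₀ - y₀‖ := by
  have hM : 0 ≤ M := by linarith [h.one_le]
  -- The second difference is `f 1 - f 0` along two segments traversed simultaneously. In `f' z` the
  -- change of direction meets a differential bounded by the Lipschitz constant, and the change of
  -- differential meets the direction `x₀ - y₀`; corresponding points of the segments stay within
  -- `ρ`.
  let f : ℝ → Fin m → E := fun z => σ v (y₁ + z • (x₁ - y₁)) - σ u (y₀ + z • (x₀ - y₀))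
  let f' : ℝ → Fin m → E := fun z => fderiv ℝ (σ v) (y₁ + z • (x₁ - y₁)) (x₁ - y₁) -
    fderiv ℝ (σ u) (y₀ + z • (x₀ - y₀)) (x₀ - y₀)
  have hline : ∀ (t : ℝ) (ht : t ∈ Icc 0 T) (p q : E) (z : ℝ),
      HasDerivAt (fun z : ℝ => σ t (q + z • p)) (fderiv ℝ (σ t) (q + z • p) p) z := by
    intro t ht p q z
    have h1 : HasDerivAt (fun z : ℝ => q + z • p) p z := by
      simpa using ((hasDerivAt_id z).smul_const p).const_add q
    exact ((hl.differentiable t ht (q + z • p)).hasFDerivAt).comp_hasDerivAt z h1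
  have hder : ∀ z ∈ Icc (0 : ℝ) 1, HasDerivWithinAt f (f' z) (Icc 0 1) z := fun z _ =>
    ((hline v hv _ _ z).sub (hline u hu _ _ z)).hasDerivWithinAt
  have hbound : ∀ z ∈ Ico (0 : ℝ) 1, ‖f' z‖ ≤
      M * ‖(x₁ - y₁) - (x₀ - y₀)‖ + M' * (|v - u| ^ θ + ρ ^ δ) * ‖x₀ - y₀‖ := by
    intro z hz
    have hz' : z ∈ Icc (0 : ℝ) 1 := Ico_subset_Icc_self hz
    set p₁ := y₁ + z • (x₁ - y₁) with hp₁
    set p₀ := y₀ + z • (x₀ - y₀) with hp₀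
    have hp₁N : ‖p₁‖ ≤ N := norm_segment_le hx₁ hy₁ hz'
    have hp₀N : ‖p₀‖ ≤ N := norm_segment_le hx₀ hy₀ hz'
    have hpp : ‖p₁ - p₀‖ ≤ ρ := by
      have e : p₁ - p₀ = (y₁ - y₀) + z • ((x₁ - x₀) - (y₁ - y₀)) := by
        rw [hp₁, hp₀]; simp only [smul_sub]; abel
      rw [e]
      exact norm_segment_le hx hy hz'
    have e : f' z = fderiv ℝ (σ v) p₁ ((x₁ - y₁) - (x₀ - y₀)) +
        ((fderiv ℝ (σ v) p₁ - fderiv ℝ (σ u) p₁) + (fderiv ℝ (σ u) p₁ - fderiv ℝ (σ u) p₀))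
          (x₀ - y₀) := by
      simp only [f', ← hp₁, ← hp₀, map_sub, add_apply,
        sub_apply]
      abel
    rw [e]
    refine (norm_add_le _ _).trans (add_le_add ?_ ?_)
    · refine (ContinuousLinearMap.le_opNorm _ _).trans (mul_le_mul_of_nonneg_right ?_ (norm_nonneg _))
      have hlip : LipschitzWith M.toNNReal (σ v) := LipschitzWith.of_dist_le_mul fun p q => by
        rw [dist_eq_norm, dist_eq_norm, Real.coe_toNNReal _ hM]
        exact h.lip v hv p q
      have := norm_fderiv_le_of_lipschitz ℝ hlip (x₀ := p₁)
      rwa [Real.coe_toNNReal _ hM] at this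
    · refine (ContinuousLinearMap.le_opNorm _ _).trans (mul_le_mul_of_nonneg_right ?_ (norm_nonneg _))
      rw [mul_add]
      refine (norm_add_le _ _).trans (add_le_add (hl.deriv_time u hu v hv p₁) ?_)
      refine (hl.deriv_space u hu p₁ p₀ hp₁N hp₀N).trans (mul_le_mul_of_nonneg_left ?_ hl.nonneg)
      exact Real.rpow_le_rpow (norm_nonneg _) hpp hδ
  have := norm_image_sub_le_of_norm_deriv_le_segment_01' hder hbound
  have e : f 1 - f 0 = (σ v x₁ - σ v y₁) - (σ u x₀ - σ u y₀) := by
    simp only [f, one_smul, zero_smul, add_zero, add_sub_cancel]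
    abel
  rwa [e] at this

variable {g : Fin m → ℝ → ℝ} {x y : ℝ → E} {r ν G : ℝ}

/-- On a short interval the difference of a solution and a delayed solution is controlled by
its initial value and the size `ε` of the perturbation caused by the delay. -/
theorem norm_sub_le_of_short_interval (h : CoeffBounds T θ M b σ b₀)
    {κ R R₁ ε ℓ s₀ t₀ : ℝ} (hl : LocalBounds T θ δ R M' b σ)
    (hx : IncrementEq T 0 b σ g x) (hy : IncrementEq T r b σ g y)
    (hδ : 0 ≤ δ) (hκ : 0 < κ) (hκθ : κ ≤ θ) (hκδ : κ ≤ ν * δ) (hκν : κ ≤ ν) (hν : 0 < ν)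
    (hκ1 : κ ≤ 1) (hsum : 1 < κ + ν) (hG : 0 ≤ G) (hR₁ : 0 ≤ R₁) (hε : 0 ≤ ε)
    (hg : ∀ j, ∀ u ∈ Icc 0 T, ∀ v ∈ Icc 0 T, u ≤ v → |g j v - g j u| ≤ G * (v - u) ^ ν)
    (hxR : ∀ t ∈ Icc 0 T, ‖x t‖ ≤ R) (hyR : ∀ t ∈ Icc 0 T, ‖y t‖ ≤ R)
    (hx₁ : ∀ u v, s₀ ≤ u → u ≤ v → v ≤ t₀ → ‖x v - x u‖ ≤ R₁ * (clock b₀ v - clock b₀ u) ^ ν)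
    (hy₁ : ∀ u v, s₀ ≤ u → u ≤ v → v ≤ t₀ → ‖y v - y u‖ ≤ R₁ * (clock b₀ v - clock b₀ u) ^ ν)
    (hε₁ : ∀ u ∈ Icc 0 T, ‖σ u (y u) - σ u (y (u - r))‖ ≤ ε)
    (hε₂ : ∀ u v, 0 ≤ u → u ≤ v → v ≤ T →
      ‖(σ v (y v) - σ v (y (v - r))) - (σ u (y u) - σ u (y (u - r)))‖ ≤ ε * (v - u) ^ κ)
    (hs₀ : 0 ≤ s₀) (hst : s₀ ≤ t₀) (ht₀ : t₀ ≤ T) (hℓ1 : ℓ ≤ 1)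
    (hℓ : clock b₀ t₀ - clock b₀ s₀ ≤ ℓ)
    (hsmall₁ : m * G * youngConst (κ + ν) * M * ℓ ^ ν ≤ 1 / 2)
    (hsmall₂ : 2 * (M' + m * G * (M + 1) +
      m * G * youngConst (κ + ν) * (M' * (1 + R₁ ^ δ) + 1)) * ℓ ^ κ ≤ 1 / 2)
    {t : ℝ} (ht : t ∈ Icc s₀ t₀) : ‖x t - y t‖ ≤ 2 * ‖x s₀ - y s₀‖ + ε := by
  have hM1 := h.one_le
  have hM'0 := hl.nonneg
  have hY := youngConst_nonneg hsum
  set Y := youngConst (κ + ν) with hYdef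
  -- `P` multiplies the sup distance in the Hölder constant of the second difference. `Q` collects
  -- every contribution of the sup distance and of `ε`, leaving only the Hölder constant itself to
  -- be contracted.
  set P := M' * (1 + R₁ ^ δ) with hP
  have hP0 : 0 ≤ P := by positivity
  set Q := M' + m * G * (M + 1) + m * G * Y * (P + 1) with hQ
  have hQ0 : 0 ≤ Q := by positivity
  let φ := clock b₀
  have φle : ∀ u v, s₀ ≤ u → u ≤ v → v ≤ t₀ → v - u ≤ φ v - φ u := fun u v h1 h2 h3 =>
    h.sub_le_clock_sub (hs₀.trans h1) h2 (h3.trans ht₀)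
  have φℓ : ∀ u v, s₀ ≤ u → u ≤ v → v ≤ t₀ → φ v - φ u ≤ ℓ := by
    intro u v h1 h2 h3
    have e1 := φle s₀ u le_rfl h1 (h2.trans h3)
    have e2 := φle v t₀ (h1.trans h2) h3 le_rfl
    change clock b₀ t₀ - clock b₀ s₀ ≤ ℓ at hℓ
    simp only [φ] at e1 e2 ⊢
    linarith
  have φ0 : ∀ u v, s₀ ≤ u → u ≤ v → v ≤ t₀ → 0 ≤ φ v - φ u := fun u v h1 h2 h3 =>
    (sub_nonneg.2 h2).trans (φle u v h1 h2 h3)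
  have hℓ0 : 0 ≤ ℓ := (φ0 s₀ t₀ le_rfl hst le_rfl).trans (φℓ s₀ t₀ le_rfl hst le_rfl)
  have memT : ∀ u, s₀ ≤ u → u ≤ t₀ → u ∈ Icc 0 T := fun u h1 h2 => ⟨hs₀.trans h1, h2.trans ht₀⟩
  have powκ : ∀ {w a : ℝ}, 0 ≤ w → w ≤ ℓ → κ ≤ a → w ^ a ≤ w ^ κ := by
    intro w a h1 h2 h3
    rcases h1.eq_or_lt with rfl | h1
    · rw [Real.zero_rpow (by linarith), Real.zero_rpow hκ.ne']
    · exact Real.rpow_le_rpow_of_exponent_ge h1 (h2.trans hℓ1) h3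
  -- increments of the difference, given sup and Hölder bounds
  have main : ∀ A B, 0 ≤ A → 0 ≤ B → (∀ u ∈ Icc s₀ t₀, ‖x u - y u‖ ≤ A) →
      (∀ u v, s₀ ≤ u → u ≤ v → v ≤ t₀ → ‖(x v - y v) - (x u - y u)‖ ≤ B * (φ v - φ u) ^ κ) →
      ∀ u v, s₀ ≤ u → u ≤ v → v ≤ t₀ →
        ‖(x v - y v) - (x u - y u)‖ ≤ (Q * (A + ε) + 1 / 2 * B) * (φ v - φ u) ^ κ := by
    intro A B hA0 hB0 hA hB u v hu huv hv
    have hw0 := φ0 u v hu huv hv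
    have hwℓ := φℓ u v hu huv hv
    rcases huv.eq_or_lt with rfl | huv
    · simp [Real.zero_rpow hκ.ne']
    obtain ⟨I, hI, eI⟩ := hx.incr u v (hs₀.trans hu) huv (hv.trans ht₀)
    obtain ⟨J, hJ, eJ⟩ := hy.incr u v (hs₀.trans hu) huv (hv.trans ht₀)
    have hsub : Icc u v ⊆ Icc 0 T := fun w hw => memT w (hu.trans hw.1) (hw.2.trans hv)
    have intx : IntervalIntegrable (fun s => b s (x s)) volume u v :=
      hx.integrable.mono_set (by
        rw [uIcc_of_le huv.le, uIcc_of_le ((hs₀.trans hst).trans ht₀)]; exact hsub)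
    have inty : IntervalIntegrable (fun s => b s (y s)) volume u v :=
      hy.integrable.mono_set (by
        rw [uIcc_of_le huv.le, uIcc_of_le ((hs₀.trans hst).trans ht₀)]; exact hsub)
    have eD : (x v - y v) - (x u - y u) =
        (∫ w in u..v, (b w (x w) - b w (y w))) + ∑ j, (I j - J j) := by
      rw [intervalIntegral.integral_sub intx inty, Finset.sum_sub_distrib]
      calc (x v - y v) - (x u - y u) = (x v - x u) - (y v - y u) := by abel
        _ = _ := by rw [eI, eJ]; abel
    have d1 : ‖∫ w in u..v, (b w (x w) - b w (y w))‖ ≤ M' * A * (v - u) := by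
      have := intervalIntegral.norm_integral_le_of_norm_le_const (a := u) (b := v)
        (f := fun w => b w (x w) - b w (y w)) (C := M' * A) (fun w hw => by
          rw [uIoc_of_le huv.le] at hw
          have hw' : w ∈ Icc u v := Ioc_subset_Icc_self hw
          refine (hl.drift w (hsub hw') _ _ (hxR w (hsub hw')) (hyR w (hsub hw'))).trans ?_
          exact mul_le_mul_of_nonneg_left
            (hA w ⟨hu.trans hw'.1, hw'.2.trans hv⟩) hM'0)
      rwa [abs_of_nonneg (by linarith)] at this
    have d2 := norm_sum_le_of_hasRSIntegral (f := fun w => σ w (x (w - 0)) - σ w (y (w - r)))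
      (g := g) (φ := φ) (θ := κ) (ν := ν) (B := M * B + P * A + ε) (G := G) (S := M * A + ε)
      (J := fun j => I j - J j) huv.le
      ((h.continuousOn_clock ((hs₀.trans hst).trans ht₀)).mono hsub)
      (fun p hp q hq hpq => φle p q (hu.trans hp.1) hpq (hq.2.trans hv)) hκ hν hsum
      (by positivity) hG ?_ ?_ (fun j p hp q hq hpq => hg j p (hsub hp) q (hsub hq) hpq)
      (fun j => (hI j).sub (hJ j))
    · rw [eD]
      refine (norm_add_le _ _).trans ((add_le_add d1 d2).trans ?_)
      change M' * A * (v - u) + m * (G * (M * A + ε + Y * (M * B + P * A + ε) * (φ v - φ u) ^ κ) *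
        (φ v - φ u) ^ ν) ≤ _
      have w1 : v - u ≤ (φ v - φ u) ^ κ := by
        refine (φle u v hu huv.le hv).trans ?_
        have := powκ hw0 hwℓ hκ1
        rwa [Real.rpow_one] at this
      have w2 : (φ v - φ u) ^ ν ≤ (φ v - φ u) ^ κ := powκ hw0 hwℓ hκν
      have w3 : (φ v - φ u) ^ ν ≤ ℓ ^ ν := Real.rpow_le_rpow hw0 hwℓ hν.le
      have w4 : ℓ ^ ν ≤ 1 := Real.rpow_le_one hℓ0 hℓ1 hν.le
      set z := (φ v - φ u) ^ κ with hz
      have hz0 : 0 ≤ z := Real.rpow_nonneg hw0 _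
      set zν := (φ v - φ u) ^ ν with hzν
      have hzν0 : 0 ≤ zν := Real.rpow_nonneg hw0 _
      have t1 : M' * A * (v - u) ≤ M' * A * z := by gcongr
      have t2 : m * G * (M * A + ε) * zν ≤ m * G * (M * A + ε) * z := by gcongr
      have t3 : m * G * Y * (P * A + ε) * (zν * z) ≤ m * G * Y * (P * A + ε) * (1 * z) := by
        gcongr
        linarith
      have t4 : m * G * Y * (M * B) * (zν * z) ≤ 1 / 2 * B * z := by
        calc m * G * Y * (M * B) * (zν * z) ≤ m * G * Y * (M * B) * (ℓ ^ ν * z) := by gcongr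
          _ = (m * G * Y * M * ℓ ^ ν) * (B * z) := by ring
          _ ≤ 1 / 2 * (B * z) := by gcongr
          _ = _ := by ring
      have t5 : M' * A + m * G * (M * A + ε) + m * G * Y * (P * A + ε) ≤ Q * (A + ε) := by
        rw [hQ]
        have hmG : 0 ≤ m * G := by positivity
        have a1 : 0 ≤ M' * ε := by positivity
        have a2 : 0 ≤ m * G * (M * ε + A) := by positivity
        have a3 : 0 ≤ m * G * Y * (P * ε + A) := by positivity
        linarith
      have t6 := mul_le_mul_of_nonneg_right t5 hz0
      linarith
    · intro p hp q hq hpq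
      have hp' : p ∈ Icc u v := Ioc_subset_Icc_self hp
      have hps := hu.trans hp'.1
      have hqt := hq.2.trans hv
      have hz0 := φ0 p q hps hpq hqt
      have hzℓ := φℓ p q hps hpq hqt
      have f1 := hl.norm_second_difference_le h hδ (hsub hp') (hsub hq) (hxR q (hsub hq))
        (hyR q (hsub hq)) (hxR p (hsub hp')) (hyR p (hsub hp')) (hx₁ p q hps hpq hqt)
        (hy₁ p q hps hpq hqt)
      have f2 := hε₂ p q (hsub hp').1 hpq (hsub hq).2
      have f3 := hB p q hps hpq hqt
      have f4 := hA p ⟨hps, hp'.2.trans hv⟩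
      change ‖(σ q (x (q - 0)) - σ q (y (q - r))) - (σ p (x (p - 0)) - σ p (y (p - r)))‖ ≤
        (M * B + P * A + ε) * (φ q - φ p) ^ κ
      rw [sub_zero, sub_zero]
      -- The first bracket compares the two paths at the same time and is a second difference of
      -- `σ`; the second is the pure effect of the delay, controlled by `ε`.
      have e : (σ q (x q) - σ q (y (q - r))) - (σ p (x p) - σ p (y (p - r))) =
          ((σ q (x q) - σ q (y q)) - (σ p (x p) - σ p (y p))) +
          ((σ q (y q) - σ q (y (q - r))) - (σ p (y p) - σ p (y (p - r)))) := by abel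
      rw [e]
      refine (norm_add_le _ _).trans ((add_le_add f1 f2).trans ?_)
      set z := (φ q - φ p) ^ κ with hz
      have hzz0 : 0 ≤ z := Real.rpow_nonneg hz0 _
      have g1 : |q - p| ^ θ ≤ z := by
        rw [abs_of_nonneg (sub_nonneg.2 hpq)]
        exact (Real.rpow_le_rpow (sub_nonneg.2 hpq) (φle p q hps hpq hqt) (by linarith)).trans
          (powκ hz0 hzℓ hκθ)
      -- Here the clock is essential: the paths are `ν`-Hölder in it, so the exponent is `ν δ ≥ κ`;
      -- the `1/2`-Hölder bound in ordinary time would only give `δ / 2`.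
      have g2 : (R₁ * (clock b₀ q - clock b₀ p) ^ ν) ^ δ ≤ R₁ ^ δ * z := by
        rw [Real.mul_rpow hR₁ (Real.rpow_nonneg hz0 _), ← Real.rpow_mul hz0]
        exact mul_le_mul_of_nonneg_left (powκ hz0 hzℓ hκδ) (by positivity)
      have g3 : (q - p) ^ κ ≤ z :=
        Real.rpow_le_rpow (sub_nonneg.2 hpq) (φle p q hps hpq hqt) hκ.le
      have k1 : M * ‖x q - y q - (x p - y p)‖ ≤ M * (B * z) :=
        mul_le_mul_of_nonneg_left f3 (by linarith)
      have k2 : M' * (|q - p| ^ θ + (R₁ * (clock b₀ q - clock b₀ p) ^ ν) ^ δ) * ‖x p - y p‖ ≤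
          M' * (z + R₁ ^ δ * z) * A := by
        gcongr
      have k3 : ε * (q - p) ^ κ ≤ ε * z := mul_le_mul_of_nonneg_left g3 hε
      rw [hP]
      linarith
    · have hvm : v ∈ Icc 0 T := hsub ⟨huv.le, le_rfl⟩
      have e : σ v (x (v - 0)) - σ v (y (v - r)) =
          (σ v (x v) - σ v (y v)) + (σ v (y v) - σ v (y (v - r))) := by rw [sub_zero]; abel
      rw [e]
      refine (norm_add_le _ _).trans (add_le_add ((h.lip v hvm _ _).trans ?_) (hε₁ v hvm))
      exact mul_le_mul_of_nonneg_left (hA v ⟨hu.trans huv.le, hv⟩) (by linarith)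
  -- closing the Hölder estimate
  have holder : ∀ A, 0 ≤ A → (∀ u ∈ Icc s₀ t₀, ‖x u - y u‖ ≤ A) →
      ∀ u v, s₀ ≤ u → u ≤ v → v ≤ t₀ →
        ‖(x v - y v) - (x u - y u)‖ ≤ 2 * (Q * (A + ε)) * (φ v - φ u) ^ κ := by
    intro A hA0 hA u v hu huv hv
    let ι := {p : ℝ × ℝ // s₀ ≤ p.1 ∧ p.1 ≤ p.2 ∧ p.2 ≤ t₀}
    have := le_of_self_improving (ι := ι)
      (f := fun p => ‖(x p.1.2 - y p.1.2) - (x p.1.1 - y p.1.1)‖)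
      (w := fun p => (φ p.1.2 - φ p.1.1) ^ κ) (q := 1 / 2) (K := Q * (A + ε)) (B₀ := 2 * R₁)
      (by positivity) (by positivity) (by norm_num) (by norm_num)
      (fun p => Real.rpow_nonneg (φ0 _ _ p.2.1 p.2.2.1 p.2.2.2) _) ?_ ?_ ⟨(u, v), hu, huv, hv⟩
    · refine this.trans (le_of_eq ?_)
      change Q * (A + ε) / (1 - 1 / 2) * (φ v - φ u) ^ κ = _
      ring
    · rintro ⟨⟨p, q⟩, hp, hpq, hq⟩
      simp only at hp hpq hq ⊢
      have e : (x q - y q) - (x p - y p) = (x q - x p) - (y q - y p) := by abel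
      rw [e]
      refine (norm_sub_le _ _).trans ?_
      have k := mul_le_mul_of_nonneg_left
        (powκ (φ0 p q hp hpq hq) (φℓ p q hp hpq hq) hκν) hR₁
      have k1 := hx₁ p q hp hpq hq
      have k2 := hy₁ p q hp hpq hq
      simp only [φ] at k ⊢
      linarith
    · rintro B hB hBh ⟨⟨p, q⟩, hp, hpq, hq⟩
      exact main A B hA0 hB hA (fun u v h1 h2 h3 => hBh ⟨(u, v), h1, h2, h3⟩) p q hp hpq hq
  -- closing the sup estimate
  have := le_of_self_improving (ι := Icc s₀ t₀) (f := fun u => ‖x u - y u‖)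
    (w := fun _ => 1) (q := 1 / 2) (K := ‖x s₀ - y s₀‖ + 1 / 2 * ε) (B₀ := 2 * R)
    (by positivity)
    (by linarith [(norm_nonneg _).trans (hxR t (memT t ht.1 ht.2))]) (by norm_num) (by norm_num)
    (fun _ => zero_le_one) ?_ ?_ ⟨t, ht⟩
  · refine this.trans (le_of_eq ?_)
    norm_num
    ring
  · rintro ⟨u, hu⟩
    have k1 := hxR u (memT u hu.1 hu.2)
    have k2 := hyR u (memT u hu.1 hu.2)
    simp only [mul_one]
    exact (norm_sub_le _ _).trans (by linarith)
  · rintro A hA hAh ⟨u, hu⟩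
    simp only [mul_one] at hAh ⊢
    have k1 := holder A hA (fun u hu => hAh ⟨u, hu⟩) s₀ u le_rfl hu.1 hu.2
    have k2 : (φ u - φ s₀) ^ κ ≤ ℓ ^ κ :=
      Real.rpow_le_rpow (φ0 _ _ le_rfl hu.1 hu.2) (φℓ _ _ le_rfl hu.1 hu.2) hκ.le
    have k3 : 2 * (Q * (A + ε)) * (φ u - φ s₀) ^ κ ≤ 1 / 2 * (A + ε) := by
      calc 2 * (Q * (A + ε)) * (φ u - φ s₀) ^ κ ≤ 2 * (Q * (A + ε)) * ℓ ^ κ := by gcongr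
        _ = (2 * Q * ℓ ^ κ) * (A + ε) := by ring
        _ ≤ 1 / 2 * (A + ε) := by gcongr
    have e : x u - y u = ((x u - y u) - (x s₀ - y s₀)) + (x s₀ - y s₀) := by abel
    rw [e]
    refine (norm_add_le _ _).trans ?_
    linarith

end Stability

/-! ### Convergence for a fixed driving path. -/

section PathwiseConvergence

theorem exists_mul_rpow_le {c a η : ℝ} (ha : 0 < a) (hη : 0 < η) :
    ∃ ℓ : ℝ, 0 < ℓ ∧ ℓ ≤ 1 ∧ c * ℓ ^ a ≤ η := by
  have h1 : Tendsto (fun ℓ : ℝ => c * ℓ ^ a) (𝓝[>] 0) (𝓝 0) := by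
    have : ContinuousAt (fun ℓ : ℝ => c * ℓ ^ a) 0 :=
      continuousAt_const.mul (Real.continuousAt_rpow_const _ _ (Or.inr ha.le))
    have h2 := this.tendsto
    simp only [Real.zero_rpow ha.ne', mul_zero] at h2
    exact h2.mono_left nhdsWithin_le_nhds
  obtain ⟨ℓ, h2, h3, h4⟩ := ((h1.eventually (ge_mem_nhds hη)).and
    (Ioc_mem_nhdsGT (zero_lt_one : (0 : ℝ) < 1))).exists
  exact ⟨ℓ, h3, h4, h2⟩

variable {E : Type*} [NormedAddCommGroup E]

/-- For `κ > α` the kernel `(t - s) ^ (κ - α - 1)` is integrable at `s = t`, with integral `t ^ (κ -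
α) / (κ - α)`. -/
theorem wNorm_le_of_holder {α κ T a B : ℝ} {f : ℝ → E} (hακ : α < κ) (hB : 0 ≤ B)
    (ha : ∀ t ∈ Icc 0 T, ‖f t‖ ≤ a)
    (hf : ∀ s t, 0 ≤ s → s ≤ t → t ≤ T → ‖f t - f s‖ ≤ B * (t - s) ^ κ) :
    wNorm α 0 T f ≤ ENNReal.ofReal (a + B * (T ^ (κ - α) / (κ - α))) := by
  refine iSup₂_le fun t ht => ?_
  have hT : 0 ≤ T := ht.1.trans ht.2
  have ha0 : 0 ≤ a := (norm_nonneg _).trans (ha t ht)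
  have hd : 0 < κ - α := sub_pos.2 hακ
  rw [ENNReal.ofReal_add ha0 (by positivity)]
  refine add_le_add ?_ ?_
  · rw [← ofReal_norm]
    exact ENNReal.ofReal_le_ofReal (ha t ht)
  · have hint : IntervalIntegrable (fun s => B * (t - s) ^ (κ - α - 1)) volume 0 t := by
      refine IntervalIntegrable.const_mul ?_ B
      have := (intervalIntegral.intervalIntegrable_rpow' (a := 0) (b := t)
        (show -1 < κ - α - 1 by linarith)).comp_sub_left t
      simpa using this.symm
    have hval : ∫ s in (0 : ℝ)..t, B * (t - s) ^ (κ - α - 1) = B * (t ^ (κ - α) / (κ - α)) := by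
      rw [intervalIntegral.integral_const_mul,
        intervalIntegral.integral_comp_sub_left (fun u => u ^ (κ - α - 1)) t,
        integral_rpow (Or.inl (by linarith))]
      simp [Real.zero_rpow hd.ne']
    have hintOn : IntegrableOn (fun s => B * (t - s) ^ (κ - α - 1)) (Ioc 0 t) :=
      (intervalIntegrable_iff_integrableOn_Ioc_of_le ht.1).1 hint
    calc ∫⁻ s in Ioo 0 t, ‖f t - f s‖ₑ / ENNReal.ofReal ((t - s) ^ (α + 1))
        ≤ ∫⁻ s in Ioo 0 t, ENNReal.ofReal (B * (t - s) ^ (κ - α - 1)) := by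
          refine setLIntegral_mono' measurableSet_Ioo fun s hs => ?_
          have hpos : 0 < t - s := by linarith [hs.2]
          rw [← ofReal_norm, ← ENNReal.ofReal_div_of_pos (by positivity)]
          refine ENNReal.ofReal_le_ofReal ?_
          rw [div_le_iff₀ (by positivity), mul_assoc, ← Real.rpow_add hpos]
          have := hf s t hs.1.le hs.2.le ht.2
          rwa [show κ - α - 1 + (α + 1) = κ by ring]
      _ ≤ ∫⁻ s in Ioc 0 t, ENNReal.ofReal (B * (t - s) ^ (κ - α - 1)) :=
          lintegral_mono_set Ioo_subset_Ioc_self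
      _ = ENNReal.ofReal (∫ s in Ioc 0 t, B * (t - s) ^ (κ - α - 1)) := by
          rw [ofReal_integral_eq_lintegral_ofReal hintOn]
          filter_upwards [ae_restrict_mem measurableSet_Ioc] with s hs
          exact mul_nonneg hB (Real.rpow_nonneg (by linarith [hs.2]) _)
      _ = ENNReal.ofReal (B * (t ^ (κ - α) / (κ - α))) := by
          rw [← intervalIntegral.integral_of_le ht.1, hval]
      _ ≤ _ := by
          refine ENNReal.ofReal_le_ofReal ?_
          have : t ^ (κ - α) ≤ T ^ (κ - α) := Real.rpow_le_rpow ht.1 ht.2 hd.le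
          gcongr

/-- Interpolation, from `d = d ^ (1 - c) * d ^ c`: it trades smallness in sup norm against a Hölder
bound. -/
theorem le_rpow_mul_rpow_of_le {d p q c : ℝ} (hd : 0 ≤ d) (hp : d ≤ p) (hq : d ≤ q) (hc : 0 ≤ c)
    (hc1 : c ≤ 1) : d ≤ p ^ (1 - c) * q ^ c := by
  calc d = d ^ (1 - c) * d ^ c := by
        rw [← Real.rpow_add_of_nonneg hd (by linarith) hc, sub_add_cancel, Real.rpow_one]
    _ ≤ p ^ (1 - c) * q ^ c := by
        have := sub_nonneg.2 hc1
        have := hd.trans hp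
        gcongr

variable {m : ℕ} {T θ δ M M' : ℝ} {b : ℝ → E → E} {σ : ℝ → E → Fin m → E} {b₀ : ℝ → ℝ}

/-- The perturbation of the diffusion coefficient caused by a small delay. -/
theorem CoeffBounds.delay_perturbation (h : CoeffBounds T θ M b σ b₀) {κ R r : ℝ} {y : ℝ → E}
    (hκ : 0 < κ) (hκθ : κ ≤ θ) (hr : 0 < r) (hr1 : r ≤ 1) (hR : 0 ≤ R)
    (hyR : ∀ s t, -r ≤ s → s ≤ t → t ≤ T → ‖y t - y s‖ ≤ R * (t - s) ^ θ) :
    (∀ u ∈ Icc 0 T, ‖σ u (y u) - σ u (y (u - r))‖ ≤ 2 * M * (1 + R) * r ^ (θ - κ)) ∧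
    ∀ u v, 0 ≤ u → u ≤ v → v ≤ T →
      ‖(σ v (y v) - σ v (y (v - r))) - (σ u (y u) - σ u (y (u - r)))‖ ≤
        2 * M * (1 + R) * r ^ (θ - κ) * (v - u) ^ κ := by
  have hM : 0 ≤ M := by linarith [h.one_le]
  have sup : ∀ u ∈ Icc 0 T, ‖σ u (y u) - σ u (y (u - r))‖ ≤ M * (1 + R) * r ^ θ := by
    intro u hu
    refine (h.lip u hu _ _).trans ?_
    have := hyR (u - r) u (by linarith [hu.1]) (by linarith) hu.2
    rw [sub_sub_cancel] at this
    rw [mul_assoc]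
    refine mul_le_mul_of_nonneg_left (this.trans ?_) hM
    gcongr
    linarith
  have hmul : r ^ θ = r ^ (θ - κ) * r ^ κ := by rw [← Real.rpow_add hr]; congr 1; ring
  refine ⟨fun u hu => (sup u hu).trans ?_, fun u v hu huv hv => ?_⟩
  · have h1 : r ^ κ ≤ 1 := Real.rpow_le_one hr.le hr1 hκ.le
    have h2 : r ^ θ ≤ r ^ (θ - κ) := by
      rw [hmul]; exact mul_le_of_le_one_right (by positivity) h1
    have h3 : 0 ≤ M * (1 + R) * r ^ (θ - κ) := by positivity
    have h4 : M * (1 + R) * r ^ θ ≤ M * (1 + R) * r ^ (θ - κ) := by gcongr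
    linarith
  · have hu' : u ∈ Icc 0 T := ⟨hu, huv.trans hv⟩
    have hv' : v ∈ Icc 0 T := ⟨hu.trans huv, hv⟩
    -- For increments shorter than the delay, the `θ`-regularity of both terms gives `(v - u) ^ θ ≤
    -- r ^ (θ - κ) (v - u) ^ κ`. For longer ones the sup bound of order `r ^ θ` suffices.
    rcases le_total (v - u) r with hle | hle
    · have k1 := h.norm_sigma_sub_le (y := y u) (z := y v) hu' hv' huv
      have k2 := h.norm_sigma_sub_le (y := y (u - r)) (z := y (v - r)) hu' hv' huv
      have k3 := hyR u v (by linarith) huv hv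
      have k4 := hyR (u - r) (v - r) (by linarith) (by linarith) (by linarith)
      rw [show v - r - (u - r) = v - u by ring] at k4
      have k5 := rpow_le_mul_rpow_of_le (sub_nonneg.2 huv) hle hκ hκθ
      have e : (σ v (y v) - σ v (y (v - r))) - (σ u (y u) - σ u (y (u - r))) =
          (σ v (y v) - σ u (y u)) - (σ v (y (v - r)) - σ u (y (u - r))) := by abel
      rw [e]
      refine (norm_sub_le _ _).trans ?_
      have k6 := mul_le_mul_of_nonneg_left k5 (show 0 ≤ 2 * M * (1 + R) by positivity)
      have k7 := mul_le_mul_of_nonneg_left k3 hM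
      have k8 := mul_le_mul_of_nonneg_left k4 hM
      linarith
    · refine (norm_sub_le _ _).trans ((add_le_add (sup v hv') (sup u hu')).trans ?_)
      have k1 : r ^ κ ≤ (v - u) ^ κ := Real.rpow_le_rpow hr.le hle hκ.le
      rw [hmul]
      have : 2 * M * (1 + R) * r ^ (θ - κ) * r ^ κ ≤ 2 * M * (1 + R) * r ^ (θ - κ) * (v - u) ^ κ := by
        gcongr
      linarith

variable [NormedSpace ℝ E] {g : Fin m → ℝ → ℝ} {x : ℝ → E} {ν G : ℝ}

/-- The distance of a solution to the solutions of the delay equations is of the order of a power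
of the delay. -/
theorem exists_norm_sub_le_rpow_delay (h : CoeffBounds T θ M b σ b₀) {κ R : ℝ}
    (hl : LocalBounds T θ δ R M' b σ) (hT : 0 ≤ T)
    (hδ : 0 ≤ δ) (hκ : 0 < κ) (hκθ : κ ≤ θ) (hκδ : κ ≤ ν * δ) (hθν' : θ ≤ ν)
    (hν : 0 < ν) (hν1 : ν ≤ 1) (hsum : 1 < κ + ν) (hG : 0 ≤ G)
    (hg : ∀ j, ∀ u ∈ Icc 0 T, ∀ v ∈ Icc 0 T, u ≤ v → |g j v - g j u| ≤ G * (v - u) ^ ν)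
    (hx : DelayPath T 0 θ M b σ g x) (hxR : ∀ t ∈ Icc 0 T, ‖x t‖ ≤ R)
    (hxh : ∀ s t, 0 ≤ s → s ≤ t → t ≤ T → ‖x t - x s‖ ≤ R * (t - s) ^ θ) :
    ∃ C : ℝ, 0 ≤ C ∧ ∀ (r : ℝ) (y : ℝ → E), 0 < r → r ≤ 1 → DelayPath T r θ M b σ g y →
      (∀ t ∈ Icc (-r) T, ‖y t‖ ≤ R) →
      (∀ s t, -r ≤ s → s ≤ t → t ≤ T → ‖y t - y s‖ ≤ R * (t - s) ^ θ) → y 0 = x 0 →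
      ∀ t ∈ Icc 0 T, ‖x t - y t‖ ≤ C * r ^ (θ - κ) := by
  have hθ : 0 < θ := by linarith
  have hM1 := h.one_le
  have hR0 : 0 ≤ R := (norm_nonneg _).trans (hxR 0 ⟨le_rfl, hT⟩)
  have hM'0 := hl.nonneg
  have hθν : 1 < θ + ν := by linarith
  have hYκ := youngConst_nonneg hsum
  have hYθ := youngConst_nonneg hθν
  set K₁ := m * (G * (M * (1 + R) * (1 + youngConst (θ + ν) * T ^ θ))) with hK₁
  have hK₁0 : 0 ≤ K₁ := by positivity
  set R₁ := M * R + 1 + K₁ with hR₁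
  have hR₁0 : 0 ≤ R₁ := by positivity
  obtain ⟨ℓ₁, hℓ₁0, hℓ₁1, hℓ₁⟩ := exists_mul_rpow_le
    (c := m * G * youngConst (κ + ν) * M) hν (one_half_pos (α := ℝ))
  obtain ⟨ℓ₂, hℓ₂0, hℓ₂1, hℓ₂⟩ := exists_mul_rpow_le
    (c := 2 * (M' + m * G * (M + 1) + m * G * youngConst (κ + ν) * (M' * (1 + R₁ ^ δ) + 1))) hκ
    (one_half_pos (α := ℝ))
  set ℓ := min ℓ₁ ℓ₂ with hℓ
  have hℓ0 : 0 < ℓ := lt_min hℓ₁0 hℓ₂0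
  have hℓ1 : ℓ ≤ 1 := (min_le_left _ _).trans hℓ₁1
  have small₁ : m * G * youngConst (κ + ν) * M * ℓ ^ ν ≤ 1 / 2 := by
    refine le_trans ?_ hℓ₁
    gcongr
    exact min_le_left _ _
  have small₂ : 2 * (M' + m * G * (M + 1) +
      m * G * youngConst (κ + ν) * (M' * (1 + R₁ ^ δ) + 1)) * ℓ ^ κ ≤ 1 / 2 := by
    refine le_trans ?_ hℓ₂
    gcongr
    exact min_le_right _ _
  -- A time step of length `Δ ≤ 1` has clock length at most `Δ + M Δ ^ (1/2) ≤ 2 M Δ ^ (1/2)`.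
  -- Neither `ℓ` nor `Δ` depends on the delay, so the number of steps is fixed.
  obtain ⟨Δ, hΔ0, hΔ1, hΔ⟩ := exists_mul_rpow_le (c := 2 * M) (a := 1 / 2) (by norm_num) hℓ0
  have clockΔ : ∀ s t, 0 ≤ s → s ≤ t → t ≤ T → t - s ≤ Δ → clock b₀ t - clock b₀ s ≤ ℓ := by
    intro s t hs hst ht hd
    rw [h.clock_sub hs hst ht]
    have k1 := h.half s t hs hst ht
    have k2 : (t - s) ^ (1 / 2 : ℝ) ≤ Δ ^ (1 / 2 : ℝ) :=
      Real.rpow_le_rpow (by linarith) hd (by norm_num)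
    have k3 : Δ ≤ Δ ^ (1 / 2 : ℝ) := by
      have := Real.rpow_le_rpow_of_exponent_ge hΔ0 hΔ1 (show (1 / 2 : ℝ) ≤ 1 by norm_num)
      rwa [Real.rpow_one] at this
    have k4 : 0 ≤ Δ ^ (1 / 2 : ℝ) := by positivity
    nlinarith [mul_le_mul_of_nonneg_left k2 (show 0 ≤ M by linarith)]
  have incr : ∀ (r : ℝ) (y : ℝ → E), 0 ≤ r → DelayPath T r θ M b σ g y →
      (∀ t ∈ Icc (-r) T, ‖y t‖ ≤ R) →
      (∀ s t, -r ≤ s → s ≤ t → t ≤ T → ‖y t - y s‖ ≤ R * (t - s) ^ θ) →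
      ∀ s t, 0 ≤ s → s ≤ t → t ≤ T → clock b₀ t - clock b₀ s ≤ 1 →
        ‖y t - y s‖ ≤ R₁ * (clock b₀ t - clock b₀ s) ^ ν := by
    intro r y hr hy hyR hyh s t hs hst ht hcl
    have k1 := hy.norm_sub_le_clock h hr hθ hν hθν hG hg hyR hyh hs hst ht
    have k2 := h.sub_le_clock_sub hs hst ht
    have k3 : ∫ u in s..t, b₀ u ≤ clock b₀ t - clock b₀ s := by
      rw [h.clock_sub hs hst ht]; linarith
    have k4 : (t - s) ^ ν ≤ (clock b₀ t - clock b₀ s) ^ ν :=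
      Real.rpow_le_rpow (by linarith) k2 hν.le
    have k5 : clock b₀ t - clock b₀ s ≤ (clock b₀ t - clock b₀ s) ^ ν :=
      Real.self_le_rpow_of_le_one (by linarith) hcl hν1
    have k6 : m * (G * (M * (1 + R) * (1 + youngConst (θ + ν) * T ^ θ)) * (t - s) ^ ν) =
        K₁ * (t - s) ^ ν := by rw [hK₁]; ring
    rw [k6] at k1
    have k7 := mul_le_mul_of_nonneg_left k4 hK₁0
    have k8 := mul_le_mul_of_nonneg_left (k2.trans k5) (show 0 ≤ M * R by positivity)
    rw [hR₁]
    linarith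
  obtain ⟨n, hn⟩ := exists_nat_ge (T / Δ)
  rw [div_le_iff₀ hΔ0] at hn
  refine ⟨2 ^ n * (2 * M * (1 + R)), by positivity, fun r y hr hr1 hy hyR hyh h0 => ?_⟩
  obtain ⟨per₁, per₂⟩ := h.delay_perturbation hκ hκθ hr hr1 hR0 hyh
  set ε := 2 * M * (1 + R) * r ^ (θ - κ) with hε
  have hε0 : 0 ≤ ε := by positivity
  have hxR' : ∀ t ∈ Icc (-0) T, ‖x t‖ ≤ R := by simpa using hxR
  have hxh' : ∀ s t, -0 ≤ s → s ≤ t → t ≤ T → ‖x t - x s‖ ≤ R * (t - s) ^ θ := by simpa using hxh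
  -- `(2 ^ n - 1) ε` solves `d ↦ 2 d + ε` from `d = 0`, the paths agreeing at time `0`.
  have iter : ∀ n : ℕ, ∀ t ∈ Icc 0 (min (n * Δ) T), ‖x t - y t‖ ≤ (2 ^ n - 1) * ε := by
    intro n
    induction n with
    | zero =>
      intro t ht
      have : t = 0 := le_antisymm (by simpa using ht.2.trans (min_le_left _ _)) ht.1
      rw [this, h0]
      simp
    | succ n ih =>
      intro t ht
      have htT : t ≤ T := ht.2.trans (min_le_right _ _)
      have htn : t ≤ (n + 1) * Δ := by simpa using ht.2.trans (min_le_left _ _)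
      have h2n : (1 : ℝ) ≤ 2 ^ n := one_le_pow₀ (by norm_num)
      rcases le_total t (n * Δ) with hle | hle
      · refine (ih t ⟨ht.1, le_min hle htT⟩).trans (mul_le_mul_of_nonneg_right ?_ hε0)
        rw [pow_succ]; linarith
      · have hnΔ : (0 : ℝ) ≤ n * Δ := by positivity
        have hcl := clockΔ (n * Δ) t hnΔ hle htT (by linarith)
        have sub1 : ∀ u v, n * Δ ≤ u → u ≤ v → v ≤ t → clock b₀ v - clock b₀ u ≤ 1 := by
          intro u v hu huv hv
          exact (clockΔ u v (hnΔ.trans hu) huv (hv.trans htT) (by linarith)).trans hℓ1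
        have key := norm_sub_le_of_short_interval h hl hx.eq hy.eq hδ hκ hκθ hκδ
          (hκθ.trans hθν') hν ((hκθ.trans hθν').trans hν1) hsum hG hR₁0 hε0 hg hxR
          (fun t ht => hyR t ⟨by linarith [ht.1], ht.2⟩)
          (fun u v hu huv hv => incr 0 x le_rfl hx hxR' hxh' u v (hnΔ.trans hu) huv
            (hv.trans htT) (sub1 u v hu huv hv))
          (fun u v hu huv hv => incr r y hr.le hy hyR hyh u v (hnΔ.trans hu) huv
            (hv.trans htT) (sub1 u v hu huv hv))
          per₁ per₂ hnΔ hle htT hℓ1 hcl small₁ small₂ ⟨hle, le_rfl⟩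
        have k := ih (n * Δ) ⟨hnΔ, le_min le_rfl (hle.trans htT)⟩
        rw [pow_succ]
        linarith
  intro t ht
  refine (iter n t ⟨ht.1, le_min (ht.2.trans hn) ht.2⟩).trans ?_
  rw [mul_assoc, ← hε]
  linarith [sub_mul (2 ^ n : ℝ) 1 ε]

/-- Pathwise convergence of delayed solutions in the norm `‖·‖_{α,∞}`. -/
theorem exists_wNorm_sub_le (h : CoeffBounds T θ M b σ b₀) {κ R α : ℝ}
    (hl : LocalBounds T θ δ R M' b σ) (hT : 0 ≤ T) (hα : 0 ≤ α) (hα2 : α < 1 / 2)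
    (hδ : 0 ≤ δ) (hκ : 0 < κ) (hκθ : κ < θ) (hκδ : κ ≤ ν * δ) (hθν' : θ ≤ ν)
    (hν : 0 < ν) (hν1 : ν ≤ 1) (hsum : 1 < κ + ν) (hG : 0 ≤ G)
    (hg : ∀ j, ∀ u ∈ Icc 0 T, ∀ v ∈ Icc 0 T, u ≤ v → |g j v - g j u| ≤ G * (v - u) ^ ν)
    (hx : DelayPath T 0 θ M b σ g x) (hxR : ∀ t ∈ Icc 0 T, ‖x t‖ ≤ R)
    (hxh : ∀ s t, 0 ≤ s → s ≤ t → t ≤ T → ‖x t - x s‖ ≤ R * (t - s) ^ θ)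
    (hx2 : ∀ s t, 0 ≤ s → s ≤ t → t ≤ T → ‖x t - x s‖ ≤ R * (t - s) ^ (1 / 2 : ℝ))
    {ε : ℝ} (hε : 0 < ε) :
    ∃ r₁ : ℝ, 0 < r₁ ∧ ∀ (r : ℝ) (y : ℝ → E), 0 < r → r < r₁ → DelayPath T r θ M b σ g y →
      (∀ t ∈ Icc (-r) T, ‖y t‖ ≤ R) →
      (∀ s t, -r ≤ s → s ≤ t → t ≤ T → ‖y t - y s‖ ≤ R * (t - s) ^ θ) →
      (∀ s t, 0 ≤ s → s ≤ t → t ≤ T → ‖y t - y s‖ ≤ R * (t - s) ^ (1 / 2 : ℝ)) → y 0 = x 0 →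
      wNorm α 0 T (fun t => x t - y t) ≤ ENNReal.ofReal ε := by
  have hR0 : 0 ≤ R := (norm_nonneg _).trans (hxR 0 ⟨le_rfl, hT⟩)
  obtain ⟨C, hC0, hC⟩ := exists_norm_sub_le_rpow_delay h hl hT hδ hκ hκθ.le hκδ hθν' hν hν1 hsum hG
    hg hx hxR hxh
  -- an exponent strictly between `α` and `1 / 2`
  set μ := (α + 1 / 2) / 2 with hμ
  have hαμ : α < μ := by rw [hμ]; linarith
  have hμ2 : 2 * μ < 1 := by rw [hμ]; linarith
  have hμ0 : 0 < μ := by rw [hμ]; linarith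
  -- Interpolating the sup distance with the `1/2`-Hölder bound, with weight `2 μ` on the latter,
  -- makes the difference `μ`-Hölder with a constant vanishing with `r`; since `μ > α`, its norm is
  -- controlled.
  let bound : ℝ → ℝ := fun r => C * r ^ (θ - κ) +
    (2 * (C * r ^ (θ - κ))) ^ (1 - 2 * μ) * (2 * R) ^ (2 * μ) * (T ^ (μ - α) / (μ - α))
  have hlim : Tendsto bound (𝓝[>] 0) (𝓝 0) := by
    have c1 : ContinuousAt (fun r : ℝ => C * r ^ (θ - κ)) 0 :=
      continuousAt_const.mul (Real.continuousAt_rpow_const _ _ (Or.inr (by linarith)))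
    have c2 : ContinuousAt bound 0 := by
      refine c1.add (((ContinuousAt.rpow_const (continuousAt_const.mul c1)
        (Or.inr (by linarith))).mul continuousAt_const).mul continuousAt_const)
    have := c2.tendsto
    have e : bound 0 = 0 := by
      simp only [bound]
      rw [Real.zero_rpow (by linarith), mul_zero, mul_zero, Real.zero_rpow (by linarith)]
      ring
    rw [e] at this
    exact this.mono_left nhdsWithin_le_nhds
  have hev := (hlim.eventually (ge_mem_nhds hε)).and (Ioc_mem_nhdsGT (zero_lt_one : (0 : ℝ) < 1))
  obtain ⟨r₁, hr₁, hr₁'⟩ := (mem_nhdsGT_iff_exists_Ioo_subset).1 hev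
  refine ⟨r₁, hr₁, fun r y hr hrr hy hyR hyh hy2 h0 => ?_⟩
  obtain ⟨hb, -, hr1⟩ := hr₁' ⟨hr, hrr⟩
  have hsup := hC r y hr hr1 hy hyR hyh h0
  refine (wNorm_le_of_holder (κ := μ) (a := C * r ^ (θ - κ))
    (B := (2 * (C * r ^ (θ - κ))) ^ (1 - 2 * μ) * (2 * R) ^ (2 * μ)) hαμ (by positivity)
    hsup ?_).trans (ENNReal.ofReal_le_ofReal hb)
  intro s t hs hst ht
  have k1 : ‖(x t - y t) - (x s - y s)‖ ≤ 2 * (C * r ^ (θ - κ)) := by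
    refine (norm_sub_le _ _).trans ?_
    linarith [hsup t ⟨hs.trans hst, ht⟩, hsup s ⟨hs, hst.trans ht⟩]
  have k2 : ‖(x t - y t) - (x s - y s)‖ ≤ 2 * R * (t - s) ^ (1 / 2 : ℝ) := by
    have e : (x t - y t) - (x s - y s) = (x t - x s) - (y t - y s) := by abel
    rw [e]
    refine (norm_sub_le _ _).trans ?_
    linarith [hx2 s t hs hst ht, hy2 s t hs hst ht]
  refine (le_rpow_mul_rpow_of_le (norm_nonneg _) k1 k2 (c := 2 * μ) (by linarith) hμ2.le).trans
    (le_of_eq ?_)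
  rw [Real.mul_rpow (by positivity) (Real.rpow_nonneg (by linarith) _),
    ← Real.rpow_mul (by linarith : (0 : ℝ) ≤ t - s), show (1 / 2 : ℝ) * (2 * μ) = μ by ring]
  ring

end PathwiseConvergence

/-! ### From the hypotheses to the pathwise setting. -/

section Hypotheses

variable {d m : ℕ}

/-- Hypothesis (H1) concerns partial derivatives only; expanding a vector in the standard basis
costs the factor `d`. -/
theorem opNorm_le_of_single {F : Type*} [NormedAddCommGroup F] [NormedSpace ℝ F]
    (L : EuclideanSpace ℝ (Fin d) →L[ℝ] F) {K : ℝ} (hK : 0 ≤ K)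
    (h : ∀ i, ‖L (EuclideanSpace.single i 1)‖ ≤ K) : ‖L‖ ≤ d * K := by
  refine L.opNorm_le_bound (by positivity) fun x => ?_
  have e : x = ∑ i, x i • EuclideanSpace.single i (1 : ℝ) := by
    have := (EuclideanSpace.basisFun (Fin d) ℝ).sum_repr x
    simpa using this.symm
  conv_lhs => rw [e]
  rw [map_sum]
  refine (norm_sum_le_of_le (n := fun _ => ‖x‖ * K) _ fun i _ => ?_).trans (le_of_eq ?_)
  · rw [map_smul, norm_smul]
    exact mul_le_mul (PiLp.norm_apply_le x i) (h i) (norm_nonneg _) (norm_nonneg _)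
  · simp; ring

variable {T β δ ρ α : ℝ} {σ : ℝ → EuclideanSpace ℝ (Fin d) → Fin m → EuclideanSpace ℝ (Fin d)}
  {b : ℝ → EuclideanSpace ℝ (Fin d) → EuclideanSpace ℝ (Fin d)}

theorem HypH1.exists_bounds (h : HypH1 T β δ σ) :
    ∃ M : ℝ → ℝ, (∀ N ≥ 0, 0 < M N) ∧
      (∀ t ∈ Icc 0 T, ∀ x y, ‖σ t x - σ t y‖ ≤ M 0 * ‖x - y‖) ∧
      (∀ s ∈ Icc 0 T, ∀ t ∈ Icc 0 T, ∀ x, ‖σ t x - σ s x‖ ≤ M 0 * |t - s| ^ β) ∧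
      (∀ s ∈ Icc 0 T, ∀ t ∈ Icc 0 T, ∀ x,
        ‖fderiv ℝ (σ t) x - fderiv ℝ (σ s) x‖ ≤ d * M 0 * |t - s| ^ β) ∧
      ∀ N ≥ 0, ∀ t ∈ Icc 0 T, ∀ x y, ‖x‖ ≤ N → ‖y‖ ≤ N →
        ‖fderiv ℝ (σ t) x - fderiv ℝ (σ t) y‖ ≤ d * M N * ‖x - y‖ ^ δ := by
  obtain ⟨M, hM, h1, h2, h3⟩ := h.bounds
  have hM0 := hM 0 le_rfl
  refine ⟨M, hM, h1, fun s hs t ht x => ?_, fun s hs t ht x => ?_, fun N hN t ht x y hx hy => ?_⟩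
  -- The time regularity of `σ` is stated jointly with that of a partial derivative, so an index
  -- must exist to read it off; for `d = 0` the space is trivial.
  · rcases Nat.eq_zero_or_pos d with rfl | hd
    · have : σ t x - σ s x = 0 := Subsingleton.elim _ _
      rw [this, norm_zero]
      positivity
    · exact (le_add_of_nonneg_right (norm_nonneg _)).trans (h3 t ht s hs x ⟨0, hd⟩)
  · rw [mul_assoc]
    refine opNorm_le_of_single _ (by positivity) fun i => ?_
    exact (le_add_of_nonneg_left (norm_nonneg _)).trans (h3 t ht s hs x i)
  · rw [mul_assoc]
    have := hM N hN
    exact opNorm_le_of_single _ (by positivity) fun i => h2 N hN t ht x y hx hy i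

/-- A form of Cauchy-Schwarz: `f ≤ c f² + 1/c` with `c = (t - s) ^ (1/2)`, and `1/c` integrated over
length `c²` contributes `c`. -/
theorem integral_le_mul_rpow_half {f : ℝ → ℝ} (hf : MemLp f 2 (volume.restrict (Icc 0 T)))
    {s t : ℝ} (hs : 0 ≤ s) (hst : s ≤ t) (ht : t ≤ T) :
    ∫ u in s..t, f u ≤ ((∫ u in Icc 0 T, f u ^ 2) + 1) * (t - s) ^ (1 / 2 : ℝ) := by
  have hsq : IntegrableOn (fun u => f u ^ 2) (Icc 0 T) := hf.integrable_sq
  have hint : IntegrableOn f (Icc 0 T) := by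
    have := hf.integrable (by norm_num)
    exact this
  have hsub : Ioc s t ⊆ Icc 0 T := fun u hu => ⟨hs.trans hu.1.le, hu.2.trans ht⟩
  rcases hst.eq_or_lt with rfl | hlt
  · simp
  set c := (t - s) ^ (1 / 2 : ℝ) with hc
  have hd : 0 < t - s := by linarith
  have hc0 : 0 < c := by positivity
  have hcc : c * c = t - s := by
    rw [hc, ← Real.rpow_add hd]; norm_num
  have hS : ∫ u in Ioc s t, f u ^ 2 ≤ ∫ u in Icc 0 T, f u ^ 2 :=
    setIntegral_mono_set hsq (ae_of_all _ fun u => sq_nonneg _) hsub.eventuallyLE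
  rw [intervalIntegral.integral_of_le hst]
  have hmono : ∫ u in Ioc s t, f u ≤ ∫ u in Ioc s t, (c * f u ^ 2 + c⁻¹) := by
    refine setIntegral_mono (hint.mono_set hsub)
      (((hsq.mono_set hsub).const_mul c).add (integrableOn_const (by simp))) fun u => ?_
    have h1 : 0 ≤ (c * f u - 1 / 2) ^ 2 := sq_nonneg _
    have h2 : f u * c ≤ (c * f u ^ 2 + c⁻¹) * c := by
      rw [add_mul, inv_mul_cancel₀ hc0.ne']
      nlinarith
    exact le_of_mul_le_mul_right h2 hc0
  refine hmono.trans ?_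
  rw [integral_add ((hsq.mono_set hsub).const_mul c) (integrableOn_const (by simp)),
    integral_const_mul, setIntegral_const, Measure.real, Real.volume_Ioc,
    ENNReal.toReal_ofReal hd.le, smul_eq_mul, ← hcc]
  have : c * c * c⁻¹ = c := by field_simp
  rw [this]
  nlinarith

/-- All bounds persist when `M` grows, so `M` can later be enlarged to control the initial path as
well. The assumption `ρ ≥ 2` puts `b₀` in `L²`, and the factor `T ^ (β - θ)` lowers the time
exponent from `β` to `θ`. -/
theorem exists_coeffBounds {θ : ℝ} (hT : 0 ≤ T) (hσ : HypH1 T β δ σ) (hb : HypH2' T ρ b)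
    (hθ : 0 < θ) (hθβ : θ ≤ β) :
    ∃ (b₀ : ℝ → ℝ) (M₀ : ℝ), ∀ M ≥ M₀, CoeffBounds T θ M b σ b₀ := by
  obtain ⟨M, hM, h1, h2, -, -⟩ := hσ.exists_bounds
  obtain ⟨b₀, L, hb₀, hL, -, hgr⟩ := hb.bounds
  have hM0 := hM 0 le_rfl
  have hL0 := hL 0 le_rfl
  have hb2 : MemLp b₀ 2 (volume.restrict (Icc 0 T)) := by
    refine hb₀.mono_exponent ?_
    have := ENNReal.ofReal_le_ofReal hb.ρ_ge
    simpa using this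
  have hS : 0 ≤ ∫ u in Icc 0 T, b₀ u ^ 2 := integral_nonneg fun u => sq_nonneg _
  set S := ∫ u in Icc 0 T, b₀ u ^ 2 with hSdef
  have hTp : 0 ≤ T ^ (β - θ) := by positivity
  have hTβ : 0 ≤ T ^ β := by positivity
  have n1 : 0 ≤ M 0 * T ^ (β - θ) := by positivity
  have n2 : 0 ≤ M 0 * T ^ β := by positivity
  have n3 := norm_nonneg (σ 0 0)
  refine ⟨b₀, 1 + M 0 + M 0 * T ^ (β - θ) + ‖σ 0 0‖ + M 0 * T ^ β + (S + 1) + L 0,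
    fun K hK => ?_⟩
  have h0T : (0 : ℝ) ∈ Icc 0 T := ⟨le_rfl, hT⟩
  refine ⟨by linarith, fun t ht x y => ?_, fun s hs t ht x => ?_, fun t ht => ?_, ?_,
    fun t ht => ?_, fun s t hs hst ht => ?_, fun t ht x => ?_⟩
  · exact (h1 t ht x y).trans (mul_le_mul_of_nonneg_right (by linarith) (norm_nonneg _))
  · refine (h2 s hs t ht x).trans ?_
    have k := rpow_le_mul_rpow_of_le (abs_nonneg (t - s))
      (abs_sub_le_iff.2 ⟨by linarith [hs.1, ht.2], by linarith [ht.1, hs.2]⟩ : |t - s| ≤ T) hθ hθβ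
    calc M 0 * |t - s| ^ β ≤ M 0 * (T ^ (β - θ) * |t - s| ^ θ) := by gcongr
      _ = M 0 * T ^ (β - θ) * |t - s| ^ θ := by ring
      _ ≤ K * |t - s| ^ θ := by
          gcongr
          linarith
  · have k := h2 0 h0T t ht 0
    have e : σ t 0 = (σ t 0 - σ 0 0) + σ 0 0 := by abel
    have k2 : |t - 0| ^ β ≤ T ^ β := by
      rw [sub_zero, abs_of_nonneg ht.1]
      exact Real.rpow_le_rpow ht.1 ht.2 (by linarith)
    rw [e]
    refine (norm_add_le _ _).trans ?_
    linarith [mul_le_mul_of_nonneg_left k2 hM0.le]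
  · rw [intervalIntegrable_iff_integrableOn_Icc_of_le hT]
    exact hb2.integrable (by norm_num)
  · have := (norm_nonneg _).trans (hgr t ht 0)
    simpa using this
  · refine (integral_le_mul_rpow_half hb2 hs hst ht).trans ?_
    have : 0 ≤ (t - s) ^ (1 / 2 : ℝ) := Real.rpow_nonneg (by linarith) _
    exact mul_le_mul_of_nonneg_right (by linarith) this
  · refine (hgr t ht x).trans ?_
    have := mul_le_mul_of_nonneg_right (show L 0 ≤ K by linarith) (norm_nonneg x)
    linarith

theorem exists_localBounds {θ R : ℝ} (hT : 0 ≤ T) (hσ : HypH1 T β δ σ) (hb : HypH2' T ρ b)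
    (hθ : 0 < θ) (hθβ : θ ≤ β) (hR : 0 ≤ R) : ∃ M : ℝ, LocalBounds T θ δ R M b σ := by
  obtain ⟨M, hM, -, -, h3, h4⟩ := hσ.exists_bounds
  obtain ⟨b₀, L, -, hL, hlip, -⟩ := hb.bounds
  have hM0 := hM 0 le_rfl
  have hMR := hM R hR
  have hLR := hL R hR
  have n1 : 0 ≤ d * M 0 * T ^ (β - θ) := by positivity
  have n2 : 0 ≤ d * M R := by positivity
  refine ⟨d * M 0 * T ^ (β - θ) + d * M R + L R, by positivity, hσ.differentiable,
    fun s hs t ht x => ?_, fun t ht x y hx hy => ?_, fun t ht x y hx hy => ?_⟩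
  · refine (h3 s hs t ht x).trans ?_
    have k := rpow_le_mul_rpow_of_le (abs_nonneg (t - s))
      (abs_sub_le_iff.2 ⟨by linarith [hs.1, ht.2], by linarith [ht.1, hs.2]⟩ : |t - s| ≤ T) hθ hθβ
    calc d * M 0 * |t - s| ^ β ≤ d * M 0 * (T ^ (β - θ) * |t - s| ^ θ) := by gcongr
      _ = d * M 0 * T ^ (β - θ) * |t - s| ^ θ := by ring
      _ ≤ _ := by
          gcongr
          linarith
  · refine (h4 R hR t ht x y hx hy).trans ?_
    gcongr
    linarith
  · refine (hlip R hR t ht x y hx hy).trans ?_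
    gcongr
    linarith

theorem MemHolder.exists_bound {E : Type*} [NormedAddCommGroup E] {lam a c : ℝ} {f : ℝ → E}
    (hlam : 0 < lam) (hf : MemHolder lam a c f) : ∃ K : ℝ, 0 ≤ K ∧ (∀ t ∈ Icc a c, ‖f t‖ ≤ K) ∧
      ∀ s t, a ≤ s → s ≤ t → t ≤ c → ‖f t - f s‖ ≤ K * (t - s) ^ lam := by
  refine ⟨(holderNorm lam a c f).toReal, ENNReal.toReal_nonneg, fun t ht => ?_,
    fun s t hs hst ht => ?_⟩
  · have h1 : ‖f t‖ₑ ≤ holderNorm lam a c f :=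
      le_trans (le_iSup₂ (f := fun t (_ : t ∈ Icc a c) => ‖f t‖ₑ) t ht) le_self_add
    have := ENNReal.toReal_mono (ne_of_lt hf) h1
    simpa using this
  · rcases hst.eq_or_lt with rfl | hst
    · simp [Real.zero_rpow hlam.ne']
    have hp : 0 < (t - s) ^ lam := Real.rpow_pos_of_pos (by linarith) _
    have h1 : ‖f t - f s‖ₑ / ENNReal.ofReal ((t - s) ^ lam) ≤ holderNorm lam a c f := by
      refine le_trans ?_ le_add_self
      refine le_trans ?_ (le_iSup₂ (f := fun t (_ : t ∈ Icc a c) =>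
        ⨆ s ∈ Ico a t, ‖f t - f s‖ₑ / ENNReal.ofReal ((t - s) ^ lam)) t ⟨hs.trans hst.le, ht⟩)
      exact le_iSup₂ (f := fun s (_ : s ∈ Ico a t) =>
        ‖f t - f s‖ₑ / ENNReal.ofReal ((t - s) ^ lam)) s ⟨hs, hst⟩
    rw [← ofReal_norm, ← ENNReal.ofReal_div_of_pos hp] at h1
    have h2 := ENNReal.toReal_mono (ne_of_lt hf) h1
    rw [ENNReal.toReal_ofReal (by positivity), div_le_iff₀ hp] at h2
    exact h2

/-- A delayed solution in `W_0^{α,∞}` is a Hölder continuous solution. -/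
theorem IsDelaySolution.delayPath {r r₀ θ M K : ℝ} {η x : ℝ → EuclideanSpace ℝ (Fin d)}
    {g : Fin m → ℝ → ℝ} (hx : IsDelaySolution α T r b σ η g x) (hT : 0 < T) (hr : 0 < r)
    (hrr : r ≤ r₀) (hα : 0 < α) (hα2 : α ≤ 1 / 2) (hθ : 0 < θ) (hθα : θ ≤ α) (hK0 : 0 ≤ K)
    (hη : ∀ t ∈ Icc (-r₀) 0, ‖η t‖ ≤ K)
    (hηh : ∀ s t, -r₀ ≤ s → s ≤ t → t ≤ 0 → ‖η t - η s‖ ≤ K * (t - s) ^ (1 - α))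
    (hM : K * (1 + r₀ ^ (1 - α - θ)) ≤ M) : DelayPath T r θ M b σ g x := by
  have hr₀ : 0 ≤ r₀ := hr.le.trans hrr
  have hp0 : 0 ≤ r₀ ^ (1 - α - θ) := by positivity
  have hKp : 0 ≤ K * r₀ ^ (1 - α - θ) := by positivity
  have hx0 : x 0 = η 0 := hx.initial 0 ⟨by linarith, le_rfl⟩
  have init : ∀ s t, -r ≤ s → s ≤ t → t ≤ 0 → ‖x t - x s‖ ≤ M * (t - s) ^ θ := by
    intro s t hs hst ht
    rw [hx.initial t ⟨hs.trans hst, ht⟩, hx.initial s ⟨hs, hst.trans ht⟩]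
    refine (hηh s t (by linarith) hst ht).trans ?_
    have k := rpow_le_mul_rpow_of_le (a := 1 - α) (sub_nonneg.2 hst)
      (by linarith : t - s ≤ r₀) hθ (by linarith)
    have hp : 0 ≤ (t - s) ^ θ := Real.rpow_nonneg (by linarith) _
    calc K * (t - s) ^ (1 - α) ≤ K * (r₀ ^ (1 - α - θ) * (t - s) ^ θ) := by gcongr
      _ = K * r₀ ^ (1 - α - θ) * (t - s) ^ θ := by ring
      _ ≤ M * (t - s) ^ θ := mul_le_mul_of_nonneg_right (by linarith) hp
  have hM0 : 0 ≤ M := le_trans (by positivity) hM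
  refine ⟨IncrementEq.of_equation hT fun t ht => ?_, fun t ht => ?_, init, ?_⟩
  · obtain ⟨h1, I, h2, h3⟩ := hx.equation t ht
    exact ⟨h1, I, h2, by rw [h3, hx0]⟩
  · rw [hx.initial t ht]
    refine (hη t ⟨by linarith [ht.1], ht.2⟩).trans ?_
    linarith
  -- The path lives on `[-r, T]`, so `[0, T]` keeps distance `r` from the left end. The constant
  -- depends on `r`, but only its finiteness is used.
  · obtain ⟨C, hC0, hC⟩ := hx.memW.exists_holder_of_left hα hr
    have pos : ∀ s t, 0 ≤ s → s ≤ t → t ≤ T → ‖x t - x s‖ ≤ C * T ^ (α - θ) * (t - s) ^ θ := by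
      intro s t hs hst ht
      refine (hC s t (by linarith) hst ht).trans ?_
      rw [mul_assoc]
      exact mul_le_mul_of_nonneg_left (rpow_le_mul_rpow_of_le (by linarith) (by linarith) hθ hθα) hC0
    have hCT : 0 ≤ C * T ^ (α - θ) := by positivity
    refine ⟨C * T ^ (α - θ) + M, by positivity, fun s t hs hst ht => ?_⟩
    have hp : 0 ≤ (t - s) ^ θ := Real.rpow_nonneg (by linarith) _
    rcases le_total 0 s with h0s | hs0
    · refine (pos s t h0s hst ht).trans (mul_le_mul_of_nonneg_right ?_ hp)
      linarith
    rcases le_total t 0 with ht0 | h0t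
    · refine (init s t hs hst ht0).trans (mul_le_mul_of_nonneg_right ?_ hp)
      linarith
    · have e : x t - x s = (x t - x 0) + (x 0 - x s) := by abel
      rw [e, add_mul]
      refine (norm_add_le _ _).trans (add_le_add ?_ ?_)
      · refine (pos 0 t le_rfl h0t ht).trans (mul_le_mul_of_nonneg_left ?_ hCT)
        exact Real.rpow_le_rpow (by linarith) (by linarith) hθ.le
      · refine (init s 0 hs hs0 le_rfl).trans (mul_le_mul_of_nonneg_left ?_ hM0)
        exact Real.rpow_le_rpow (by linarith) (by linarith) hθ.le

theorem IsSolution.apply_zero {x₀ : EuclideanSpace ℝ (Fin d)} {x : ℝ → EuclideanSpace ℝ (Fin d)}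
    {g : Fin m → ℝ → ℝ} (hx : IsSolution α T b σ x₀ g x) (hT : 0 ≤ T) : x 0 = x₀ := by
  obtain ⟨-, I, h2, h3⟩ := hx.equation 0 ⟨le_rfl, hT⟩
  have : ∀ j, I j = 0 := fun j => (h2 j).eq_zero_of_eq
  simpa [this] using h3

/-- A solution in `W_0^{α,∞}` of the equation without delay is a Hölder continuous solution. -/
theorem IsSolution.delayPath {θ ν G M : ℝ} {x₀ : EuclideanSpace ℝ (Fin d)} {b₀ : ℝ → ℝ}
    {x : ℝ → EuclideanSpace ℝ (Fin d)}
    {g : Fin m → ℝ → ℝ} (hx : IsSolution α T b σ x₀ g x) (hT : 0 < T)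
    (h : CoeffBounds T θ M b σ b₀)
    (hα : 0 < α) (hα2 : α ≤ 1 / 2) (hθ : 0 < θ) (hθα : θ ≤ α)
    (hθν : 1 < θ + ν) (hG : 0 ≤ G)
    (hg : ∀ j, ∀ u ∈ Icc 0 T, ∀ v ∈ Icc 0 T, u ≤ v → |g j v - g j u| ≤ G * (v - u) ^ ν)
    (hM : ‖x₀‖ ≤ M) : DelayPath T 0 θ M b σ g x := by
  have hx0 := hx.apply_zero hT.le
  have hM1 := h.one_le
  have heq : IncrementEq T 0 b σ g x := IncrementEq.of_equation hT fun t ht => by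
    obtain ⟨h1, I, h2, h3⟩ := hx.equation t ⟨ht.1.le, ht.2⟩
    exact ⟨h1, I, by simpa using h2, by rw [h3, hx0]⟩
  have hz : ∀ t : ℝ, -0 ≤ t → t ≤ 0 → t = 0 := fun t h1 h2 => le_antisymm h2 (by simpa using h1)
  refine ⟨heq, fun t ht => ?_, fun s t hs hst ht => ?_, ?_⟩
  · rw [hz t ht.1 ht.2, hx0]
    exact hM
  · rw [hz t (hs.trans hst) ht, hz s hs (hst.trans ht)]
    simp [Real.zero_rpow hθ.ne']
  · obtain ⟨K, hK0, hK⟩ := hx.memW.exists_holder hα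
    obtain ⟨A, hA0, hA, -⟩ := hx.memW.exists_bound
    have hY := youngConst_nonneg hθν
    have pos : ∀ s t, 0 < s → s ≤ t → t ≤ T → ‖x t - x s‖ ≤ K * T ^ (α - θ) * (t - s) ^ θ := by
      intro s t hs hst ht
      refine (hK s t hs hst ht).trans ?_
      rw [mul_assoc]
      exact mul_le_mul_of_nonneg_left (rpow_le_mul_rpow_of_le (by linarith) (by linarith) hθ hθα) hK0
    set B := K * T ^ (α - θ) with hB
    have hB0 : 0 ≤ B := by positivity
    set S := G * (M * (1 + A) + youngConst (θ + ν) * (M * (1 + B)) * T ^ θ) with hS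
    have hS0 : 0 ≤ S := by positivity
    set C := M * A * T ^ (1 - θ) + M * T ^ (1 / 2 - θ) + m * (S * T ^ (ν - θ)) with hC
    have hC0 : 0 ≤ C := by positivity
    refine ⟨B + C, by positivity, fun s t hs hst ht => ?_⟩
    rw [neg_zero] at hs
    have hp : 0 ≤ (t - s) ^ θ := Real.rpow_nonneg (by linarith) _
    rcases hst.eq_or_lt with rfl | hlt
    · simp [Real.zero_rpow hθ.ne']
    -- Without delay, membership in `W_0^{α,∞}` gives regularity on `(0, T]` only. Increments from
    -- `0` are recovered from the equation, Young's estimate requiring no control of the integrand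
    -- at the left end.
    rcases hs.eq_or_lt with rfl | hs
    · have h1 := heq.norm_sub_le h hθ (by linarith) hθν hG hB0 hg le_rfl hlt ht
        (fun u hu => hA u ⟨hu.1, hu.2.trans ht⟩) (by rw [sub_zero]; exact hA t ⟨hst, ht⟩)
        (fun u hu v hv huv => by
          rw [sub_zero, sub_zero]; exact pos u v hu.1 huv (hv.2.trans ht))
      have h2 := h.half 0 t le_rfl hst ht
      have d0 : 0 ≤ t - 0 := by linarith
      have dT : t - 0 ≤ T := by linarith
      have p1 := rpow_le_mul_rpow_of_le (a := 1) d0 dT hθ (by linarith)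
      have p2 := rpow_le_mul_rpow_of_le (a := 1 / 2) d0 dT hθ (by linarith)
      have p3 := rpow_le_mul_rpow_of_le (a := ν) d0 dT hθ (by linarith)
      have p4 : (t - 0) ^ θ ≤ T ^ θ := Real.rpow_le_rpow d0 dT hθ.le
      rw [Real.rpow_one] at p1
      have q1 := mul_le_mul_of_nonneg_left p1 (show 0 ≤ M * A by positivity)
      have q2 := mul_le_mul_of_nonneg_left p2 (show 0 ≤ M by linarith)
      have q3 : m * (G * (M * (1 + A) + youngConst (θ + ν) * (M * (1 + B)) * (t - 0) ^ θ) *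
          (t - 0) ^ ν) ≤ m * (S * (T ^ (ν - θ) * (t - 0) ^ θ)) := by
        rw [hS]
        gcongr
      have q4 : 0 ≤ B * (t - 0) ^ θ := by positivity
      rw [hC]
      linarith
    · refine (pos s t hs hst ht).trans (mul_le_mul_of_nonneg_right ?_ hp)
      linarith

end Hypotheses

/-! ### Dyadic chaining. -/

section DyadicChaining

/-- A continuous function whose dyadic increments decay geometrically is Hölder continuous. -/
theorem holder_of_dyadic {T ν : ℝ} (hT : 0 < T) (hν : 0 < ν) :
    ∃ C : ℝ, 0 < C ∧ ∀ (f : ℝ → ℝ) (K : ℝ), ContinuousOn f (Icc 0 T) → 0 ≤ K →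
      (∀ n k : ℕ, k < 2 ^ n →
        |f ((k + 1 : ℕ) * (T / 2 ^ n)) - f (k * (T / 2 ^ n))| ≤ K * ((2 : ℝ) ^ (-ν)) ^ n) →
      ∀ u ∈ Icc 0 T, ∀ v ∈ Icc 0 T, u ≤ v → |f v - f u| ≤ C * K * (v - u) ^ ν := by
  set q : ℝ := (2 : ℝ) ^ (-ν) with hq
  have hq0 : 0 < q := by positivity
  have hq1 : q < 1 := Real.rpow_lt_one_of_one_lt_of_neg (by norm_num) (by linarith)
  have h1q : 0 < 1 - q := by linarith
  refine ⟨(2 / T) ^ ν * (1 + 2 * (q / (1 - q))), by positivity, ?_⟩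
  intro f K hf hK hdy
  -- `p n t` is the last dyadic point of level `n` not after `t`. From one level to the next it
  -- stays or moves by one interval of the finer level, so the distance from `f (p n t)` to `f t` is
  -- a geometric tail.
  let k : ℕ → ℝ → ℕ := fun n t => ⌊t * 2 ^ n / T⌋₊
  let p : ℕ → ℝ → ℝ := fun n t => k n t * (T / 2 ^ n)
  have hk_le : ∀ n, ∀ t ∈ Icc 0 T, (k n t : ℝ) ≤ t * 2 ^ n / T := fun n t ht =>
    Nat.floor_le (div_nonneg (mul_nonneg ht.1 (by positivity)) hT.le)
  have hk_lt : ∀ n t, t * 2 ^ n / T < k n t + 1 := fun n t => Nat.lt_floor_add_one _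
  have hp_le : ∀ n, ∀ t ∈ Icc 0 T, p n t ≤ t := by
    intro n t ht
    have h1 := hk_le n t ht
    have h2 : (0 : ℝ) < 2 ^ n := by positivity
    calc p n t ≤ t * 2 ^ n / T * (T / 2 ^ n) := by simp only [p]; gcongr
      _ = t := by field_simp
  have hp_lt : ∀ n t, t - p n t ≤ T / 2 ^ n := by
    intro n t
    have h1 := (hk_lt n t).le
    have h2 : (0 : ℝ) < 2 ^ n := by positivity
    have h3 : t * 2 ^ n / T * (T / 2 ^ n) ≤ (k n t + 1) * (T / 2 ^ n) := by gcongr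
    have h4 : t * 2 ^ n / T * (T / 2 ^ n) = t := by field_simp
    rw [h4, add_mul, one_mul] at h3
    simp only [p]; linarith
  have hp_mem : ∀ n, ∀ t ∈ Icc 0 T, p n t ∈ Icc 0 T := fun n t ht =>
    ⟨by simp only [p]; positivity, (hp_le n t ht).trans ht.2⟩
  have hk_top : ∀ n, ∀ t ∈ Icc 0 T, k n t ≤ 2 ^ n := by
    intro n t ht
    have h1 : (k n t : ℝ) ≤ 2 ^ n := (hk_le n t ht).trans (by
      rw [div_le_iff₀ hT, mul_comm]
      exact mul_le_mul_of_nonneg_left ht.2 (by positivity))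
    exact_mod_cast h1
  have hk_succ : ∀ n, ∀ t ∈ Icc 0 T, k (n + 1) t = 2 * k n t ∨ k (n + 1) t = 2 * k n t + 1 := by
    intro n t ht
    have e : t * 2 ^ (n + 1) / T = 2 * (t * 2 ^ n / T) := by rw [pow_succ]; ring
    have a1 := hk_le n t ht
    have a2 := hk_lt n t
    have a3 := hk_le (n + 1) t ht
    have a4 := hk_lt (n + 1) t
    rw [e] at a3 a4
    have b1 : (k (n + 1) t : ℝ) < 2 * k n t + 2 := by linarith
    have b2 : (2 * k n t : ℝ) < k (n + 1) t + 1 := by linarith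
    have c1 : k (n + 1) t < 2 * k n t + 2 := by exact_mod_cast b1
    have c2 : 2 * k n t < k (n + 1) t + 1 := by exact_mod_cast b2
    omega
  have hstep : ∀ n, ∀ t ∈ Icc 0 T, |f (p (n + 1) t) - f (p n t)| ≤ K * q ^ (n + 1) := by
    intro n t ht
    have e : p n t = ((2 * k n t : ℕ) : ℝ) * (T / 2 ^ (n + 1)) := by
      simp only [p]; push_cast; rw [pow_succ]; field_simp
    rcases hk_succ n t ht with h | h
    · have : p (n + 1) t = p n t := by rw [e, ← h]
      rw [this, sub_self, abs_zero]; positivity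
    · have hlt : 2 * k n t < 2 ^ (n + 1) := by
        have := hk_top (n + 1) t ht
        omega
      have := hdy (n + 1) (2 * k n t) hlt
      rw [← h, ← e] at this
      exact this
  have htail : ∀ t ∈ Icc 0 T, ∀ n, |f t - f (p n t)| ≤ K * q ^ n * (q / (1 - q)) := by
    intro t ht n
    have hind : ∀ j, |f (p (n + j) t) - f (p n t)| ≤ K * q ^ n * (q / (1 - q)) * (1 - q ^ j) := by
      intro j
      induction j with
      | zero => simp
      | succ j ih =>
        have h1 := hstep (n + j) t ht
        have h2 := abs_sub_le (f (p (n + (j + 1)) t)) (f (p (n + j) t)) (f (p n t))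
        rw [← add_assoc] at h2 ⊢
        refine h2.trans ((add_le_add h1 ih).trans (le_of_eq ?_))
        have hD : q = q / (1 - q) * (1 - q) := by field_simp
        have e : K * q ^ (n + j + 1) = K * q ^ n * q ^ j * (q / (1 - q) * (1 - q)) := by
          rw [← hD]; ring
        rw [e]; ring
    have hlim : Tendsto (fun j => p (n + j) t) atTop (𝓝 t) := by
      have h1 : Tendsto (fun j : ℕ => t - T / 2 ^ (n + j)) atTop (𝓝 (t - 0)) := by
        refine tendsto_const_nhds.sub (tendsto_const_nhds.div_atTop ?_)
        exact (tendsto_pow_atTop_atTop_of_one_lt (by norm_num : (1 : ℝ) < 2)).comp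
          (tendsto_atTop_mono (fun j => Nat.le_add_left j n) tendsto_id)
      rw [sub_zero] at h1
      exact tendsto_of_tendsto_of_tendsto_of_le_of_le h1 tendsto_const_nhds
        (fun j => by have := hp_lt (n + j) t; simp only; linarith) (fun j => hp_le _ t ht)
    have hlim2 : Tendsto (fun j => p (n + j) t) atTop (𝓝[Icc 0 T] t) :=
      tendsto_nhdsWithin_iff.2 ⟨hlim, Eventually.of_forall fun j => hp_mem _ t ht⟩
    have hlim3 := ((hf t ht).tendsto.comp hlim2).sub_const (f (p n t))
    refine le_of_tendsto' hlim3.abs fun j => ?_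
    refine (hind j).trans (mul_le_of_le_one_right (by positivity) ?_)
    have : 0 ≤ q ^ j := by positivity
    linarith
  intro s hs t ht hst
  rcases hst.eq_or_lt with rfl | hlt
  · simp [Real.zero_rpow hν.ne']
  have hd : 0 < t - s := by linarith
  -- The level is chosen with `T / 2 ^ (n + 1) < t - s ≤ T / 2 ^ n`: the approximations of `s` and
  -- `t` coincide or are neighbours, and `q ^ n` is comparable to `(t - s) ^ ν`.
  obtain ⟨n, hn1, hn2⟩ := exists_nat_pow_near (x := T / (t - s)) (y := 2)
    ((one_le_div hd).2 (by linarith [hs.1, ht.2])) (by norm_num)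
  have hkk : k n t ≤ k n s + 1 := by
    have a1 := hk_le n t ht
    have a2 := hk_lt n s
    have a3 : t * 2 ^ n / T ≤ s * 2 ^ n / T + 1 := by
      rw [le_div_iff₀ hd] at hn1
      rw [div_add_one hT.ne', div_le_div_iff_of_pos_right hT]
      linarith
    have : (k n t : ℝ) < k n s + 2 := by linarith
    have : k n t < k n s + 2 := by exact_mod_cast this
    omega
  have hkmono : k n s ≤ k n t := Nat.floor_mono (by gcongr)
  have hmid : |f (p n t) - f (p n s)| ≤ K * q ^ n := by
    rcases hkmono.eq_or_lt with h | h
    · have : p n t = p n s := by simp only [p]; rw [h]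
      rw [this, sub_self, abs_zero]; positivity
    · have h1 : k n t = k n s + 1 := by omega
      have := hdy n (k n s) (by have := hk_top n t ht; omega)
      simp only [p]
      rw [h1]
      exact this
  have htot : |f t - f s| ≤ K * q ^ n * (1 + 2 * (q / (1 - q))) := by
    have a1 := htail t ht n
    have a2 := htail s hs n
    have e : f t - f s = (f t - f (p n t)) + (f (p n t) - f (p n s)) - (f s - f (p n s)) := by ring
    rw [e]
    refine (abs_sub _ _).trans ((add_le_add (abs_add_le _ _) le_rfl).trans ?_)
    linarith
  have hqn : q ^ n ≤ (2 / T) ^ ν * (t - s) ^ ν := by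
    have e : q ^ n = ((2 : ℝ) ^ n)⁻¹ ^ ν := by
      rw [hq, ← Real.rpow_natCast, ← Real.rpow_mul (by norm_num), Real.inv_rpow (by positivity),
        ← Real.rpow_natCast 2 n, ← Real.rpow_mul (by norm_num), ← Real.rpow_neg (by norm_num)]
      congr 1; ring
    rw [e, ← Real.mul_rpow (by positivity) hd.le]
    refine Real.rpow_le_rpow (by positivity) ?_ hν.le
    rw [div_lt_iff₀ hd, pow_succ] at hn2
    rw [inv_le_iff_one_le_mul₀ (by positivity), div_mul_eq_mul_div, div_mul_eq_mul_div,
      one_le_div hT]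
    linarith
  calc |f t - f s| ≤ K * q ^ n * (1 + 2 * (q / (1 - q))) := htot
    _ ≤ K * ((2 / T) ^ ν * (t - s) ^ ν) * (1 + 2 * (q / (1 - q))) := by gcongr
    _ = _ := by ring

end DyadicChaining

/-! ### Gaussian tails of the Hölder constant. -/

section FractionalBrownianMotion

/-- The weight `u^(2l) exp (ε u²)` used for Gaussian moments. -/
noncomputable def gaussWeight (ε : ℝ) (l : ℕ) (u : ℝ) : ℝ := u ^ (2 * l) * Real.exp (ε * u ^ 2)

theorem gaussWeight_nonneg (ε : ℝ) (l : ℕ) (u : ℝ) : 0 ≤ gaussWeight ε l u := by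
  unfold gaussWeight
  rw [pow_mul]
  positivity

theorem measurable_gaussWeight (ε : ℝ) (l : ℕ) : Measurable (gaussWeight ε l) := by
  unfold gaussWeight
  fun_prop

theorem exp_le_add_gaussWeight {ε : ℝ} (hε : 0 ≤ ε) (l : ℕ) (u : ℝ) :
    Real.exp (ε * u ^ 2) ≤ Real.exp ε + gaussWeight ε l u := by
  have h0 := gaussWeight_nonneg ε l u
  rcases le_total (u ^ 2) 1 with h | h
  · have : Real.exp (ε * u ^ 2) ≤ Real.exp ε := Real.exp_le_exp.2 (mul_le_of_le_one_right hε h)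
    linarith
  · have : Real.exp (ε * u ^ 2) ≤ gaussWeight ε l u := by
      rw [gaussWeight, pow_mul]
      exact le_mul_of_one_le_left (Real.exp_pos _).le (one_le_pow₀ h)
    linarith [Real.exp_pos ε]

/-- Fernique's theorem supplies an exponent `C`; half of it absorbs the polynomial `u ^ (2 l)`, so
one `ε` serves every `l`. -/
theorem exists_lintegral_gaussWeight_lt_top :
    ∃ ε : ℝ, 0 < ε ∧ ∀ l, ∫⁻ u, ENNReal.ofReal (gaussWeight ε l u) ∂(gaussianReal 0 1) < ∞ := by
  obtain ⟨C, hC, hint⟩ := IsGaussian.exists_integrable_exp_sq (gaussianReal 0 1)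
  set ε := C / 2 with hε
  have hε0 : 0 < ε := by positivity
  refine ⟨ε, hε0, fun l => ?_⟩
  have hle : ∀ u : ℝ, gaussWeight ε l u ≤ (l.factorial / ε ^ l) * Real.exp (C * ‖u‖ ^ 2) := by
    intro u
    have h1 := Real.pow_div_factorial_le_exp (ε * u ^ 2) (by positivity) l
    have h2 : u ^ (2 * l) ≤ (l.factorial / ε ^ l) * Real.exp (ε * u ^ 2) := by
      rw [div_le_iff₀ (by positivity), mul_pow, ← pow_mul] at h1
      rw [div_mul_eq_mul_div, le_div_iff₀ (by positivity)]
      linarith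
    calc gaussWeight ε l u ≤ (l.factorial / ε ^ l) * Real.exp (ε * u ^ 2) *
          Real.exp (ε * u ^ 2) := mul_le_mul_of_nonneg_right h2 (Real.exp_pos _).le
      _ = _ := by
          rw [mul_assoc, ← Real.exp_add, Real.norm_eq_abs, sq_abs]
          congr 2
          rw [hε]; ring
  have hint' := hint.const_mul (l.factorial / ε ^ l : ℝ)
  refine lt_of_le_of_lt (lintegral_mono fun u => ENNReal.ofReal_le_ofReal (hle u)) ?_
  exact hint'.lintegral_lt_top

variable {Ω : Type*} [MeasurableSpace Ω] {P : Measure Ω}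

/-- `X` has the law of `s` times a standard Gaussian. The polynomial factor scales out as `s ^ (2
l)`, the gain needed to sum over many increments, and `s ≤ 1` only decreases the exponential. -/
theorem lintegral_gaussWeight_le {X : Ω → ℝ} {s ε : ℝ} (hX : HasGaussianLaw X P)
    (hmean : ∫ ω, X ω ∂P = 0) (hvar : ∫ ω, X ω ^ 2 ∂P = s ^ 2) (hs : 0 ≤ s) (hs1 : s ≤ 1)
    (hε : 0 ≤ ε) (l : ℕ) :
    ∫⁻ ω, ENNReal.ofReal (gaussWeight ε l (X ω)) ∂P ≤
      ENNReal.ofReal (s ^ (2 * l)) *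
        ∫⁻ u, ENNReal.ofReal (gaussWeight ε l u) ∂(gaussianReal 0 1) := by
  have hmeas : Measurable fun u => ENNReal.ofReal (gaussWeight ε l u) :=
    (measurable_gaussWeight ε l).ennreal_ofReal
  have hlaw : P.map X = (gaussianReal 0 1).map (s * ·) := by
    rw [hX.map_eq_gaussianReal, gaussianReal_map_const_mul, hmean, mul_zero, mul_one,
      variance_of_integral_eq_zero hX.aemeasurable hmean, hvar]
    congr 1
    exact Real.toNNReal_of_nonneg (sq_nonneg s)
  rw [← lintegral_map' hmeas.aemeasurable hX.aemeasurable, hlaw,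
    lintegral_map hmeas (measurable_const_mul s), ← lintegral_const_mul _ hmeas]
  refine lintegral_mono fun u => ?_
  rw [← ENNReal.ofReal_mul (by positivity)]
  refine ENNReal.ofReal_le_ofReal ?_
  rw [gaussWeight, gaussWeight, mul_pow, mul_assoc]
  have h1 : s ^ 2 ≤ 1 := pow_le_one₀ hs hs1
  have h2 : ε * (s * u) ^ 2 ≤ ε * u ^ 2 := by
    rw [mul_pow]
    exact mul_le_mul_of_nonneg_left (mul_le_of_le_one_left (sq_nonneg u) h1) hε
  have h3 : 0 ≤ u ^ (2 * l) := by rw [pow_mul]; positivity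
  gcongr

theorem IsFractionalBrownianMotion.integral_sub_sq {H T : ℝ} {W : ℝ → Ω → ℝ}
    (hW : IsFractionalBrownianMotion P H T W) {s t : ℝ} (hs : s ∈ Icc 0 T) (ht : t ∈ Icc 0 T)
    (hH : 0 < H) :
    ∫ ω, (W t ω - W s ω) ^ 2 ∂P = |t - s| ^ (2 * H) := by
  have ms : MemLp (W s) 2 P := (hW.gaussian.hasGaussianLaw_eval ⟨s, hs⟩).memLp_two
  have mt : MemLp (W t) 2 P := (hW.gaussian.hasGaussianLaw_eval ⟨t, ht⟩).memLp_two
  have e : (fun ω => (W t ω - W s ω) ^ 2) =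
      fun ω => (W t ω * W t ω - 2 * (W s ω * W t ω)) + W s ω * W s ω := by
    funext ω; ring
  have i1 : Integrable (fun ω => W t ω * W t ω) P := mt.integrable_mul mt
  have i2 : Integrable (fun ω => W s ω * W t ω) P := ms.integrable_mul mt
  have i3 : Integrable (fun ω => W s ω * W s ω) P := ms.integrable_mul ms
  have i4 : Integrable (fun ω => W t ω * W t ω - 2 * (W s ω * W t ω)) P := i1.sub (i2.const_mul 2)
  rw [e, integral_add i4 i3, integral_sub i1 (i2.const_mul 2),
    integral_const_mul, hW.covariance t ht t ht, hW.covariance s hs t ht, hW.covariance s hs s hs]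
  simp only [sub_self, abs_zero]
  rw [Real.zero_rpow (by linarith)]
  ring

/-- The Hölder constants of fractional Brownian paths have Gaussian tails: a Hölder constant `G`
can be chosen with `exp (ε G²)` bounded by an integrable random variable. -/
theorem exists_holder_const_fractionalBrownianMotion {H T ν : ℝ} (hT : 0 < T) (hH : 0 < H)
    (hν : 0 < ν) (hνH : ν < H) :
    ∃ ε : ℝ, 0 < ε ∧ ∀ W : ℝ → Ω → ℝ, IsFractionalBrownianMotion P H T W →
      ∃ S : Ω → ℝ≥0∞, AEMeasurable S P ∧ ∫⁻ ω, S ω ∂P < ∞ ∧ ∀ᵐ ω ∂P, ∃ G : ℝ, 0 ≤ G ∧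
        (∀ u ∈ Icc 0 T, ∀ v ∈ Icc 0 T, u ≤ v → |W v ω - W u ω| ≤ G * (v - u) ^ ν) ∧
        ENNReal.ofReal (Real.exp (ε * G ^ 2)) ≤ S ω := by
  obtain ⟨ε₀, hε₀, hfin⟩ := exists_lintegral_gaussWeight_lt_top
  obtain ⟨C, hC, hchain⟩ := holder_of_dyadic hT hν
  set q : ℝ := (2 : ℝ) ^ (-ν) with hq
  have hq0 : 0 < q := by positivity
  -- standard deviation of the normalized dyadic increments of level `n` is `p ^ n`
  set p : ℝ := (2 : ℝ) ^ (-(H - ν)) with hp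
  have hp0 : 0 < p := by positivity
  have hp1 : p < 1 := Real.rpow_lt_one_of_one_lt_of_neg (by norm_num) (by linarith)
  -- Level `n` has `2 ^ n` increments, each of expected weight at most `p ^ (2 l n)` times a
  -- constant; `p ^ (2 l) ≤ 1/4` leaves a summable `2 ^ (-n)`.
  obtain ⟨l, hl⟩ := exists_pow_lt_of_lt_one (show (0 : ℝ) < 1 / 4 by norm_num) hp1
  have hl2 : p ^ (2 * l) ≤ 1 / 4 :=
    (pow_le_pow_of_le_one hp0.le hp1.le (by omega : l ≤ 2 * l)).trans hl.le
  set D : ℝ := C * T ^ H with hD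
  have hD0 : 0 < D := by positivity
  refine ⟨ε₀ / D ^ 2, by positivity, fun W hW => ?_⟩
  have hPprob : IsProbabilityMeasure P := hW.gaussian.isProbabilityMeasure
  have hmem : ∀ n k : ℕ, k ≤ 2 ^ n → (k : ℝ) * (T / 2 ^ n) ∈ Icc 0 T := by
    intro n k hk
    have hk' : (k : ℝ) ≤ 2 ^ n := by exact_mod_cast hk
    refine ⟨by positivity, ?_⟩
    calc (k : ℝ) * (T / 2 ^ n) ≤ 2 ^ n * (T / 2 ^ n) := by gcongr
      _ = T := by field_simp
  let c : ℕ → ℝ := fun n => (T ^ H * q ^ n)⁻¹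
  let ξ : ℕ → ℕ → Ω → ℝ := fun n k ω =>
    c n • (W ((k + 1 : ℕ) * (T / 2 ^ n)) ω - W (k * (T / 2 ^ n)) ω)
  have hlaw : ∀ n k : ℕ, k < 2 ^ n → HasGaussianLaw (ξ n k) P := fun n k hk =>
    (hW.gaussian.hasGaussianLaw_fun_sub (s := ⟨_, hmem n (k + 1) hk⟩)
      (t := ⟨_, hmem n k hk.le⟩)).fun_smul (c n)
  have hmean : ∀ n k : ℕ, k < 2 ^ n → ∫ ω, ξ n k ω ∂P = 0 := by
    intro n k hk
    have i1 : Integrable (W ((k + 1 : ℕ) * (T / 2 ^ n))) P :=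
      (hW.gaussian.hasGaussianLaw_eval ⟨_, hmem n (k + 1) hk⟩).integrable
    have i2 : Integrable (W (k * (T / 2 ^ n))) P :=
      (hW.gaussian.hasGaussianLaw_eval ⟨_, hmem n k hk.le⟩).integrable
    simp only [ξ]
    rw [integral_smul, integral_sub i1 i2, hW.mean_zero _ (hmem n (k + 1) hk),
      hW.mean_zero _ (hmem n k hk.le), sub_zero, smul_zero]
  have hpq : ∀ n : ℕ, (T / 2 ^ n) ^ H = T ^ H * q ^ n * p ^ n := by
    intro n
    rw [mul_assoc, ← mul_pow, hq, hp, ← Real.rpow_add (by norm_num), Real.div_rpow hT.le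
      (by positivity), div_eq_mul_inv, ← Real.rpow_natCast 2 n, ← Real.rpow_mul (by norm_num),
      ← Real.rpow_neg (by norm_num), ← Real.rpow_natCast _ n, ← Real.rpow_mul (by norm_num)]
    congr 2; ring
  have hvar : ∀ n k : ℕ, k < 2 ^ n → ∫ ω, ξ n k ω ^ 2 ∂P = (p ^ n) ^ 2 := by
    intro n k hk
    have h1 := hW.integral_sub_sq (hmem n k hk.le) (hmem n (k + 1) hk) hH
    have e : ((k + 1 : ℕ) : ℝ) * (T / 2 ^ n) - k * (T / 2 ^ n) = T / 2 ^ n := by push_cast; ring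
    rw [e, abs_of_nonneg (by positivity), mul_comm 2 H, Real.rpow_mul (by positivity), hpq,
      Real.rpow_two] at h1
    simp only [ξ, smul_eq_mul, mul_pow]
    rw [integral_const_mul, h1]
    simp only [c]
    field_simp
  set Γ := ∫⁻ u, ENNReal.ofReal (gaussWeight ε₀ l u) ∂(gaussianReal 0 1) with hΓ
  -- The sum of all weights dominates each of them, replacing a supremum over the increments while
  -- keeping a finite mean.
  let Z : Ω → ℝ≥0∞ := fun ω =>
    ∑' n : ℕ, ∑ k ∈ Finset.range (2 ^ n), ENNReal.ofReal (gaussWeight ε₀ l (ξ n k ω))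
  have hZmeas1 : ∀ n, ∀ k ∈ Finset.range (2 ^ n),
      AEMeasurable (fun ω => ENNReal.ofReal (gaussWeight ε₀ l (ξ n k ω))) P := fun n k hk =>
    ((measurable_gaussWeight ε₀ l).comp_aemeasurable
      (hlaw n k (Finset.mem_range.1 hk)).aemeasurable).ennreal_ofReal
  have hZmeas2 : ∀ n, AEMeasurable (fun ω =>
      ∑ k ∈ Finset.range (2 ^ n), ENNReal.ofReal (gaussWeight ε₀ l (ξ n k ω))) P := fun n =>
    Finset.aemeasurable_fun_sum _ (hZmeas1 n)
  have hZmeas : AEMeasurable Z P := AEMeasurable.tsum hZmeas2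
  have hZint : ∫⁻ ω, Z ω ∂P < ∞ := by
    have hlevel : ∀ n, ∫⁻ ω, ∑ k ∈ Finset.range (2 ^ n),
        ENNReal.ofReal (gaussWeight ε₀ l (ξ n k ω)) ∂P ≤ ENNReal.ofReal ((1 / 2) ^ n) * Γ := by
      intro n
      rw [lintegral_finsetSum' _ (hZmeas1 n)]
      calc ∑ k ∈ Finset.range (2 ^ n), ∫⁻ ω, ENNReal.ofReal (gaussWeight ε₀ l (ξ n k ω)) ∂P
          ≤ ∑ k ∈ Finset.range (2 ^ n), ENNReal.ofReal ((p ^ n) ^ (2 * l)) * Γ := by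
            refine Finset.sum_le_sum fun k hk => ?_
            have hk' := Finset.mem_range.1 hk
            exact lintegral_gaussWeight_le (hlaw n k hk') (hmean n k hk') (hvar n k hk')
              (by positivity) (pow_le_one₀ hp0.le hp1.le) hε₀.le l
        _ = ENNReal.ofReal (2 ^ n * (p ^ n) ^ (2 * l)) * Γ := by
            rw [Finset.sum_const, Finset.card_range, nsmul_eq_mul, ENNReal.ofReal_mul (by positivity),
              mul_assoc]
            congr 1
            rw [ENNReal.ofReal_pow (by norm_num)]
            simp
        _ ≤ _ := by
            gcongr
            rw [← pow_mul, mul_comm n, pow_mul, ← mul_pow]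
            refine pow_le_pow_left₀ (by positivity) ?_ n
            linarith
    have hsum : Summable fun n : ℕ => ((1 : ℝ) / 2) ^ n := summable_geometric_two
    calc ∫⁻ ω, Z ω ∂P = ∑' n, ∫⁻ ω, ∑ k ∈ Finset.range (2 ^ n),
          ENNReal.ofReal (gaussWeight ε₀ l (ξ n k ω)) ∂P := lintegral_tsum hZmeas2
      _ ≤ ∑' n, ENNReal.ofReal ((1 / 2) ^ n) * Γ := ENNReal.tsum_le_tsum hlevel
      _ = (∑' n, ENNReal.ofReal ((1 / 2) ^ n)) * Γ := ENNReal.tsum_mul_right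
      _ < ∞ := by
          refine ENNReal.mul_lt_top ?_ (hfin l)
          rw [← ENNReal.ofReal_tsum_of_nonneg (fun n => by positivity) hsum]
          exact ENNReal.ofReal_lt_top
  refine ⟨fun ω => ENNReal.ofReal (Real.exp ε₀) + Z ω, hZmeas.const_add _, ?_, ?_⟩
  · rw [lintegral_add_left measurable_const, lintegral_const, measure_univ, mul_one]
    exact ENNReal.add_lt_top.2 ⟨ENNReal.ofReal_lt_top, hZint⟩
  · filter_upwards [ae_lt_top' hZmeas hZint.ne, hW.continuous] with ω hZω hcont
    set z := (Z ω).toReal with hz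
    have hz0 : 0 ≤ z := ENNReal.toReal_nonneg
    have he1 : 1 ≤ Real.exp ε₀ + z := by linarith [Real.one_le_exp hε₀.le]
    have hlog : 0 ≤ Real.log (Real.exp ε₀ + z) := Real.log_nonneg he1
    -- `K` solves `exp (ε₀ K²) = exp ε₀ + z`, so it bounds every normalized increment. Chaining
    -- turns it into the Hölder constant `D K`, which accounts for the exponent `ε₀ / D²`.
    set K := Real.sqrt (Real.log (Real.exp ε₀ + z) / ε₀) with hK
    have hK0 : 0 ≤ K := Real.sqrt_nonneg _
    have hK2 : ε₀ * K ^ 2 = Real.log (Real.exp ε₀ + z) := by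
      rw [hK, Real.sq_sqrt (by positivity)]
      field_simp
    have hξ : ∀ n k : ℕ, k < 2 ^ n → |ξ n k ω| ≤ K := by
      intro n k hk
      have h1 : ENNReal.ofReal (gaussWeight ε₀ l (ξ n k ω)) ≤ Z ω := by
        refine le_trans ?_ (ENNReal.le_tsum n)
        exact Finset.single_le_sum
          (f := fun k => ENNReal.ofReal (gaussWeight ε₀ l (ξ n k ω))) (fun _ _ => zero_le)
          (Finset.mem_range.2 hk)
      have h2 : gaussWeight ε₀ l (ξ n k ω) ≤ z := by
        have := ENNReal.toReal_mono hZω.ne h1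
        rwa [ENNReal.toReal_ofReal (gaussWeight_nonneg _ _ _)] at this
      have h3 := (exp_le_add_gaussWeight hε₀.le l (ξ n k ω)).trans
        (add_le_add le_rfl h2)
      have h4 : ε₀ * ξ n k ω ^ 2 ≤ ε₀ * K ^ 2 := by
        rw [hK2]
        exact (Real.le_log_iff_exp_le (by linarith)).2 h3
      exact abs_le_of_sq_le_sq (le_of_mul_le_mul_left h4 hε₀) hK0
    refine ⟨D * K, by positivity, fun u hu v hv huv => ?_, ?_⟩
    · have := hchain (fun t => W t ω) (T ^ H * K) hcont (by positivity) (fun n k hk => ?_) u hu v hv huv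
      · calc _ ≤ _ := this
          _ = _ := by rw [hD]; ring
      · have h1 := hξ n k hk
        simp only [ξ, c, smul_eq_mul] at h1
        rw [abs_mul, abs_of_pos (by positivity), inv_mul_le_iff₀ (by positivity)] at h1
        calc _ ≤ _ := h1
          _ = _ := by ring
    · have e : ε₀ / D ^ 2 * (D * K) ^ 2 = ε₀ * K ^ 2 := by field_simp
      rw [e, hK2, Real.exp_log (by linarith), ENNReal.ofReal_add (Real.exp_pos _).le hz0, hz,
        ENNReal.ofReal_toReal hZω.ne]

end FractionalBrownianMotion

/-! ### Almost sure and `L^p` convergence. -/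

section Convergence

/-- The deterministic part of the convergence theorem: for driving paths with Hölder constant `G`,
the distance between the solution and the delayed solutions is bounded by
`C exp (C (1 + G)^(1/ν))` and tends to zero with the delay. -/
theorem exists_pathwise_bounds {d m : ℕ} {T r₀ H α β δ ρ : ℝ}
    (hT : 0 < T) (hr₀ : 0 < r₀) (hH : H ∈ Ioo (1 / 2 : ℝ) 1)
    {b : ℝ → EuclideanSpace ℝ (Fin d) → EuclideanSpace ℝ (Fin d)}
    {σ : ℝ → EuclideanSpace ℝ (Fin d) → Fin m → EuclideanSpace ℝ (Fin d)}
    {η : ℝ → EuclideanSpace ℝ (Fin d)}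
    (hσ : HypH1 T β δ σ) (hb : HypH2' T ρ b)
    (hβ : 1 - H < β) (hδ : 1 / H - 1 < δ) (hα : 1 - H < α) (hα2 : α < 1 / 2)
    (hηC : MemHolder (1 - α) (-r₀) 0 η) :
    ∃ ν C : ℝ, 1 / 2 < ν ∧ ν < H ∧ 0 ≤ C ∧ ∀ (g : Fin m → ℝ → ℝ) (G : ℝ)
      (x : ℝ → EuclideanSpace ℝ (Fin d)), 0 ≤ G →
      (∀ j, ∀ u ∈ Icc 0 T, ∀ v ∈ Icc 0 T, u ≤ v → |g j v - g j u| ≤ G * (v - u) ^ ν) →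
      IsSolution α T b σ (η 0) g x →
      (∀ r ∈ Ioc 0 r₀, ∀ y, IsDelaySolution α T r b σ η g y →
        wNorm α 0 T (fun t => x t - y t) ≤
          ENNReal.ofReal (C * Real.exp (C * (1 + G) ^ (1 / ν)))) ∧
      ∀ ε > 0, ∃ r₁ > 0, ∀ r ∈ Ioc 0 r₀, r < r₁ → ∀ y, IsDelaySolution α T r b σ η g y →
        wNorm α 0 T (fun t => x t - y t) ≤ ENNReal.ofReal ε := by
  obtain ⟨hH2, hH1⟩ := hH
  have hH0 : 0 < H := by linarith
  have hα0 : 0 < α := by linarith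
  have hδ0 := hσ.δ_mem.1
  set θ := min α β with hθdef
  have hθα : θ ≤ α := min_le_left _ _
  have hθβ : θ ≤ β := min_le_right _ _
  have hθH : 1 - H < θ := lt_min hα hβ
  have hθ : 0 < θ := by linarith
  have hθ2 : θ ≤ 1 / 2 := by linarith
  have hδH : 1 / (1 + δ) < H := by
    rw [div_lt_iff₀ (by linarith)]
    have : 1 / H < 1 + δ := by linarith
    rwa [div_lt_iff₀ hH0, mul_comm] at this
  -- Below `H` there is room for `ν > 1/2`, `ν > 1 - θ` (Young for solutions) and `ν > 1 / (1 + δ)`,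
  -- that is `1 - ν < ν δ`; the last is where `δ > 1/H - 1` enters.
  obtain ⟨ν, hν1, hνH⟩ := exists_between (max_lt hH2 (max_lt (by linarith : 1 - θ < H) hδH))
  have hν : 1 / 2 < ν := (le_max_left _ _).trans_lt hν1
  have hνθ : 1 - θ < ν := ((le_max_left _ _).trans (le_max_right _ _)).trans_lt hν1
  have hνδ : 1 / (1 + δ) < ν := ((le_max_right _ _).trans (le_max_right _ _)).trans_lt hν1
  have hθν : 1 < θ + ν := by linarith
  have hνδ' : 1 - ν < ν * δ := by
    rw [div_lt_iff₀ (by linarith)] at hνδ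
    linarith
  -- `κ > 1 - ν` allows Young's estimate for the difference, `κ < ν δ` the second difference of `σ`,
  -- and `κ < θ` leaves a positive power of the delay.
  obtain ⟨κ, hκ1, hκ2⟩ := exists_between (lt_min (by linarith : 1 - ν < θ) hνδ')
  have hκθ : κ < θ := hκ2.trans_le (min_le_left _ _)
  have hκδ : κ < ν * δ := hκ2.trans_le (min_le_right _ _)
  have hκ0 : 0 < κ := by linarith
  have hνle : ν ≤ 1 := by linarith
  obtain ⟨b₀, M₀, hM₀⟩ := exists_coeffBounds hT.le hσ hb hθ hθβ
  obtain ⟨K, hK0, hηK, hηh⟩ := hηC.exists_bound (by linarith)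
  set M := max M₀ (K * (1 + r₀ ^ (1 - α - θ))) with hM
  have hcb : CoeffBounds T θ M b σ b₀ := hM₀ M (le_max_left _ _)
  have hMK : K * (1 + r₀ ^ (1 - α - θ)) ≤ M := le_max_right _ _
  have hη0 : ‖η 0‖ ≤ M := by
    refine (hηK 0 ⟨by linarith, le_rfl⟩).trans (le_trans ?_ hMK)
    have : 0 ≤ K * r₀ ^ (1 - α - θ) := by positivity
    linarith
  obtain ⟨C, hC1, hC⟩ := exists_apriori_bound_half (E := EuclideanSpace ℝ (Fin d)) m hT.le hθ hθ2
    hν hνle hθν hcb.one_le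
  set c := T ^ (1 / 2 - α) / (1 / 2 - α) with hc
  have hα2' : 0 < 1 / 2 - α := by linarith
  have hc0 : 0 ≤ c := by positivity
  set C' := C * (2 + 2 * c) with hC'
  have hCC' : C ≤ C' := by nlinarith
  refine ⟨ν, C', hν, hνH, by linarith, fun g G x hG hg hx => ?_⟩
  have hxp : DelayPath T 0 θ M b σ g x :=
    hx.delayPath hT hcb hα0 hα2.le hθ hθα hθν hG hg hη0
  have hx0 := hx.apply_zero hT.le
  obtain ⟨hx1, hx2, hx3⟩ := hC b σ b₀ g x 0 G hcb le_rfl hG hg hxp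
  simp only [neg_zero] at hx1 hx2
  set z := (1 + G) ^ (1 / ν) with hz
  have hz0 : 0 ≤ z := by positivity
  set R := C * Real.exp (C * z) with hR
  have hR0 : 0 ≤ R := by positivity
  have hyp : ∀ r ∈ Ioc 0 r₀, ∀ y, IsDelaySolution α T r b σ η g y → DelayPath T r θ M b σ g y :=
    fun r hr y hy => hy.delayPath hT hr.1 hr.2 hα0 hα2.le hθ hθα hK0 hηK hηh hMK
  refine ⟨fun r hr y hy => ?_, fun ε hε => ?_⟩
  · obtain ⟨hy1, -, hy3⟩ := hC b σ b₀ g y r G hcb hr.1.le hG hg (hyp r hr y hy)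
    refine (wNorm_le_of_holder (κ := 1 / 2) (a := 2 * R) (B := 2 * R) hα2 (by positivity)
      (fun t ht => ?_) (fun s t hs hst ht => ?_)).trans (ENNReal.ofReal_le_ofReal ?_)
    · refine (norm_sub_le _ _).trans ?_
      linarith [hx1 t ht, hy1 t ⟨by linarith [hr.1, ht.1], ht.2⟩]
    · have e : (x t - y t) - (x s - y s) = (x t - x s) - (y t - y s) := by abel
      rw [e]
      refine (norm_sub_le _ _).trans ?_
      linarith [hx3 s t hs hst ht, hy3 s t hs hst ht]
    · calc 2 * R + 2 * R * c = C' * Real.exp (C * z) := by rw [hR, hC']; ring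
        _ ≤ C' * Real.exp (C' * z) := by gcongr
  · obtain ⟨M', hM'⟩ := exists_localBounds hT.le hσ hb hθ hθβ hR0
    obtain ⟨r₁, hr₁, h₁⟩ := exists_wNorm_sub_le hcb hM' hT.le hα0.le hα2 hδ0.le hκ0 hκθ hκδ.le
      (by linarith) (by linarith) hνle (by linarith) hG hg hxp hx1 hx2 hx3 hε
    refine ⟨r₁, hr₁, fun r hr hrr y hy => ?_⟩
    obtain ⟨hy1, hy2, hy3⟩ := hC b σ b₀ g y r G hcb hr.1.le hG hg (hyp r hr y hy)
    exact h₁ r y hr.1 hrr (hyp r hr y hy) hy1 hy2 hy3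
      (by rw [hx0]; exact hy.initial 0 ⟨by linarith [hr.1], le_rfl⟩)

/-- The largest of the finitely many constants serves all components, and the sum of the dominating
variables covers it. The summand `1` handles `m = 0`, where `G = 0`. -/
theorem exists_common_holder_const {Ω : Type*} [MeasurableSpace Ω] {P : Measure Ω}
    [IsProbabilityMeasure P] {m : ℕ} {H T ν : ℝ} (hT : 0 < T) (hH : 0 < H) (hν : 0 < ν)
    (hνH : ν < H) {W : Fin m → ℝ → Ω → ℝ} (hW : ∀ j, IsFractionalBrownianMotion P H T (W j)) :
    ∃ (ε : ℝ) (S : Ω → ℝ≥0∞), 0 < ε ∧ ∫⁻ ω, S ω ∂P < ∞ ∧ ∀ᵐ ω ∂P, ∃ G : ℝ, 0 ≤ G ∧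
      (∀ j, ∀ u ∈ Icc 0 T, ∀ v ∈ Icc 0 T, u ≤ v → |W j v ω - W j u ω| ≤ G * (v - u) ^ ν) ∧
      ENNReal.ofReal (Real.exp (ε * G ^ 2)) ≤ S ω := by
  obtain ⟨ε, hε, h⟩ := exists_holder_const_fractionalBrownianMotion (P := P) hT hH hν hνH
  choose S hSm hSi hS using fun j => h (W j) (hW j)
  refine ⟨ε, fun ω => 1 + ∑ j, S j ω, hε, ?_, ?_⟩
  · rw [lintegral_add_left measurable_const, lintegral_finsetSum' _ fun j _ => hSm j]
    simp only [lintegral_const, measure_univ, mul_one]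
    exact ENNReal.add_lt_top.2 ⟨ENNReal.one_lt_top, ENNReal.sum_lt_top.2 fun j _ => hSi j⟩
  · filter_upwards [ae_all_iff.2 hS] with ω hω
    choose G hG0 hG hGS using hω
    rcases isEmpty_or_nonempty (Fin m) with he | hne
    · exact ⟨0, le_rfl, fun j => he.elim j, by simp⟩
    · obtain ⟨i, -, hi⟩ := Finset.exists_max_image Finset.univ G Finset.univ_nonempty
      refine ⟨G i, hG0 i, fun j u hu v hv huv => (hG j u hu v hv huv).trans ?_, ?_⟩
      · exact mul_le_mul_of_nonneg_right (hi j (Finset.mem_univ j))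
          (Real.rpow_nonneg (by linarith) _)
      · refine (hGS i).trans (le_trans ?_ le_add_self)
        exact Finset.single_le_sum (f := fun j => S j ω) (fun _ _ => zero_le) (Finset.mem_univ i)

/-- A power with exponent less than two is dominated by a square. -/
theorem exists_mul_rpow_le_mul_sq {c q ε : ℝ} (hc : 0 ≤ c) (hq : 0 ≤ q) (hq2 : q < 2)
    (hε : 0 < ε) : ∃ A : ℝ, ∀ G : ℝ, 0 ≤ G → c * (1 + G) ^ q ≤ ε * G ^ 2 + A := by
  set Y := (2 * c / ε) ^ (1 / (2 - q)) with hY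
  have hq2' : 0 < 2 - q := by linarith
  have hY0 : 0 ≤ Y := by positivity
  have hA : 0 ≤ c * Y ^ q := by positivity
  refine ⟨ε + c * Y ^ q, fun G hG => ?_⟩
  set y := 1 + G with hy
  have hy0 : 0 < y := by linarith
  have hsq : ε / 2 * y ^ 2 ≤ ε * G ^ 2 + ε := by
    rw [hy]
    nlinarith [mul_nonneg hε.le (sq_nonneg (G - 1))]
  rcases le_total y Y with h | h
  · have : c * y ^ q ≤ c * Y ^ q := by gcongr
    have : 0 ≤ ε * G ^ 2 := by positivity
    linarith
  · have h1 : 2 * c / ε ≤ y ^ (2 - q) := by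
      calc 2 * c / ε = Y ^ (2 - q) := by
            rw [hY, ← Real.rpow_mul (by positivity), one_div_mul_cancel hq2'.ne', Real.rpow_one]
        _ ≤ y ^ (2 - q) := Real.rpow_le_rpow hY0 h hq2'.le
    have h2 : c ≤ ε / 2 * y ^ (2 - q) := by
      rw [div_le_iff₀ hε] at h1
      linarith
    have h3 : c * y ^ q ≤ ε / 2 * y ^ 2 := by
      calc c * y ^ q ≤ ε / 2 * y ^ (2 - q) * y ^ q := by gcongr
        _ = ε / 2 * y ^ 2 := by
            rw [mul_assoc, ← Real.rpow_add hy0, sub_add_cancel, Real.rpow_two]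
    linarith

/-- Since `1 / ν < 2`, the exponent of any power of the a priori bound grows more slowly than `ε
G²`. -/
theorem exists_ofReal_exp_rpow_le {C ν p ε : ℝ} (hC : 0 ≤ C) (hν : 1 / 2 < ν) (hp : 0 ≤ p)
    (hε : 0 < ε) : ∃ A : ℝ, ∀ G : ℝ, 0 ≤ G →
      ENNReal.ofReal (C * Real.exp (C * (1 + G) ^ (1 / ν))) ^ p ≤
        ENNReal.ofReal A * ENNReal.ofReal (Real.exp (ε * G ^ 2)) := by
  have hν0 : 0 < ν := by linarith
  obtain ⟨A, hA⟩ := exists_mul_rpow_le_mul_sq (c := C * p) (q := 1 / ν) (by positivity)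
    (by positivity) (by rw [div_lt_iff₀ hν0]; linarith) hε
  refine ⟨C ^ p * Real.exp A, fun G hG => ?_⟩
  rw [ENNReal.ofReal_rpow_of_nonneg (by positivity) hp, ← ENNReal.ofReal_mul (by positivity)]
  refine ENNReal.ofReal_le_ofReal ?_
  rw [Real.mul_rpow hC (Real.exp_pos _).le, ← Real.exp_mul, mul_assoc (C ^ p), ← Real.exp_add]
  refine mul_le_mul_of_nonneg_left (Real.exp_le_exp.2 ?_) (by positivity)
  linarith [hA G hG]

theorem tendsto_zero_of_forall_le_ofReal {ι : Type*} {l : Filter ι} {f : ι → ℝ≥0∞}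
    (h : ∀ ε > 0, ∀ᶠ i in l, f i ≤ ENNReal.ofReal ε) : Tendsto f l (𝓝 0) := by
  rw [ENNReal.tendsto_nhds_zero]
  intro ε hε
  rcases eq_or_ne ε ∞ with rfl | htop
  · exact Eventually.of_forall fun _ => le_top
  · have := h ε.toReal (ENNReal.toReal_pos hε.ne' htop)
    rwa [ENNReal.ofReal_toReal htop] at this

/-- Dominated convergence to zero for lower integrals of possibly non-measurable functions. -/
theorem tendsto_lintegral_zero_of_dominated {Ω : Type*} [MeasurableSpace Ω] {P : Measure Ω}
    {F : ℕ → Ω → ℝ≥0∞} (S : Ω → ℝ≥0∞) (hS : ∫⁻ ω, S ω ∂P ≠ ∞)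
    (hFS : ∀ᶠ n in atTop, ∀ᵐ ω ∂P, F n ω ≤ S ω)
    (hF : ∀ᵐ ω ∂P, Tendsto (fun n => F n ω) atTop (𝓝 0)) :
    Tendsto (fun n => ∫⁻ ω, F n ω ∂P) atTop (𝓝 0) := by
  -- Each `F n` has a measurable minorant with the same lower integral, so ordinary dominated
  -- convergence applies to the minorants.
  choose f hfm hfF hf using fun n => exists_measurable_le_lintegral_eq P (F n)
  have := tendsto_lintegral_filter_of_dominated_convergence (μ := P) (l := atTop) (F := f)
    (f := fun _ => 0) S (Eventually.of_forall hfm)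
    (hFS.mono fun n hn => hn.mono fun ω hω => (hfF n ω).trans hω) hS
    (hF.mono fun ω hω => tendsto_of_tendsto_of_tendsto_of_le_of_le tendsto_const_nhds hω
      (fun _ => zero_le) fun n => hfF n ω)
  simpa [hf] using this

end Convergence
end DelayFBM

theorem theorem1p2 {d m : ℕ} {Ω : Type*} [MeasurableSpace Ω] (P : Measure Ω)
    [IsProbabilityMeasure P] (T r₀ H α β δ ρ : ℝ)
    (hT : 0 < T) (hr₀ : 0 < r₀) (hH : H ∈ Ioo (1 / 2 : ℝ) 1)
    -- the driving fractional Brownian motions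
    (W : Fin m → ℝ → Ω → ℝ)
    (hW : ∀ j, IsFractionalBrownianMotion P H T (W j))
    (hWindep : iIndepFun (fun (j : Fin m) (ω : Ω) (t : Icc (0 : ℝ) T) => W j t ω) P)
    -- the coefficients and the initial path
    (b : ℝ → EuclideanSpace ℝ (Fin d) → EuclideanSpace ℝ (Fin d))
    (σ : ℝ → EuclideanSpace ℝ (Fin d) → Fin m → EuclideanSpace ℝ (Fin d))
    (η : ℝ → EuclideanSpace ℝ (Fin d))
    (hσ : HypH1 T β δ σ) (hb : HypH2' T ρ b)
    (hβ : 1 - H < β) (hδ : 1 / H - 1 < δ) (hα : 1 - H < α) (hρ : ρ ≤ 1 / α)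
    (hηW : MemW α (-r₀) 0 η) (hηC : MemHolder (1 - α) (-r₀) 0 η)
    -- the solution of the equation without delay
    (X : ℝ → Ω → EuclideanSpace ℝ (Fin d))
    (hXmeas : ∀ t ∈ Icc 0 T, AEMeasurable (X t) P)
    (hX : ∀ᵐ ω ∂P, IsSolution α T b σ (η 0) (fun j t => W j t ω) (fun t => X t ω))
    -- the solutions of the delay equations
    (Xr : ℝ → ℝ → Ω → EuclideanSpace ℝ (Fin d))
    (hXrmeas : ∀ r ∈ Ioc 0 r₀, ∀ t ∈ Icc (-r) T, AEMeasurable (Xr r t) P)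
    (hXr : ∀ r ∈ Ioc 0 r₀, ∀ᵐ ω ∂P,
      IsDelaySolution α T r b σ η (fun j t => W j t ω) (fun t => Xr r t ω)) :
    -- almost sure convergence, the paths `Xr r · ω` being solutions for all `r` simultaneously
    (α < min (1 / 2) (min β (δ / (1 + δ))) →
      (∀ᵐ ω ∂P, ∀ r ∈ Ioc 0 r₀,
        IsDelaySolution α T r b σ η (fun j t => W j t ω) (fun t => Xr r t ω)) →
      ∀ᵐ ω ∂P, Tendsto (fun r => wNorm α 0 T (fun t => X t ω - Xr r t ω)) (𝓝[>] 0) (𝓝 0)) ∧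
    -- convergence in `L^p`
    (∀ γ : ℝ, HypH3 T γ σ →
      α < max (min (1 / 2) (min β (δ / (1 + δ)))) ((2 - γ) / 4) →
      ∀ p : ℝ, 1 ≤ p →
        Tendsto (fun r => ∫⁻ ω, (wNorm α 0 T (fun t => X t ω - Xr r t ω)) ^ p ∂P)
          (𝓝[>] 0) (𝓝 0)) := by
  have hα0 : 0 < α := by linarith [hH.2]
  have half : α < 1 / 2 →
      ((∀ᵐ ω ∂P, ∀ r ∈ Ioc 0 r₀,
        IsDelaySolution α T r b σ η (fun j t => W j t ω) (fun t => Xr r t ω)) →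
      ∀ᵐ ω ∂P, Tendsto (fun r => wNorm α 0 T (fun t => X t ω - Xr r t ω)) (𝓝[>] 0) (𝓝 0)) ∧
      ∀ p : ℝ, 1 ≤ p →
        Tendsto (fun r => ∫⁻ ω, (wNorm α 0 T (fun t => X t ω - Xr r t ω)) ^ p ∂P)
          (𝓝[>] 0) (𝓝 0) := by
    intro hα2
    obtain ⟨ν, C, hν, hνH, hC, hpath⟩ :=
      exists_pathwise_bounds hT hr₀ hH hσ hb hβ hδ hα hα2 hηC
    obtain ⟨ε, S, hε, hS, hSG⟩ := exists_common_holder_const hT (by linarith [hH.1])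
      (by linarith) hνH hW
    refine ⟨fun hall => ?_, fun p hp => ?_⟩
    · filter_upwards [hX, hSG, hall] with ω hXω hGω hallω
      obtain ⟨G, hG0, hG, -⟩ := hGω
      obtain ⟨-, hconv⟩ := hpath (fun j t => W j t ω) G (fun t => X t ω) hG0 hG hXω
      refine tendsto_zero_of_forall_le_ofReal fun ε hε => ?_
      obtain ⟨r₁, hr₁, h₁⟩ := hconv ε hε
      filter_upwards [Ioc_mem_nhdsGT hr₀, Ioo_mem_nhdsGT hr₁] with r hr hrr
      exact h₁ r hr hrr.2 _ (hallω r hr)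
    · obtain ⟨A, hA⟩ := exists_ofReal_exp_rpow_le hC hν (by linarith : 0 ≤ p) hε
      -- The null set off which `Xr r` solves its equation may depend on `r`; along a sequence of
      -- delays the countable union is still null.
      refine tendsto_of_seq_tendsto fun u hu => ?_
      have hmem : ∀ᶠ n in atTop, u n ∈ Ioc 0 r₀ := hu.eventually (Ioc_mem_nhdsGT hr₀)
      refine tendsto_lintegral_zero_of_dominated (fun ω => ENNReal.ofReal A * S ω) ?_ ?_ ?_
      · rw [lintegral_const_mul' _ _ ENNReal.ofReal_ne_top]
        exact ENNReal.mul_ne_top ENNReal.ofReal_ne_top hS.ne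
      · filter_upwards [hmem] with n hn
        filter_upwards [hX, hSG, hXr (u n) hn] with ω hXω hGω hXrω
        obtain ⟨G, hG0, hG, hGS⟩ := hGω
        obtain ⟨hbd, -⟩ := hpath (fun j t => W j t ω) G (fun t => X t ω) hG0 hG hXω
        refine (ENNReal.rpow_le_rpow (hbd (u n) hn _ hXrω) (by linarith)).trans ((hA G hG0).trans ?_)
        gcongr
      · have hall : ∀ᵐ ω ∂P, ∀ n, u n ∈ Ioc 0 r₀ →
            IsDelaySolution α T (u n) b σ η (fun j t => W j t ω) (fun t => Xr (u n) t ω) := by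
          refine ae_all_iff.2 fun n => ?_
          by_cases hn : u n ∈ Ioc 0 r₀
          · exact (hXr (u n) hn).mono fun ω hω _ => hω
          · exact ae_of_all _ fun ω h => absurd h hn
        filter_upwards [hX, hSG, hall] with ω hXω hGω hallω
        obtain ⟨G, hG0, hG, -⟩ := hGω
        obtain ⟨-, hconv⟩ := hpath (fun j t => W j t ω) G (fun t => X t ω) hG0 hG hXω
        have hlim : Tendsto (fun n => wNorm α 0 T (fun t => X t ω - Xr (u n) t ω)) atTop (𝓝 0) := by
          refine tendsto_zero_of_forall_le_ofReal fun ε hε => ?_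
          obtain ⟨r₁, hr₁, h₁⟩ := hconv ε hε
          filter_upwards [hmem, hu.eventually (Ioo_mem_nhdsGT hr₁)] with n hn hnr
          exact h₁ (u n) hn hnr.2 _ (hallω n hn)
        have := (ENNReal.continuous_rpow_const (y := p)).tendsto 0 |>.comp hlim
        rwa [ENNReal.zero_rpow_of_pos (by linarith)] at this
  -- Both ranges of `α` lie below `1/2`: the first by definition of the minimum, the second because
  -- `γ ≥ 0` gives `(2 - γ) / 4 ≤ 1/2`.
  refine ⟨fun hα₁ => (half (hα₁.trans_le (min_le_left _ _))).1, fun γ hγ hα₁ => ?_⟩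
  refine (half (hα₁.trans_le (max_le (min_le_left _ _) ?_))).2
  linarith [hγ.1.1]
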